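/- Let $\mathbb F_q$ be a finite field with $q$ elements, $A=\mathbb F_q[T]$, $k=\mathbb F_q(T)$, $\bar k$ an algebraic closure of $k$, and $\tau(z)=z^q$. **Heights.** The places of $k$ are normalised by $v(x)=\deg(l)\,\mathrm{ord}_l(x)$ for $l\in A$ monic irreducible, and $v(x)=-\deg x$ at $\infty$. For a finite extension $E/k$, a place $w$ of $E$ is a valuation that extends one of these $v$, and $n_w=e_wf_w$ is its local degree (ramification index times inertia degree). For $b=(b_1,\dots,b_m)\in\bar k^m$ put $h(b)=\frac{1}{[k(b):k]}\sum_{w}n_w\max_i\{0,-w(b_i)\}$, the sum being over the places $w$ of $k(b)$. **Drinfeld modules.** A Drinfeld module $\Phi$ of rank $d\ge1$ is the homomorphism of $\mathbb F_q$-algebras from $A$ to the ring $\bar k\{\tau\}$ of additive polynomials with $\Phi(T)=\sum_{i=0}^d a_i\tau^i$, where $a_i\in\bar k$, $a_0=T$, $a_d\ne0$. Put $k(\Phi)=k(a_1,\dots,a_d)$, $c(\Phi)=[k(\Phi):k]$, $h(\Phi)=h(a_0,\dots,a_d)$ and $\alpha=h(\Phi)c(\Phi)$. A point $x\in\bar k$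 is torsion if $\Phi(a)(x)=0$ for some $a\in A\setminus\{0\}$. The canonical height is $\hat h(x)=\lim_{n\to\infty}h(\Phi(T^n)(x))/q^{dn}$. **The condition RV.** A monic irreducible $l\in A$ is RV (with respect to $\Phi$) if at every place $w$ of $k(\Phi)$ above $l$ all $a_i$ are integral, $\Phi(l)(X)\equiv X^{q^{d\deg l}}$ modulo $w$, and the inertia degree of $w$ over $l$ is $1$. For $0<r\le1$, $\Phi$ is RV$(r)$ if for every integer $N\ge1$ there are at least $\frac{1}{2r}\frac{q^{rN}}{N}$ RV polynomials $l$ of degree $N$; it is RV$(r)^*$ if this holds for all sufficiently large $N$. With $\log$ the logarithm to the base $q$, put $\log_+D=\max\{\log D,1\}$ and $\log\log_+D=\max\{\log\log D,1\}$ (so $\log\log_+1=1$). **Theorem.** Let $\Phi$ be a Drinfeld module of rank $d$ and let $0<r\le1$. The limit defining $\hat h(x)$ exists for all $x\in\bar k$. Put $$c_0=6500\,d\,h(\Phi)^3c(\Phi)^3q^{d+rh(\Phi)c(\Phi)},$$ $$C_0=\min\left\{q^{-5d(2(d+1)h(\Phi)+1)\left((q^{q+d+1}-1)c(\Phi)\right)^2},\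 \frac{h(\Phi)c(\Phi)}{768\,r\,q^d\,c_0^{\,1+\frac{4d}{r}h(\Phi)c(\Phi)}}\right\}.$$ 1. If $\Phi$ is RV$(r)$, then every non-torsion point $x\in\bar k$ that is separable over $k$, of degree $D=[k(x):k]$, satisfies $$\hat h(x)\ \ge\ C_0\,\frac{(\log\log_+D)^{2+d\alpha/r}}{D\,(\log_+D)^{1+2d\alpha/r}}.$$ 2. If $\Phi$ is RV$(r)^*$, then there is a constant $C$ with $0<C\le C_0$, depending only on $\Phi$ and $r$, such that every non-torsion point $x\in\bar k$ that is separable over $k$, of degree $D=[k(x):k]$, satisfies $$\hat h(x)\ \ge\ C\,\frac{(\log\log_+D)^{2+d\alpha/r}}{D\,(\log_+D)^{1+2d\alpha/r}}.$$ -/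

import Mathlib

open Polynomial Filter Topology IsDedekindDomain
open scoped NNReal IntermediateField WithZero

noncomputable section

namespace DrinfeldLehmer

/-- The algebraic closure of `k = F(T)`; here `k` is `RatFunc F`, the fraction field of `F[T]`. -/
abbrev Bar (F : Type*) [Field F] : Type _ := AlgebraicClosure (RatFunc F)

/-- The number of elements of the constant field. -/
def q (F : Type*) [Fintype F] : ℕ := Fintype.card F

/-- The field `k(b)` generated over `k` by a family of algebraic elements. -/
abbrev fieldOf {F : Type*} [Field F] {ι : Type*} (b : ι → Bar F) : IntermediateField (RatFunc F) (Bar F) :=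
  IntermediateField.adjoin (RatFunc F) (Set.range b)

/-- The family `b`, seen in `k(b)`. -/
def toFieldOf {F : Type*} [Field F] {ι : Type*} (b : ι → Bar F) (i : ι) : fieldOf b :=
  ⟨b i, IntermediateField.subset_adjoin _ _ ⟨i, rfl⟩⟩

/-- The degree `[k(x) : k]`. -/
def degree {F : Type*} [Field F] (x : Bar F) : ℕ := Module.finrank (RatFunc F) (RatFunc F)⟮x⟯

/-! ### Places and heights -/

section Places

variable (F : Type*) [Field F] [Fintype F]

/-- The set of monic irreducible polynomials of `F[T]`. -/
abbrev MonicPrime : Type _ := {l : F[X] // l.Monic ∧ Irreducible l}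

/-- A place of `k = F(T)`: `some l` is the `l`-adic place, `none` is the place at infinity. -/
abbrev BasePlace : Type _ := Option (MonicPrime F)

variable {F}

/-- The prime ideal of `F[T]` generated by a monic irreducible polynomial. -/
def MonicPrime.spec (l : MonicPrime F) : HeightOneSpectrum F[X] where
  asIdeal := Ideal.span {l.1}
  isPrime := (Ideal.span_singleton_prime l.2.2.ne_zero).2 l.2.2.prime
  ne_bot := by simpa using l.2.2.ne_zero

theorem one_lt_q_pow {n : ℕ} (hn : 0 < n) : (1 : ℝ≥0) < (q F : ℝ≥0) ^ n :=
  one_lt_pow₀ (by exact_mod_cast Fintype.one_lt_card (α := F)) hn.ne'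

/-- A valuation with values in `ℤᵐ⁰`, turned into a real absolute value: `exp n` becomes
`q ^ (m * n)`. -/
def realVal (v : Valuation (RatFunc F) ℤᵐ⁰) {m : ℕ} (hm : 0 < m) : Valuation (RatFunc F) ℝ≥0 :=
  v.map (WithZeroMulInt.toNNReal (zero_lt_one.trans (one_lt_q_pow (F := F) hm)).ne')
    (WithZeroMulInt.toNNReal_strictMono (one_lt_q_pow hm)).monotone

open scoped Classical in
/-- The normalised absolute value of a place `v` of `k`, i.e. `x ↦ q ^ (- v x)`, where
`v x = deg l * ord_l x` for the `l`-adic place and `v x = - deg x` at infinity. -/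
def BasePlace.val : BasePlace F → Valuation (RatFunc F) ℝ≥0
  | some l => realVal (l.spec.valuation (RatFunc F)) l.2.2.natDegree_pos
  | none => realVal (RatFunc.inftyValuation F) one_pos

variable (F) in
/-- A place of an extension `E` of `k`: an extension `w` to `E` of one of the normalised
places `v` of `k`, written as the absolute value `x ↦ q ^ (- w x)`. -/
structure Place (E : Type*) [Field E] [Algebra (RatFunc F) E] where
  /-- the place of `k` below -/
  base : BasePlace F
  /-- the absolute value `x ↦ q ^ (- w x)` -/
  val : Valuation E ℝ≥0
  val_algebraMap : ∀ x : RatFunc F, val (algebraMap (RatFunc F) E x) = base.val x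

namespace Place

variable {E : Type*} [Field E] [Algebra (RatFunc F) E] (w : Place F E)

instance : w.base.val.HasExtension w.val where
  val_isEquiv_comap := by
    have h : w.val.comap (algebraMap (RatFunc F) E) = w.base.val :=
      Valuation.ext fun x => w.val_algebraMap x
    rw [h]
    exact Valuation.IsEquiv.refl

/-- The ramification index `e_w`, the index of the value group of `k` in that of `E`. -/
def ramificationIndex : ℕ :=
  (Units.map (w.base.val : RatFunc F →* ℝ≥0)).range.relIndex
    (Units.map (w.val : E →* ℝ≥0)).range

/-- The inertia degree `f_w`, the degree of the residue field extension. -/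
def inertiaDegree : ℕ :=
  Module.finrank (IsLocalRing.ResidueField w.base.val.valuationSubring)
    (IsLocalRing.ResidueField w.val.valuationSubring)

/-- The local degree `n_w = e_w * f_w`. -/
def localDegree : ℕ := w.ramificationIndex * w.inertiaDegree

/-- The additive valuation `w x` (for `x ≠ 0`; the value at `0`, which ought to be `+∞`,
is `0` here, which does not matter in `max {0, - w x}`). -/
def ord (x : E) : ℝ := - Real.logb (q F) (w.val x)

end Place

variable (F) in
/-- `(1 / [E : k]) * ∑_w n_w * max_i {0, - w (b i)}`, the sum being over all places of `E`. -/
def heightIn (E : Type*) [Field E] [Algebra (RatFunc F) E] {ι : Type*} (b : ι → E) : ℝ :=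
  (Module.finrank (RatFunc F) E : ℝ)⁻¹ *
    ∑ᶠ w : Place F E, (w.localDegree : ℝ) * ⨆ i, max 0 (- w.ord (b i))

/-- The logarithmic height of the affine point `b`, i.e. of the projective point `[1 : b]`. -/
def affineHeight {ι : Type*} (b : ι → Bar F) : ℝ := heightIn F (fieldOf b) (toFieldOf b)

/-- The Weil height `h(x)` of an algebraic element. -/
def weilHeight (x : Bar F) : ℝ := affineHeight fun _ : Unit => x

end Places

/-! ### Drinfeld modules -/

section Action

variable {F : Type*} [Field F] [Fintype F] {E : Type*} [Field E] [Algebra F E] {d : ℕ}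

/-- The additive polynomial `Φ(T)(X) = ∑ a_i X ^ (q ^ i)`. -/
def tPoly (F : Type*) [Fintype F] {E : Type*} [Field E] {d : ℕ} (a : Fin (d + 1) → E) : E[X] :=
  ∑ i, C (a i) * X ^ (q F ^ (i : ℕ))

/-- The additive polynomial `Φ(f)(X)` for `f ∈ F[T]`: if `f = ∑ b_n T ^ n`, then
`Φ(f)(X) = ∑ b_n Φ(T)^{∘ n}(X)`. -/
def actionPoly (a : Fin (d + 1) → E) (f : F[X]) : E[X] :=
  f.sum fun n b => C (algebraMap F E b) * (tPoly F a).comp^[n] X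

/-- The `F`-linear operator `∑ a_i τ ^ i`, with `τ` the `q`-Frobenius. -/
def tOp (a : Fin (d + 1) → E) : Module.End F E :=
  ∑ i, LinearMap.mulLeft F (a i) * (FiniteField.frobeniusAlgHom F E).toLinearMap ^ (i : ℕ)

end Action

/-- A Drinfeld module `Φ` of rank `d ≥ 1` over the algebraic closure of `k = F(T)`, given by
`Φ(T) = a_0 + a_1 τ + ... + a_d τ ^ d` with `a_0 = T` and `a_d ≠ 0`. -/
structure DrinfeldModule (F : Type*) [Field F] (d : ℕ) where
  rank_pos : 0 < d
  /-- the coefficients `a_0, ..., a_d` of `Φ(T)` -/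
  coeff : Fin (d + 1) → Bar F
  coeff_zero : coeff 0 = algebraMap (RatFunc F) (Bar F) RatFunc.X
  coeff_last : coeff (Fin.last d) ≠ 0

namespace DrinfeldModule

variable {F : Type*} [Field F] [Fintype F] {d : ℕ} (Φ : DrinfeldModule F d)

/-- The homomorphism of `F`-algebras `Φ : F[T] → End_F`, the one with `Φ(T) = ∑ a_i τ ^ i`. -/
def hom : F[X] →ₐ[F] Module.End F (Bar F) := Polynomial.aeval (tOp Φ.coeff)

/-- The operator `Φ(f)` is the one induced by the polynomial `Φ(f)(X)`. -/
theorem eval_actionPoly (f : F[X]) (x : Bar F) :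
    (actionPoly Φ.coeff f).eval x = Φ.hom f x := by
  have hτ : ∀ (n : ℕ) (y : Bar F),
      ((FiniteField.frobeniusAlgHom F (Bar F)).toLinearMap ^ n) y = y ^ (q F ^ n) := by
    intro n
    induction n with
    | zero => intro y; simp
    | succ n ih => intro y; simp [pow_succ, ih, q, ← pow_mul, mul_comm]
  have hT : ∀ y : Bar F, (tPoly F Φ.coeff).eval y = tOp (F := F) Φ.coeff y := by
    intro y
    simp [tPoly, tOp, eval_finsetSum, hτ]
  have hn : ∀ (n : ℕ), ((tPoly F Φ.coeff).comp^[n] X).eval x = (tOp (F := F) Φ.coeff ^ n) x := by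
    intro n
    rw [iterate_comp_eval, eval_X, Module.End.pow_apply]
    exact congrFun (congrArg (fun g => g^[n]) (funext hT)) x
  rw [hom, aeval_endomorphism, actionPoly, Polynomial.sum, Polynomial.sum, eval_finsetSum]
  refine Finset.sum_congr rfl fun n _ => ?_
  rw [eval_mul, eval_C, hn, Algebra.smul_def]

/-- `x` is a torsion point: `Φ(f)(x) = 0` for some `f ≠ 0`. -/
def IsTorsion (x : Bar F) : Prop := ∃ f : F[X], f ≠ 0 ∧ Φ.hom f x = 0

/-- The coefficient field `k(Φ) = k(a_0, ..., a_d) = k(a_1, ..., a_d)`. -/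
abbrev coeffField : IntermediateField (RatFunc F) (Bar F) := fieldOf Φ.coeff

/-- `c(Φ) = [k(Φ) : k]`. -/
def fieldDegree : ℕ := Module.finrank (RatFunc F) Φ.coeffField

/-- `h(Φ)`, the height of the coefficients `a_0, ..., a_d`. -/
def height : ℝ := affineHeight Φ.coeff

/-- The sequence `n ↦ h(Φ(T ^ n)(x)) / q ^ (d * n)`. -/
def heightSeq (x : Bar F) (n : ℕ) : ℝ := weilHeight (Φ.hom (X ^ n) x) / (q F : ℝ) ^ (d * n)

/-- The canonical height, the limit of `h(Φ(T ^ n)(x)) / q ^ (d * n)`. -/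
def canonicalHeight (x : Bar F) : ℝ := limUnder atTop (Φ.heightSeq x)

/-- The property RV of a monic irreducible `l` with respect to `Φ`: at all places `w` of `k(Φ)`
above `l`, the coefficients of `Φ` are integral,
`Φ(l)(X) ≡ X ^ (q ^ (d * deg l))` modulo `w`, and the inertia degree is `1`. -/
def PrimeRV (l : MonicPrime F) : Prop :=
  ∀ w : Place F Φ.coeffField, w.base = some l →
    (∀ i, w.val (toFieldOf Φ.coeff i) ≤ 1) ∧
    (∀ n, w.val ((actionPoly (toFieldOf Φ.coeff) l.1 -
      X ^ (q F ^ (d * l.1.natDegree))).coeff n) < 1) ∧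
    w.inertiaDegree = 1

/-- The number of monic irreducible `l` of degree `N` with the property RV. -/
def countRV (N : ℕ) : ℕ := {l : MonicPrime F | l.1.natDegree = N ∧ Φ.PrimeRV l}.ncard

/-- `Φ` is RV(r, c₁). -/
def IsRVWith (r c₁ : ℝ) : Prop :=
  ∀ N : ℕ, 0 < N → c₁ * ((q F : ℝ) ^ (r * N) / N) ≤ Φ.countRV N

/-- `Φ` is RV(r, c₁)*. -/
def IsRVStarWith (r c₁ : ℝ) : Prop :=
  ∃ N₀ : ℕ, 0 < N₀ ∧ ∀ N : ℕ, N₀ ≤ N → c₁ * ((q F : ℝ) ^ (r * N) / N) ≤ Φ.countRV N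

/-- `Φ` is RV(r). -/
def IsRV (r : ℝ) : Prop := Φ.IsRVWith r (1 / (2 * r))

/-- `Φ` is RV(r)*. -/
def IsRVStar (r : ℝ) : Prop := Φ.IsRVStarWith r (1 / (2 * r))

/-- `α = h(Φ) c(Φ)`. -/
def alpha : ℝ := Φ.height * Φ.fieldDegree

/-- `c₀ = 6500 d h(Φ)³ c(Φ)³ q ^ (d + r h(Φ) c(Φ))`. -/
def c0 (r : ℝ) : ℝ :=
  6500 * d * Φ.height ^ 3 * (Φ.fieldDegree : ℝ) ^ 3 * (q F : ℝ) ^ (d + r * Φ.alpha)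

/-- The explicit constant `C₀`. -/
def bigC0 (r : ℝ) : ℝ :=
  min
    ((q F : ℝ) ^ (-(5 * d * (2 * (d + 1) * Φ.height + 1) *
      (((q F : ℝ) ^ (q F + d + 1) - 1) * Φ.fieldDegree) ^ 2)))
    (Φ.alpha / (768 * r * (q F : ℝ) ^ d * Φ.c0 r ^ (1 + 4 * d / r * Φ.alpha)))

end DrinfeldModule

/-- `log₊ D = max {log D, 1}`, with the logarithm to the base `q`. -/
def logPlus (F : Type*) [Fintype F] (D : ℕ) : ℝ := max (Real.logb (q F) D) 1

/-- `loglog₊ D = max {log log D, 1}`, with logarithms to the base `q`. -/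
def logLogPlus (F : Type*) [Fintype F] (D : ℕ) : ℝ :=
  max (Real.logb (q F) (Real.logb (q F) D)) 1

/-- The function `D ↦ (loglog₊ D) ^ (2 + d α / r) / (D (log₊ D) ^ (1 + 2 d α / r))`. -/
def DrinfeldModule.bound {F : Type*} [Field F] [Fintype F] {d : ℕ} (Φ : DrinfeldModule F d)
    (r : ℝ) (D : ℕ) : ℝ :=
  logLogPlus F D ^ (2 + d / r * Φ.alpha) / (D * logPlus F D ^ (1 + 2 * d / r * Φ.alpha))

end DrinfeldLehmer

end

open Polynomial Filter Topology IsDedekindDomain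
open scoped NNReal IntermediateField WithZero

noncomputable section

namespace DrinfeldLehmer

/-! ### Places of `k` as discrete valuation rings -/

section BasePlaces

set_option linter.unusedSectionVars false

variable {F : Type*} [Field F] [Fintype F]

/-! This is a Dobrowolski-type argument, with an interpolation determinant in place of an auxiliary
function. Let z_j be the D' ≤ D conjugates of x over k(Φ); they are distinct because x is separable.
Take m RV primes l_i of degree N. Let Δ be the determinant evaluating (t + m)D' polynomials, one of
each degree 0, 1, 2, ..., at the z_j with multiplicity t and at the points Φ(l_i)(z_j) with
multiplicity one. Δ is a power of a_d times a confluent Vandermonde product (`det_confluent`). Hence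
Δ ≠ 0 as soon as the points are distinct, and then the logarithms of its absolute values average to
zero by the product formula (`avg_log`).

Everywhere, |Δ| is at most the product of its row maxima. The polynomials are products of powers of
the Φ(T^j)(X), governed by base-q^d digits (`basisPoly`). So a row at z costs (q^d - 1) ∑_{j<s} log
max{1, |Φ(T^j)(z)|}, with average at most q^{ds} ĥ(z) + 4 s h(Φ) (`sum_weilHeight_le`). The error is
linear in s, which is about the logarithm of the size of Δ; this is why these polynomials replace
the monomials. The t-fold multiplicity costs a further s t² D' h(Φ).

Above l_i there is a gain. Let P be the minimal polynomial of x over k(Φ). Since residue degrees of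
k(Φ) above l_i are one, Frobenius fixes the coefficients of P, once scaled to be integral, modulo
the place; since Φ(l_i)(X) ≡ X^{q^{dN}}, the value P(Φ(l_i)(z_j)) is small along with
P(z_j)^{q^{dN}} = 0 (`val_prod_frobenius_sub_le`). This value enters the Vandermonde product t times
for each j, so l_i contributes t D' N / c(Φ). The comparison is `height_inequality`.

Distinctness of the points is Galois theory. If Φ(l)(z) = Φ(l')(σ z) and σ^n z = z, then Φ(l^n -
l'^n)(z) = 0, so l = l' because z is not torsion (`eq_of_hom_eq`). A prime l for which Φ(l) is not
injective on the conjugates at least halves the set of images, so at most log_2 D primes are lost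
(`two_pow_card_le`).

Finally t and m are chosen so that the terms without ĥ(x) use up at most three quarters of m t N.
Then s is taken minimal for the size of Δ, and q^{rN} of the order of (log D)²/loglog D, so that
enough RV primes exist (`lower_bound_of_inequality`). The limit defining ĥ exists because h(Φ(T)(y))
and q^d h(y) differ by at most 4 h(Φ). -/

theorem one_lt_q : (1 : ℝ) < q F := by
  exact_mod_cast Fintype.one_lt_card (α := F)

theorem toNNReal_exp {e : ℝ≥0} (he : e ≠ 0) (n : ℤ) :
    WithZeroMulInt.toNNReal he (WithZero.exp n) = e ^ n := by
  rw [WithZeroMulInt.toNNReal_neg_apply he WithZero.exp_ne_zero]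
  rfl

theorem toNNReal_eq_zpow_log {e : ℝ≥0} (he : e ≠ 0) {x : ℤᵐ⁰} (hx : x ≠ 0) :
    WithZeroMulInt.toNNReal he x = e ^ (WithZero.log x) := by
  conv_lhs => rw [← WithZero.exp_log hx]
  exact toNNReal_exp he _

theorem realVal_apply (v : Valuation (RatFunc F) ℤᵐ⁰) {m : ℕ} (hm : 0 < m) {x : RatFunc F}
    (hx : x ≠ 0) : realVal v hm x = ((q F : ℝ≥0) ^ m) ^ (WithZero.log (v x)) := by
  rw [realVal, Valuation.map_apply, toNNReal_eq_zpow_log]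
  exact (Valuation.ne_zero_iff v).2 hx

/-- The degree of a place of `k`. -/
def BasePlace.deg : BasePlace F → ℕ
  | some l => l.1.natDegree
  | none => 1

theorem BasePlace.deg_pos : ∀ v : BasePlace F, 0 < v.deg
  | some l => l.2.2.natDegree_pos
  | none => one_pos

theorem BasePlace.val_eq_zpow (v : BasePlace F) {x : RatFunc F} (hx : x ≠ 0) :
    ∃ n : ℤ, v.val x = ((q F : ℝ≥0) ^ v.deg) ^ n := by
  cases v with
  | some l => exact ⟨_, realVal_apply _ l.2.2.natDegree_pos hx⟩
  | none => exact ⟨_, realVal_apply _ one_pos hx⟩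

theorem BasePlace.val_some_self (l : MonicPrime F) :
    BasePlace.val (some l) (algebraMap F[X] (RatFunc F) l.1) = ((q F : ℝ≥0) ^ l.1.natDegree)⁻¹ := by
  have h0 : algebraMap F[X] (RatFunc F) l.1 ≠ 0 := by simpa using l.2.2.ne_zero
  rw [BasePlace.val, realVal_apply _ _ h0, HeightOneSpectrum.valuation_of_algebraMap,
    HeightOneSpectrum.intValuation_singleton _ l.2.2.ne_zero rfl, WithZero.log_exp, zpow_neg_one]

theorem BasePlace.val_none {x : RatFunc F} (hx : x ≠ 0) :
    BasePlace.val (none : BasePlace F) x = (q F : ℝ≥0) ^ x.intDegree := by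
  classical
  rw [BasePlace.val, realVal_apply _ _ hx, pow_one, RatFunc.inftyValuation_apply,
    RatFunc.inftyValuation_of_nonzero F hx, WithZero.log_exp]

theorem BasePlace.exists_uniformizer (v : BasePlace F) :
    ∃ π : RatFunc F, v.val π = ((q F : ℝ≥0) ^ v.deg)⁻¹ := by
  cases v with
  | some l => exact ⟨_, BasePlace.val_some_self l⟩
  | none =>
    refine ⟨(RatFunc.X)⁻¹, ?_⟩
    rw [map_inv₀, BasePlace.val_none RatFunc.X_ne_zero, RatFunc.intDegree_X]
    simp [BasePlace.deg]

theorem BasePlace.one_lt_q_pow_deg (v : BasePlace F) : (1 : ℝ≥0) < (q F : ℝ≥0) ^ v.deg :=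
  one_lt_q_pow v.deg_pos

/-- The valuation ring of a place of `k`. -/
abbrev BasePlace.ring (v : BasePlace F) : ValuationSubring (RatFunc F) := v.val.valuationSubring

/-- Every nonzero value is an integral power of q^deg, and π attains its inverse. So each nonzero
integral element is a unit times a power of π. -/
instance (v : BasePlace F) : IsDiscreteValuationRing v.ring := by
  obtain ⟨π, hπ⟩ := v.exists_uniformizer
  have h1 := v.one_lt_q_pow_deg
  have h0 : (0 : ℝ≥0) < (q F : ℝ≥0) ^ v.deg := zero_lt_one.trans h1
  have hπ0 : π ≠ 0 := by
    rintro rfl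
    simp at hπ
    exact h0.ne' (by simpa using hπ.symm)
  have hlt : v.val π < 1 := by rw [hπ]; exact inv_lt_one_of_one_lt₀ h1
  let p : v.ring := ⟨π, hlt.le⟩
  have hunit : ∀ x : v.ring, IsUnit x ↔ v.val (x : RatFunc F) = 1 := fun x =>
    (Valuation.integer.integers v.val).isUnit_iff_valuation_eq_one
  have hp0 : p ≠ 0 := fun h => hπ0 (congrArg Subtype.val h)
  refine IsDiscreteValuationRing.ofHasUnitMulPowIrreducibleFactorization ⟨p, ?_, ?_⟩
  · refine ⟨fun h => hlt.ne ((hunit p).1 h), fun a b hab => ?_⟩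
    -- Nonunits have absolute value at most |π|, so a product of two of them has absolute value at
    -- most |π|² < |π|.
    by_contra! hcon
    have key : ∀ y : v.ring, y ≠ 0 → ¬ IsUnit y → v.val (y : RatFunc F) ≤ v.val π := by
      intro y hy0 hy
      have hy0' : (y : RatFunc F) ≠ 0 := fun h => hy0 (Subtype.ext h)
      obtain ⟨n, hn⟩ := v.val_eq_zpow hy0'
      have hle : v.val (y : RatFunc F) < 1 := lt_of_le_of_ne y.2 fun h => hy ((hunit y).2 h)
      rw [hn] at hle ⊢
      rw [hπ, ← zpow_neg_one]
      have : n < 0 := by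
        by_contra! h
        exact absurd hle (not_lt.2 (one_le_zpow₀ h1.le h))
      exact zpow_le_zpow_right₀ h1.le (by omega)
    have ha0 : a ≠ 0 := by rintro rfl; exact hp0 (by simpa using hab)
    have hb0 : b ≠ 0 := by rintro rfl; exact hp0 (by simpa using hab)
    have h := congrArg (fun y : v.ring => v.val (y : RatFunc F)) hab
    have h' : v.val π = v.val (a : RatFunc F) * v.val (b : RatFunc F) := by
      rw [← map_mul]; exact h
    have hππ : v.val π ≤ v.val π * v.val π := by
      conv_lhs => rw [h']
      exact mul_le_mul' (key a ha0 hcon.1) (key b hb0 hcon.2)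
    have hpos : 0 < v.val π := zero_lt_iff.2 ((Valuation.ne_zero_iff _).2 hπ0)
    have : v.val π * v.val π < v.val π := by
      calc v.val π * v.val π < v.val π * 1 := by gcongr
        _ = _ := mul_one _
    exact absurd hππ (not_le.2 this)
  · intro x hx0
    have hx0' : (x : RatFunc F) ≠ 0 := fun h => hx0 (Subtype.ext h)
    obtain ⟨n, hn⟩ := v.val_eq_zpow hx0'
    have hn0 : n ≤ 0 := by
      by_contra! h
      exact absurd x.2 (not_le.2 (hn ▸ one_lt_zpow₀ h1 h))
    obtain ⟨m, rfl⟩ : ∃ m : ℕ, n = -m := ⟨(-n).toNat, by omega⟩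
    refine ⟨m, ?_⟩
    have hval : v.val ((x : RatFunc F) / π ^ m) = 1 := by
      rw [map_div₀, map_pow, hn, hπ, zpow_neg, zpow_natCast, inv_pow]
      exact div_self (inv_ne_zero (pow_ne_zero _ h0.ne'))
    let u : v.ring := ⟨(x : RatFunc F) / π ^ m, hval.le⟩
    have hu : IsUnit u := (hunit u).2 hval
    refine ⟨hu.unit, Subtype.ext ?_⟩
    change π ^ m * ((x : RatFunc F) / π ^ m) = x
    field_simp

end BasePlaces

/-! ### Valuation rings of `k` over their Frobenius powers -/

section Frobenius

set_option linter.unusedSectionVars false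

variable {F : Type*} [Field F] [Fintype F]

/-- The coefficients lie in F and are fixed by the q-Frobenius. -/
theorem pow_q_pow_eq_expand (n : ℕ) (f : F[X]) : f ^ q F ^ n = expand F (q F ^ n) f := by
  induction n with
  | zero => simp
  | succ n ih =>
    rw [pow_succ, pow_mul, ih, expand_mul, q, FiniteField.expand_card, map_pow]

theorem q_pow_pos (n : ℕ) : 0 < q F ^ n := pow_pos (Fintype.card_pos (α := F)) n

theorem coeff_divX_iterate (f : F[X]) (i n : ℕ) : (divX^[i] f).coeff n = f.coeff (n + i) := by
  induction i generalizing f with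
  | zero => simp
  | succ i ih => rw [Function.iterate_succ_apply, ih, coeff_divX]; congr 1

/-- Every polynomial is a combination of `1, X, ..., X ^ (Q - 1)` with `Q`-th powers as
coefficients, where `Q` is a power of the order of the field of constants. -/
theorem exists_eq_sum_X_pow_mul_pow (n : ℕ) (f : F[X]) :
    ∃ h : ℕ → F[X], f = ∑ i ∈ Finset.range (q F ^ n), X ^ i * h i ^ q F ^ n ∧
      ∀ i, q F ^ n * (h i).natDegree ≤ f.natDegree := by
  have hQ := q_pow_pos (F := F) n
  -- The i-th witness collects the coefficients of f in the degrees congruent to i modulo Q.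
  refine ⟨fun i => contract (q F ^ n) (divX^[i] f), ?_, fun i => ?_⟩
  · ext m
    simp_rw [pow_q_pow_eq_expand, finsetSum_coeff, coeff_X_pow_mul', coeff_expand hQ,
      coeff_contract hQ.ne', coeff_divX_iterate]
    rw [Finset.sum_eq_single (m % q F ^ n)]
    · rw [if_pos (Nat.mod_le _ _), if_pos (Nat.dvd_sub_mod m), Nat.div_mul_cancel (Nat.dvd_sub_mod m),
        Nat.sub_add_cancel (Nat.mod_le _ _)]
    · intro i hi hne
      split_ifs with h1 h2
      · exfalso
        apply hne
        obtain ⟨c, hc⟩ := h2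
        have : m = i + q F ^ n * c := by omega
        rw [this, Nat.add_mul_mod_self_left, Nat.mod_eq_of_lt (Finset.mem_range.1 hi)]
      · rfl
      · rfl
    · intro h
      exact absurd (Finset.mem_range.2 (Nat.mod_lt _ hQ)) h
  · by_cases h0 : contract (q F ^ n) (divX^[i] f) = 0
    · simp [h0]
    · have hc := leadingCoeff_ne_zero.2 h0
      rw [leadingCoeff, coeff_contract hQ.ne', coeff_divX_iterate] at hc
      have := le_natDegree_of_ne_zero hc
      rw [mul_comm]
      exact (Nat.le_add_right _ i).trans this

/-- A denominator g adapted to the place: prime to l at a finite place, and of degree at least that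
of the numerator at infinity. The degree condition on h is the one delivered by
`exists_eq_sum_X_pow_mul_pow`; it keeps h/g integral at infinity too. -/
theorem BasePlace.exists_frac (v : BasePlace F) {y : RatFunc F} (hy : v.val y ≤ 1) :
    ∃ f g : F[X], g ≠ 0 ∧ y = algebraMap _ _ f / algebraMap _ _ g ∧
      ∀ (n : ℕ) (h : F[X]), q F ^ n * h.natDegree ≤ (f * g ^ (q F ^ n - 1)).natDegree →
        v.val (algebraMap F[X] (RatFunc F) h / algebraMap F[X] (RatFunc F) g) ≤ 1 := by
  cases v with
  | some l =>
    have hy' : l.spec.valuation (RatFunc F) y ≤ 1 := by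
      have := (WithZeroMulInt.toNNReal_strictMono
        (one_lt_q_pow (F := F) l.2.2.natDegree_pos)).le_iff_le (a := l.spec.valuation (RatFunc F) y)
          (b := 1)
      rw [map_one] at this
      exact this.1 hy
    obtain ⟨a, s, hs⟩ := l.spec.exists_primeCompl_mul_eq_of_integer y hy'
    have hs1 : l.spec.valuation (RatFunc F) (algebraMap F[X] (RatFunc F) s) = 1 :=
      (HeightOneSpectrum.valuation_eq_one_iff_notMem _).2 s.2
    have hs0 : algebraMap F[X] (RatFunc F) s ≠ 0 := by
      intro h
      rw [h, map_zero] at hs1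
      exact zero_ne_one hs1
    refine ⟨a, s, fun h => hs0 (by rw [h, map_zero]), ?_, fun n h _ => ?_⟩
    · rw [eq_div_iff hs0]; exact hs
    · rw [BasePlace.val, realVal, Valuation.map_apply, map_div₀, hs1, div_one,
        ← map_one (WithZeroMulInt.toNNReal
          (zero_lt_one.trans (one_lt_q_pow (F := F) l.2.2.natDegree_pos)).ne')]
      exact (WithZeroMulInt.toNNReal_strictMono
        (one_lt_q_pow (F := F) l.2.2.natDegree_pos)).monotone
        (HeightOneSpectrum.valuation_le_one _ _)
  | none =>
    by_cases hy0 : y = 0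
    · refine ⟨0, 1, one_ne_zero, by simp [hy0], fun n h hh => ?_⟩
      have hQ := q_pow_pos (F := F) n
      have h0 : h.natDegree = 0 := by
        simp only [zero_mul, natDegree_zero, nonpos_iff_eq_zero, mul_eq_zero] at hh
        omega
      by_cases hz : h = 0
      · simp [hz]
      · rw [map_one, div_one, BasePlace.val_none (by simpa using hz), RatFunc.intDegree_polynomial,
          h0]
        simp
    · refine ⟨y.num, y.denom, y.denom_ne_zero, (RatFunc.num_div_denom y).symm, fun n h hh => ?_⟩
      have h1 : (1 : ℝ≥0) < q F := by simpa using one_lt_q_pow (F := F) one_pos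
      have hQ := q_pow_pos (F := F) n
      rw [BasePlace.val_none hy0] at hy
      have hdeg : y.num.natDegree ≤ y.denom.natDegree := by
        by_contra! hlt
        refine absurd hy (not_le.2 (one_lt_zpow₀ h1 ?_))
        rw [RatFunc.intDegree]
        omega
      by_cases hz : h = 0
      · simp [hz]
      have hg0 : algebraMap F[X] (RatFunc F) y.denom ≠ 0 := by simpa using y.denom_ne_zero
      rw [BasePlace.val_none (div_ne_zero (by simpa using hz) hg0),
        RatFunc.intDegree_div (by simpa using hz) hg0, RatFunc.intDegree_polynomial,
        RatFunc.intDegree_polynomial]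
      have h2 : q F ^ n * h.natDegree ≤ q F ^ n * y.denom.natDegree := by
        refine hh.trans (natDegree_mul_le.trans ?_)
        rw [natDegree_pow]
        calc y.num.natDegree + (q F ^ n - 1) * y.denom.natDegree
            ≤ y.denom.natDegree + (q F ^ n - 1) * y.denom.natDegree := by omega
          _ = (1 + (q F ^ n - 1)) * y.denom.natDegree := by ring
          _ = _ := by rw [Nat.add_sub_cancel' hQ]
      have h3 := Nat.le_of_mul_le_mul_left h2 hQ
      exact zpow_le_one_of_nonpos₀ h1.le (by omega)

/-- The valuation ring of a place of `k` is finite over its `Q`-th powers. -/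
theorem BasePlace.exists_eq_sum_pow_mul (v : BasePlace F) (n : ℕ) {y : RatFunc F}
    (hy : v.val y ≤ 1) : ∃ c : ℕ → RatFunc F, (∀ i, v.val (c i) ≤ 1) ∧
      y = ∑ i ∈ Finset.range (q F ^ n), c i ^ q F ^ n * RatFunc.X ^ i := by
  obtain ⟨f, g, hg, rfl, hfg⟩ := v.exists_frac hy
  have hQ := q_pow_pos (F := F) n
  obtain ⟨h, hsum, hdeg⟩ := exists_eq_sum_X_pow_mul_pow n (f * g ^ (q F ^ n - 1))
  have hg0 : algebraMap F[X] (RatFunc F) g ≠ 0 := by simpa using hg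
  refine ⟨fun i => algebraMap _ _ (h i) / algebraMap _ _ g, fun i => hfg n _ (hdeg i), ?_⟩
  have h1 := congrArg (algebraMap F[X] (RatFunc F)) hsum
  rw [map_mul, map_pow, map_sum] at h1
  -- The denominator is turned into a Q-th power, so that only the numerator has to be decomposed.
  have h2 : algebraMap F[X] (RatFunc F) f / algebraMap F[X] (RatFunc F) g =
      (algebraMap F[X] (RatFunc F) f * algebraMap F[X] (RatFunc F) g ^ (q F ^ n - 1)) /
        algebraMap F[X] (RatFunc F) g ^ q F ^ n := by
    rw [div_eq_div_iff hg0 (pow_ne_zero _ hg0)]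
    conv_lhs => rw [← Nat.sub_add_cancel hQ, pow_succ]
    ring
  rw [h2, h1, Finset.sum_div]
  refine Finset.sum_congr rfl fun i _ => ?_
  rw [map_mul, map_pow, map_pow, RatFunc.algebraMap_X, div_pow]
  ring

end Frobenius

/-! ### Finiteness of integral closures, inseparable extensions included -/

section IntegralClosure

variable {F : Type*} [Field F] [Fintype F]

/-- E is purely inseparable of finite exponent over the separable closure. With q = p^f and f ≥ 1,
the power q^n is at least p^n, and overshooting is harmless. -/
theorem exists_pow_mem_separableClosure (E : Type*) [Field E] [Algebra (RatFunc F) E]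
    [FiniteDimensional (RatFunc F) E] :
    ∃ n : ℕ, ∀ y : E, y ^ q F ^ n ∈ separableClosure (RatFunc F) E := by
  obtain ⟨p, hp⟩ := CharP.exists F
  obtain ⟨f, hprime, hcard⟩ := FiniteField.card F p
  have : Fact p.Prime := ⟨hprime⟩
  have : CharP (RatFunc F) p := charP_of_injective_algebraMap (algebraMap F (RatFunc F)).injective p
  have : ExpChar (separableClosure (RatFunc F) E) p :=
    expChar_of_injective_algebraMap (algebraMap (RatFunc F) _).injective p
  refine ⟨IsPurelyInseparable.exponent (separableClosure (RatFunc F) E) E, fun y => ?_⟩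
  obtain ⟨z, hz⟩ := IsPurelyInseparable.exponent_def' (separableClosure (RatFunc F) E) p y
  obtain ⟨a, ha⟩ : ∃ a, (f : ℕ) = 1 + a := ⟨f - 1, by have := f.pos; omega⟩
  rw [q, hcard, ← pow_mul, ha, add_mul, one_mul, pow_add, pow_mul, ← hz]
  exact pow_mem z.2 _

theorem exists_span_integral_of_isSeparable (v : BasePlace F) (M : Type*) [Field M]
    [Algebra (RatFunc F) M] [FiniteDimensional (RatFunc F) M] [Algebra.IsSeparable (RatFunc F) M] :
    ∃ s : Finset M, ∀ y : M, IsIntegral v.ring y →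
      ∃ c : s → v.ring, ∑ a, algebraMap (RatFunc F) M (c a) * a = y := by
  have hfin : Module.Finite v.ring (integralClosure v.ring M) :=
    IsIntegralClosure.finite v.ring (RatFunc F) M _
  obtain ⟨s, hs⟩ := (Module.Finite.iff_fg (N := (integralClosure v.ring M).toSubmodule)).1 hfin
  refine ⟨s, fun y hy => ?_⟩
  have hmem : y ∈ Submodule.span v.ring (s : Set M) := hs ▸ hy
  obtain ⟨c, hc⟩ := Submodule.mem_span_finset'.1 hmem
  exact ⟨c, by rw [← hc]; exact Finset.sum_congr rfl fun a _ => (Algebra.smul_def _ _).symm⟩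

/-- The integral closure of the valuation ring of a place of `k` in a finite extension is finite,
also if the extension is inseparable. -/
instance finite_integralClosure (v : BasePlace F) (E : Type*) [Field E] [Algebra (RatFunc F) E]
    [FiniteDimensional (RatFunc F) E] : Module.Finite v.ring (integralClosure v.ring E) := by
  obtain ⟨p, hp⟩ := CharP.exists F
  obtain ⟨f, hprime, hcard⟩ := FiniteField.card F p
  have : Fact p.Prime := ⟨hprime⟩
  have : CharP (RatFunc F) p := charP_of_injective_algebraMap (algebraMap F (RatFunc F)).injective p
  have : CharP E p := charP_of_injective_algebraMap (algebraMap (RatFunc F) E).injective p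
  obtain ⟨n, hn⟩ := exists_pow_mem_separableClosure (F := F) E
  have hQ : q F ^ n = p ^ (f * n) := by rw [q, hcard, ← pow_mul]
  -- The power φ of Frobenius carries E injectively into the separable closure, where finiteness is
  -- known. The image of the integral closure is studied as a module over ψ(v.ring), the ring of
  -- Q-th powers, and finiteness is then pulled back along φ.
  set φ : E →+* E := iterateFrobenius E p (f * n) with hφ
  have hφa : ∀ y : E, φ y = y ^ q F ^ n := fun y => by rw [hQ]; rfl
  obtain ⟨s, hs⟩ := exists_span_integral_of_isSeparable v (separableClosure (RatFunc F) E)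
  let ψ : v.ring →+* E := φ.comp (algebraMap v.ring E)
  have hnoeth : IsNoetherianRing ψ.range := isNoetherianRing_range ψ
  let G : Set E := (fun a : ℕ × separableClosure (RatFunc F) E =>
    algebraMap (RatFunc F) E RatFunc.X ^ a.1 * (a.2 : E)) ''
      ((Finset.range (q F ^ n) ×ˢ s : Finset _) : Set _)
  have hG : G.Finite := (Finset.finite_toSet _).image _
  let I : Submodule ψ.range E :=
    { carrier := {z | ∃ y : E, IsIntegral v.ring y ∧ φ y = z}
      add_mem' := by
        rintro _ _ ⟨y, hy, rfl⟩ ⟨z, hz, rfl⟩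
        exact ⟨y + z, hy.add hz, map_add _ _ _⟩
      zero_mem' := ⟨0, isIntegral_zero, map_zero _⟩
      smul_mem' := by
        rintro ⟨_, r, rfl⟩ _ ⟨y, hy, rfl⟩
        exact ⟨algebraMap v.ring E r * y, isIntegral_algebraMap.mul hy, map_mul _ _ _⟩ }
  have hle : I ≤ Submodule.span ψ.range G := by
    rintro _ ⟨y, hy, rfl⟩
    have hy' : IsIntegral v.ring (⟨φ y, by rw [hφa]; exact hn y⟩ : separableClosure (RatFunc F) E) := by
      have h1 : IsIntegral v.ring (φ y) := by rw [hφa]; exact hy.pow _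
      obtain ⟨g, hg, hg'⟩ := h1
      refine ⟨g, hg, (separableClosure (RatFunc F) E).val.injective ?_⟩
      rw [map_zero, ← hg']
      exact hom_eval₂ g _ (separableClosure (RatFunc F) E).val.toRingHom _
    obtain ⟨c, hc⟩ := hs _ hy'
    have hc' : φ y = ∑ a : s, algebraMap (RatFunc F) E (c a) * (a : E) := by
      have := congrArg (separableClosure (RatFunc F) E).val hc
      rw [map_sum] at this
      exact this.symm
    rw [hc']
    refine Submodule.sum_mem _ fun a _ => ?_
    -- The scalars c a lie in v.ring, not in its subring of Q-th powers; the powers of X in the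
    -- generating set G make up for this.
    obtain ⟨b, hb1, hb2⟩ := v.exists_eq_sum_pow_mul n (c a).2
    have : algebraMap (RatFunc F) E (c a) = ∑ i ∈ Finset.range (q F ^ n),
        ψ ⟨b i, hb1 i⟩ * algebraMap (RatFunc F) E RatFunc.X ^ i := by
      rw [hb2, map_sum]
      refine Finset.sum_congr rfl fun i _ => ?_
      rw [map_mul, map_pow, map_pow]
      congr 1
      exact (hφa _).symm
    rw [this, Finset.sum_mul]
    refine Submodule.sum_mem _ fun i hi => ?_
    rw [mul_assoc]
    exact Submodule.smul_mem _ (⟨ψ ⟨b i, hb1 i⟩, ⟨_, rfl⟩⟩ : ψ.range)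
      (Submodule.subset_span ⟨(i, a.1), by simpa using Finset.mem_range.1 hi, rfl⟩)
  have hN : IsNoetherian ψ.range (Submodule.span ψ.range G) := isNoetherian_span_of_finite _ hG
  obtain ⟨t, ht⟩ := isNoetherian_submodule.1 hN I hle
  have htI : ∀ z : t, ∃ y : E, IsIntegral v.ring y ∧ φ y = z := fun z => by
    have : (z : E) ∈ I := ht ▸ Submodule.subset_span z.2
    exact this
  choose y hy hyφ using htI
  classical
  refine (Module.Finite.iff_fg (N := (integralClosure v.ring E).toSubmodule)).2 ⟨Finset.univ.image y, le_antisymm ?_ ?_⟩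
  · rw [Submodule.span_le]
    intro z hz
    obtain ⟨a, -, rfl⟩ := Finset.mem_image.1 (Finset.mem_coe.1 hz)
    exact hy a
  · intro z hz
    have hz' : φ z ∈ Submodule.span ψ.range (t : Set E) := by
      rw [ht]; exact ⟨z, hz, rfl⟩
    obtain ⟨c, hc⟩ := Submodule.mem_span_finset'.1 hz'
    choose r hr using fun a => (c a).2
    have : z = ∑ a : t, algebraMap v.ring E (r a) * y a := by
      apply φ.injective
      rw [← hc, map_sum]
      refine Finset.sum_congr rfl fun a _ => ?_
      rw [map_mul, hyφ]
      change (c a : E) * a = _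
      rw [← hr]
      rfl
    rw [this]
    refine Submodule.sum_mem _ fun a _ => ?_
    rw [← Algebra.smul_def]
    exact Submodule.smul_mem _ _ (Submodule.subset_span (Finset.mem_coe.2
      (Finset.mem_image_of_mem _ (Finset.mem_univ _))))

instance isDedekindDomain_integralClosure (v : BasePlace F) (E : Type*) [Field E]
    [Algebra (RatFunc F) E] [FiniteDimensional (RatFunc F) E] :
    IsDedekindDomain (integralClosure v.ring E) :=
  have : IsNoetherianRing (integralClosure v.ring E) := IsNoetherianRing.of_finite v.ring _
  have : IsIntegrallyClosed (integralClosure v.ring E) :=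
    integralClosure.isIntegrallyClosedOfFiniteExtension (RatFunc F)
  have : Ring.DimensionLEOne (integralClosure v.ring E) := Ring.DimensionLEOne.of_isIntegral v.ring _
  { }

instance isFractionRing_integralClosure (v : BasePlace F) (E : Type*) [Field E]
    [Algebra (RatFunc F) E] [FiniteDimensional (RatFunc F) E] :
    IsFractionRing (integralClosure v.ring E) E :=
  integralClosure.isFractionRing_of_finite_extension (RatFunc F) E

end IntegralClosure

/-! ### Comparison of real valuations with adic valuations -/

section AdicComparison

/-- A real valuation on the fraction field of a Dedekind domain, integral on it and with center
`P`, is a power of the `P`-adic valuation. -/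
theorem exists_val_eq_zpow_log {R K : Type*} [CommRing R] [IsDedekindDomain R] [Field K]
    [Algebra R K] [IsFractionRing R K] (P : HeightOneSpectrum R) (u : Valuation K ℝ≥0)
    (h1 : ∀ r : R, u (algebraMap R K r) ≤ 1)
    (h2 : ∀ r : R, r ∈ P.asIdeal ↔ u (algebraMap R K r) < 1) :
    ∃ C : ℝ≥0, 1 < C ∧ ∀ y : K, y ≠ 0 → u y = C ^ (WithZero.log (P.valuation K y)) := by
  have hd : ∀ d : P.asIdeal.primeCompl, u (algebraMap R K d) = 1 := fun d =>
    le_antisymm (h1 _) (not_lt.1 fun h => d.2 ((h2 _).2 h))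
  have hdP : ∀ d : P.asIdeal.primeCompl, P.valuation K (algebraMap R K d) = 1 := fun d =>
    (HeightOneSpectrum.valuation_eq_one_iff_notMem _).2 d.2
  have key : ∀ z : K, P.valuation K z ≤ 1 → ∃ n : R, u z = u (algebraMap R K n) ∧
      P.valuation K z = P.valuation K (algebraMap R K n) := by
    intro z hz
    obtain ⟨n, d, hnd⟩ := P.exists_primeCompl_mul_eq_of_integer z hz
    refine ⟨n, ?_, ?_⟩
    · rw [← hnd, map_mul, hd, mul_one]
    · rw [← hnd, map_mul, hdP, mul_one]
  have hone : ∀ z : K, P.valuation K z = 1 → u z = 1 := by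
    intro z hz
    obtain ⟨n, hn, hn'⟩ := key z hz.le
    rw [hn]
    exact hd ⟨n, (HeightOneSpectrum.valuation_eq_one_iff_notMem _).1 (hn'.symm.trans hz)⟩
  obtain ⟨ϖ, hϖ⟩ := P.valuation_exists_uniformizer K
  have hϖ0 : ϖ ≠ 0 := by
    rintro rfl
    rw [map_zero] at hϖ
    exact WithZero.exp_ne_zero hϖ.symm
  have hϖ1 : u ϖ < 1 := by
    have hlt : P.valuation K ϖ < 1 := by
      rw [hϖ, ← WithZero.exp_zero, WithZero.exp_lt_exp]; norm_num
    obtain ⟨n, hn, hn'⟩ := key ϖ hlt.le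
    rw [hn, ← h2]
    exact (HeightOneSpectrum.valuation_lt_one_iff_mem P n).1 (hn' ▸ hlt)
  have hpos : 0 < u ϖ := zero_lt_iff.2 ((Valuation.ne_zero_iff _).2 hϖ0)
  refine ⟨(u ϖ)⁻¹, (one_lt_inv₀ hpos).2 hϖ1, fun y hy => ?_⟩
  have hν : P.valuation K y ≠ 0 := (Valuation.ne_zero_iff _).2 hy
  -- The uniformizer has valuation exp (-1), so this product is a P-adic unit.
  have := hone (y * ϖ ^ (WithZero.log (P.valuation K y))) (by
    rw [map_mul, map_zpow₀, hϖ, ← WithZero.exp_zsmul, smul_neg, smul_eq_mul, mul_one]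
    nth_rw 1 [← WithZero.exp_log hν]
    rw [← WithZero.exp_add, add_neg_cancel, WithZero.exp_zero])
  rw [map_mul, map_zpow₀] at this
  rw [inv_zpow]
  exact eq_inv_of_mul_eq_one_left this

theorem relIndex_zpowers_pow {G : Type*} [Group G] {g : G} (hg : ∀ n : ℤ, g ^ n = 1 → n = 0)
    (e : ℕ) : (Subgroup.zpowers (g ^ e)).relIndex (Subgroup.zpowers g) = e := by
  have h1 : Subgroup.zpowers g = (⊤ : Subgroup (Multiplicative ℤ)).map (zpowersHom G g) := by
    rw [← MonoidHom.range_eq_map]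
    ext x
    simp [Subgroup.mem_zpowers_iff]
  have h2 : (Subgroup.zpowers (g ^ e)).comap (zpowersHom G g) =
      AddSubgroup.toSubgroup (AddSubgroup.zmultiples (e : ℤ)) := by
    ext n
    rw [Subgroup.mem_comap, Subgroup.mem_zpowers_iff]
    change _ ↔ n.toAdd ∈ AddSubgroup.zmultiples (e : ℤ)
    rw [AddSubgroup.mem_zmultiples_iff]
    refine exists_congr fun m => ?_
    rw [zpowersHom_apply, ← zpow_natCast, ← zpow_mul, smul_eq_mul]
    constructor
    · intro h
      have := hg (e * m - n.toAdd) (by rw [zpow_sub, h, mul_inv_cancel])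
      linarith
    · intro h
      rw [← h, mul_comm]
  rw [h1, ← Subgroup.relIndex_comap, h2, Subgroup.relIndex_top_right, AddSubgroup.index_toSubgroup,
    Int.index_zmultiples, Int.natAbs_natCast]

/-- Since P is the preimage of the maximal ideal, S/P embeds in the residue field of O. Since S
represents every class modulo the maximal ideal, the embedding is onto. -/
theorem finrank_residueField_eq_inertiaDeg {R S O : Type*} [CommRing R] [CommRing S] [CommRing O]
    [IsLocalRing R] [IsLocalRing O] [Algebra R S] [Algebra R O] [IsLocalHom (algebraMap R O)]
    (ι : S →ₐ[R] O) (P : Ideal S) [P.LiesOver (IsLocalRing.maximalIdeal R)]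
    (hP : P = (IsLocalRing.maximalIdeal O).comap ι)
    (hs : ∀ y : O, ∃ s : S, ι s - y ∈ IsLocalRing.maximalIdeal O) :
    Module.finrank (IsLocalRing.ResidueField R) (IsLocalRing.ResidueField O) =
      Ideal.inertiaDeg' (IsLocalRing.maximalIdeal R) P := by
  rw [Ideal.inertiaDeg'_algebraMap]
  symm
  let f : S ⧸ P →+* IsLocalRing.ResidueField O :=
    Ideal.Quotient.lift P ((IsLocalRing.residue O).comp (ι : S →+* O)) fun s hs =>
      (IsLocalRing.residue_eq_zero_iff _).2 (hP.le hs)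
  have hfmk : ∀ s : S, f (Ideal.Quotient.mk P s) = IsLocalRing.residue O (ι s) := fun s => rfl
  have hf : Function.Injective f := by
    rw [injective_iff_map_eq_zero]
    intro z hz
    obtain ⟨s, rfl⟩ := Ideal.Quotient.mk_surjective z
    rw [hfmk, IsLocalRing.residue_eq_zero_iff] at hz
    exact Ideal.Quotient.eq_zero_iff_mem.2 (hP.ge hz)
  have hsurj : Function.Surjective f := by
    intro z
    obtain ⟨y, rfl⟩ := IsLocalRing.residue_surjective z
    obtain ⟨s, hs⟩ := hs y
    refine ⟨Ideal.Quotient.mk _ s, ?_⟩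
    rw [hfmk, ← sub_eq_zero, ← map_sub, IsLocalRing.residue_eq_zero_iff]
    exact hs
  let : Module (IsLocalRing.ResidueField R) (S ⧸ P) :=
    inferInstanceAs (Module (R ⧸ IsLocalRing.maximalIdeal R) (S ⧸ P))
  have hsmul : ∀ (r : IsLocalRing.ResidueField R) (z : S ⧸ P), f (r • z) = r • f z := by
    intro r z
    obtain ⟨r, rfl⟩ := IsLocalRing.residue_surjective r
    obtain ⟨z, rfl⟩ := Ideal.Quotient.mk_surjective z
    change f (Ideal.Quotient.mk P (r • z)) = _
    rw [hfmk, hfmk, map_smul, Algebra.smul_def, map_mul, Algebra.smul_def]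
    rfl
  exact LinearEquiv.finrank_eq (R := IsLocalRing.ResidueField R) (M := S ⧸ P)
    (LinearEquiv.ofBijective
      ({ toFun := f, map_add' := map_add f, map_smul' := hsmul } :
        (S ⧸ P) →ₗ[IsLocalRing.ResidueField R] IsLocalRing.ResidueField O) ⟨hf, hsurj⟩)

end AdicComparison

/-! ### The prime ideal, ramification index and inertia degree of a place -/

section PlacePrimes

set_option linter.unusedSectionVars false

variable {F : Type*} [Field F] [Fintype F]

/-- The maximal ideal of the valuation ring of a place of `k`. -/
abbrev BasePlace.spec (v : BasePlace F) : HeightOneSpectrum v.ring :=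
  IsDiscreteValuationRing.maximalIdeal v.ring

theorem BasePlace.mem_maximalIdeal (v : BasePlace F) (r : v.ring) :
    r ∈ IsLocalRing.maximalIdeal v.ring ↔ v.val (r : RatFunc F) < 1 := by
  have h : IsUnit r ↔ v.val (r : RatFunc F) = 1 :=
    (Valuation.integer.integers v.val).isUnit_iff_valuation_eq_one
  rw [IsLocalRing.mem_maximalIdeal, mem_nonunits_iff, h]
  exact ⟨fun h => lt_of_le_of_ne r.2 h, fun h => h.ne⟩

/-- The general comparison only gives some base C > 1. Each of C and q^deg is an integral power of
the other and both exceed 1, so they agree. -/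
theorem BasePlace.val_eq_zpow_log (v : BasePlace F) {x : RatFunc F} (hx : x ≠ 0) :
    v.val x = ((q F : ℝ≥0) ^ v.deg) ^ (WithZero.log (v.spec.valuation (RatFunc F) x)) := by
  obtain ⟨C, hC, h⟩ := exists_val_eq_zpow_log (K := RatFunc F) v.spec v.val (fun r => r.2)
    (fun r => v.mem_maximalIdeal r)
  have hq := v.one_lt_q_pow_deg
  have hq0 : (q F : ℝ≥0) ^ v.deg ≠ 0 := (zero_lt_one.trans hq).ne'
  suffices hCq : C = (q F : ℝ≥0) ^ v.deg by rw [h x hx, hCq]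
  obtain ⟨y, hy⟩ := v.spec.valuation_exists_uniformizer (RatFunc F)
  have hy0 : y ≠ 0 := by
    rintro rfl
    rw [map_zero] at hy
    exact WithZero.exp_ne_zero hy.symm
  have h1 := h y hy0
  rw [hy, WithZero.log_exp] at h1
  obtain ⟨m, hm⟩ := v.val_eq_zpow hy0
  obtain ⟨π, hπ⟩ := v.exists_uniformizer
  have hπ0 : π ≠ 0 := by
    rintro rfl
    rw [map_zero] at hπ
    exact inv_ne_zero hq0 hπ.symm
  have h2 := h π hπ0
  rw [hπ] at h2
  set n := WithZero.log (v.spec.valuation (RatFunc F) π)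
  have hCm : C = ((q F : ℝ≥0) ^ v.deg) ^ (-m) := by
    rw [zpow_neg, ← hm, h1, zpow_neg_one, inv_inv]
  rw [hCm, ← zpow_neg_one, ← zpow_mul] at h2
  have h3 := zpow_right_injective₀ (zero_lt_one.trans hq) hq.ne' h2
  have hm0 : 0 < -m := by
    by_contra! hle
    exact absurd hC (not_lt.2 (hCm ▸ zpow_le_one_of_nonpos₀ hq.le hle))
  have h4 : (-m) ∣ 1 := ⟨-n, by linarith⟩
  have h5 : -m = 1 := by
    have := Int.le_of_dvd one_pos h4
    omega
  rw [hCm, h5, zpow_one]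

variable {E : Type*} [Field E] [Algebra (RatFunc F) E] (w : Place F E)

theorem Place.val_le_one_of_isIntegral {y : E} (hy : IsIntegral w.base.ring y) : w.val y ≤ 1 := by
  have h : IsIntegral w.val.valuationSubring y := by
    obtain ⟨g, hg, hg'⟩ := hy
    refine ⟨g.map (algebraMap w.base.ring w.val.valuationSubring), hg.map _, ?_⟩
    rw [eval₂_map, ← hg']
    rfl
  obtain ⟨z, hz⟩ := IsIntegrallyClosed.isIntegral_iff.1 h
  rw [← hz]
  exact z.2

/-- The inclusion of the integral closure of the valuation ring of `k` in that of a place above. -/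
def Place.incl : integralClosure w.base.ring E →+* w.val.valuationSubring :=
  (integralClosure w.base.ring E).val.toRingHom.codRestrict w.val.valuationSubring.toSubring
    fun s => w.val_le_one_of_isIntegral s.2

theorem Place.mem_maximalIdeal (r : w.val.valuationSubring) :
    r ∈ IsLocalRing.maximalIdeal w.val.valuationSubring ↔ w.val (r : E) < 1 := by
  have h : IsUnit r ↔ w.val (r : E) = 1 :=
    (Valuation.integer.integers w.val).isUnit_iff_valuation_eq_one
  rw [IsLocalRing.mem_maximalIdeal, mem_nonunits_iff, h]
  exact ⟨fun h => lt_of_le_of_ne r.2 h, fun h => h.ne⟩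

/-- The prime ideal of a place. -/
def Place.prime : Ideal (integralClosure w.base.ring E) :=
  (IsLocalRing.maximalIdeal w.val.valuationSubring).comap w.incl

theorem Place.mem_prime (s : integralClosure w.base.ring E) : s ∈ w.prime ↔ w.val (s : E) < 1 :=
  w.mem_maximalIdeal _

instance Place.isPrime_prime : w.prime.IsPrime := Ideal.IsPrime.comap _

instance Place.liesOver_prime : w.prime.LiesOver (IsLocalRing.maximalIdeal w.base.ring) :=
  ⟨by
    ext r
    rw [Ideal.mem_under, w.mem_prime, w.base.mem_maximalIdeal, ← w.val_algebraMap]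
    rfl⟩

instance (v : BasePlace F) : FaithfulSMul v.ring E :=
  (faithfulSMul_iff_algebraMap_injective v.ring E).2
    ((algebraMap (RatFunc F) E).injective.comp Subtype.val_injective)

instance (v : BasePlace F) : FaithfulSMul v.ring (integralClosure v.ring E) :=
  (faithfulSMul_iff_algebraMap_injective v.ring _).2 fun _ _ h =>
    FaithfulSMul.algebraMap_injective v.ring E (congrArg Subtype.val h)

instance (v : BasePlace F) : Module.IsTorsionFree v.ring (integralClosure v.ring E) :=
  Module.isTorsionFree_iff_faithfulSMul.2 inferInstance

variable [FiniteDimensional (RatFunc F) E]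

theorem maximalIdeal_ring_ne_bot (v : BasePlace F) : IsLocalRing.maximalIdeal v.ring ≠ ⊥ :=
  v.spec.ne_bot

theorem ne_bot_of_liesOver_maximalIdeal {v : BasePlace F} (P : Ideal (integralClosure v.ring E))
    [P.LiesOver (IsLocalRing.maximalIdeal v.ring)] : P ≠ ⊥ :=
  Ideal.ne_bot_of_liesOver_of_ne_bot (maximalIdeal_ring_ne_bot v) P

/-- The prime ideal of a place, as a point of the height one spectrum. -/
def Place.spec : HeightOneSpectrum (integralClosure w.base.ring E) where
  asIdeal := w.prime
  isPrime := inferInstance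
  ne_bot := ne_bot_of_liesOver_maximalIdeal _

/-- The ramification index of a prime above a place of `k`. -/
abbrev ramIdx {v : BasePlace F} (P : Ideal (integralClosure v.ring E)) : ℕ :=
  Ideal.ramificationIdx' (IsLocalRing.maximalIdeal v.ring) P

/-- The inertia degree of a prime above a place of `k`. -/
abbrev inertDeg {v : BasePlace F} (P : Ideal (integralClosure v.ring E)) : ℕ :=
  Ideal.inertiaDeg' (IsLocalRing.maximalIdeal v.ring) P

theorem log_valuation_algebraMap {v : BasePlace F} (P : HeightOneSpectrum (integralClosure v.ring E))
    [P.asIdeal.LiesOver (IsLocalRing.maximalIdeal v.ring)] (x : RatFunc F) :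
    WithZero.log (P.valuation E (algebraMap (RatFunc F) E x)) =
      ramIdx P.asIdeal * WithZero.log (v.spec.valuation (RatFunc F) x) := by
  have : P.asIdeal.LiesOver v.spec.asIdeal := ‹_›
  have h := HeightOneSpectrum.valuation_liesOver (K := RatFunc F) E v.spec P x
  rw [← h, WithZero.log_pow, nsmul_eq_mul]
  rfl

theorem ramIdx_ne_zero {v : BasePlace F} (P : Ideal (integralClosure v.ring E)) [P.IsPrime]
    [P.LiesOver (IsLocalRing.maximalIdeal v.ring)] : ramIdx P ≠ 0 :=
  Ideal.IsDedekindDomain.ramificationIdx'_ne_zero_of_liesOver P (maximalIdeal_ring_ne_bot v)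

/-- The base C is pinned down by evaluating at a uniformizer of `k`, because w extends the
normalised place below. -/
theorem Place.exists_val_eq : ∃ C : ℝ≥0, 1 < C ∧ C ^ ramIdx w.prime = (q F : ℝ≥0) ^ w.base.deg ∧
    ∀ y : E, y ≠ 0 → w.val y = C ^ (WithZero.log (w.spec.valuation E y)) := by
  obtain ⟨C, hC, h⟩ := exists_val_eq_zpow_log (K := E) w.spec w.val
    (fun r => w.val_le_one_of_isIntegral r.2) (fun r => w.mem_prime r)
  refine ⟨C, hC, ?_, h⟩
  obtain ⟨π, hπ⟩ := w.base.spec.valuation_exists_uniformizer (RatFunc F)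
  have hπ0 : π ≠ 0 := by
    rintro rfl
    rw [map_zero] at hπ
    exact WithZero.exp_ne_zero hπ.symm
  have h1 := h (algebraMap (RatFunc F) E π) (by simpa using hπ0)
  have : w.spec.asIdeal.LiesOver (IsLocalRing.maximalIdeal w.base.ring) :=
    inferInstanceAs (w.prime.LiesOver _)
  rw [w.val_algebraMap, w.base.val_eq_zpow_log hπ0, log_valuation_algebraMap, hπ,
    WithZero.log_exp, mul_neg_one, zpow_neg, zpow_neg, zpow_one, inv_inj, zpow_natCast] at h1
  exact h1.symm

/-- The two value groups are infinite cyclic, generated by C and by C^e. -/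
theorem Place.ramificationIndex_eq : w.ramificationIndex = ramIdx w.prime := by
  obtain ⟨C, hC, hCe, h⟩ := w.exists_val_eq
  have hC0 : C ≠ 0 := (zero_lt_one.trans hC).ne'
  have hq0 : (q F : ℝ≥0) ^ w.base.deg ≠ 0 := (zero_lt_one.trans w.base.one_lt_q_pow_deg).ne'
  have hE : (Units.map (w.val : E →* ℝ≥0)).range = Subgroup.zpowers (Units.mk0 C hC0) := by
    ext u
    rw [MonoidHom.mem_range, Subgroup.mem_zpowers_iff]
    constructor
    · rintro ⟨y, rfl⟩
      exact ⟨_, Units.ext (by simpa using (h y y.ne_zero).symm)⟩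
    · rintro ⟨n, rfl⟩
      obtain ⟨y, hy⟩ := w.spec.valuation_surjective E (WithZero.exp n)
      have hy0 : y ≠ 0 := by
        rintro rfl
        rw [map_zero] at hy
        exact WithZero.exp_ne_zero hy.symm
      refine ⟨Units.mk0 y hy0, Units.ext ?_⟩
      have := h y hy0
      rw [hy, WithZero.log_exp] at this
      simpa using this
  have hk : (Units.map (w.base.val : RatFunc F →* ℝ≥0)).range =
      Subgroup.zpowers (Units.mk0 C hC0 ^ ramIdx w.prime) := by
    have hCu : Units.mk0 C hC0 ^ ramIdx w.prime = Units.mk0 _ hq0 := Units.ext (by simpa using hCe)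
    rw [hCu]
    ext u
    rw [MonoidHom.mem_range, Subgroup.mem_zpowers_iff]
    constructor
    · rintro ⟨y, rfl⟩
      exact ⟨_, Units.ext (by simpa using (w.base.val_eq_zpow_log y.ne_zero).symm)⟩
    · rintro ⟨n, rfl⟩
      obtain ⟨y, hy⟩ := w.base.spec.valuation_surjective (RatFunc F) (WithZero.exp n)
      have hy0 : y ≠ 0 := by
        rintro rfl
        rw [map_zero] at hy
        exact WithZero.exp_ne_zero hy.symm
      refine ⟨Units.mk0 y hy0, Units.ext ?_⟩
      have := w.base.val_eq_zpow_log hy0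
      rw [hy, WithZero.log_exp] at this
      simpa using this
  rw [Place.ramificationIndex, hE, hk]
  refine relIndex_zpowers_pow (fun n hn => ?_) _
  have := congrArg Units.val hn
  simp only [Units.val_zpow_eq_zpow_val, Units.val_mk0, Units.val_one] at this
  exact (zpow_eq_one_iff_right₀ zero_le hC.ne').1 this

/-- Adic approximation by the Dedekind domain; it supplies the surjectivity onto the residue field
of w. -/
theorem Place.exists_sub_val_lt_one {y : E} (hy : w.val y ≤ 1) :
    ∃ s : integralClosure w.base.ring E, w.val (s - y) < 1 := by
  obtain ⟨C, hC, -, h⟩ := w.exists_val_eq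
  by_cases hy0 : y = 0
  · exact ⟨0, by simp [hy0]⟩
  have hν0 : w.spec.valuation E y ≠ 0 := (Valuation.ne_zero_iff _).2 hy0
  have hν : w.spec.valuation E y ≤ 1 := by
    rw [h y hy0] at hy
    rw [← WithZero.exp_log hν0, ← WithZero.exp_zero, WithZero.exp_le_exp]
    by_contra! hlt
    exact absurd hy (not_le.2 (one_lt_zpow₀ hC hlt))
  obtain ⟨a, ha⟩ := w.spec.exists_valuation_sub_lt_of_integer hν 1
  refine ⟨a, ?_⟩
  change w.val (algebraMap _ E a - y) < 1
  by_cases h0 : algebraMap (integralClosure w.base.ring E) E a - y = 0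
  · rw [h0, map_zero]; exact zero_lt_one
  rw [h _ h0]
  refine zpow_lt_one_of_neg₀ hC ?_
  rw [← WithZero.log_one]
  exact (WithZero.log_lt_log ((Valuation.ne_zero_iff _).2 h0) one_ne_zero).2 (by simpa using ha)

theorem Place.inertiaDegree_eq : w.inertiaDegree = inertDeg w.prime := by
  refine finrank_residueField_eq_inertiaDeg ⟨w.incl, fun _ => rfl⟩ w.prime rfl fun y => ?_
  obtain ⟨s, hs⟩ := w.exists_sub_val_lt_one y.2
  exact ⟨s, (w.mem_maximalIdeal _).2 hs⟩

end PlacePrimes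

/-! ### Places from primes, and the sum of the local degrees -/

section PlaceOfPrime

set_option linter.unusedSectionVars false

variable {F : Type*} [Field F] [Fintype F]
variable {E : Type*} [Field E] [Algebra (RatFunc F) E] [FiniteDimensional (RatFunc F) E]

/-- The prime ideal attached to an extension of the valuation of a place of `k`. -/
def center (v : BasePlace F) (u : Valuation E ℝ≥0)
    (hu : ∀ x : RatFunc F, u (algebraMap (RatFunc F) E x) = v.val x) :
    Ideal (integralClosure v.ring E) := (Place.mk v u hu).prime

section

variable {v : BasePlace F} {u : Valuation E ℝ≥0}
  {hu : ∀ x : RatFunc F, u (algebraMap (RatFunc F) E x) = v.val x}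

theorem mem_center {s : integralClosure v.ring E} : s ∈ center v u hu ↔ u (s : E) < 1 :=
  (Place.mk v u hu).mem_prime s

instance : (center v u hu).IsPrime := Place.isPrime_prime (Place.mk v u hu)

instance : (center v u hu).LiesOver (IsLocalRing.maximalIdeal v.ring) :=
  Place.liesOver_prime (Place.mk v u hu)

theorem localDegree_mk : (Place.mk v u hu).localDegree =
    ramIdx (center v u hu) * inertDeg (center v u hu) := by
  rw [Place.localDegree, Place.ramificationIndex_eq, Place.inertiaDegree_eq]
  rfl

end

/-- Every prime above a place of `k` comes from a place. -/
theorem exists_center_eq {v : BasePlace F} (P : Ideal (integralClosure v.ring E)) [P.IsPrime]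
    [P.LiesOver (IsLocalRing.maximalIdeal v.ring)] :
    ∃ (u : Valuation E ℝ≥0) (hu : ∀ x : RatFunc F, u (algebraMap (RatFunc F) E x) = v.val x),
      center v u hu = P := by
  have he : ramIdx P ≠ 0 := ramIdx_ne_zero P
  -- The base is the e-th root of q^deg, which makes the P-adic absolute value extend v itself and
  -- not a power of it.
  have hC : 1 < ((q F : ℝ≥0) ^ v.deg) ^ ((ramIdx P : ℝ)⁻¹) :=
    NNReal.one_lt_rpow v.one_lt_q_pow_deg (by positivity)
  let P' : HeightOneSpectrum (integralClosure v.ring E) :=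
    ⟨P, inferInstance, ne_bot_of_liesOver_maximalIdeal P⟩
  have : P'.asIdeal.LiesOver (IsLocalRing.maximalIdeal v.ring) := ‹_›
  let u : Valuation E ℝ≥0 := (P'.valuation E).map (WithZeroMulInt.toNNReal (zero_lt_one.trans hC).ne')
      (WithZeroMulInt.toNNReal_strictMono hC).monotone
  refine ⟨u, fun x => ?_, ?_⟩
  · by_cases hx : x = 0
    · simp [hx]
    rw [Valuation.map_apply, toNNReal_eq_zpow_log _ ((Valuation.ne_zero_iff _).2 (by simpa using hx)),
      log_valuation_algebraMap, v.val_eq_zpow_log hx, zpow_mul, zpow_natCast,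
      NNReal.rpow_inv_natCast_pow _ he]
  · ext s
    rw [mem_center]
    exact (WithZeroMulInt.toNNReal_lt_one_iff hC).trans
      (HeightOneSpectrum.valuation_lt_one_iff_mem P' s)

/-- The prime determines the adic valuation, and C^e = q^deg determines the base C of the
exponential. -/
theorem Place.ext_of_val_lt_one_iff {w w' : Place F E} (hb : w.base = w'.base)
    (h : ∀ s : E, IsIntegral w.base.ring s → (w.val s < 1 ↔ w'.val s < 1)) : w = w' := by
  obtain ⟨C, hC, hCe, hw⟩ := w.exists_val_eq
  obtain ⟨C', hC', hCe', hw'⟩ := w'.exists_val_eq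
  obtain ⟨v, u, hu⟩ := w
  obtain ⟨v', u', hu'⟩ := w'
  obtain rfl : v = v' := hb
  have hP : (Place.mk v u hu).spec = (Place.mk v u' hu').spec := by
    apply HeightOneSpectrum.ext
    ext s
    change s ∈ (Place.mk v u hu).prime ↔ s ∈ (Place.mk v u' hu').prime
    rw [Place.mem_prime, Place.mem_prime]
    exact h s s.2
  have hp : (Place.mk v u hu).prime = (Place.mk v u' hu').prime :=
    congrArg HeightOneSpectrum.asIdeal hP
  have hCC : C = C' := by
    rw [hp, ← hCe'] at hCe
    exact pow_left_injective (ramIdx_ne_zero (center v u' hu')) hCe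
  congr
  ext y
  by_cases hy : y = 0
  · simp [hy]
  · have h1 := hw y hy
    have h2 := hw' y hy
    rw [hP, hCC] at h1
    exact congrArg _ (h1.trans h2.symm)

variable {L : Type*} [Field L] [Algebra (RatFunc F) L] [FiniteDimensional (RatFunc F) L]
  [Algebra E L] [IsScalarTower (RatFunc F) E L]

variable (E) in
/-- The place of a subfield below a place. -/
def Place.restrict (W : Place F L) : Place F E where
  base := W.base
  val := W.val.comap (algebraMap E L)
  val_algebraMap x := by
    rw [Valuation.comap_apply, ← IsScalarTower.algebraMap_apply, W.val_algebraMap]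

/-- The map between integral closures. -/
def closureMap (v : BasePlace F) (E L : Type*) [Field E] [Algebra (RatFunc F) E] [Field L]
    [Algebra (RatFunc F) L] [Algebra E L] [IsScalarTower (RatFunc F) E L] :
    integralClosure v.ring E →+* integralClosure v.ring L :=
  ((algebraMap E L).comp (integralClosure v.ring E).val.toRingHom).codRestrict
    (integralClosure v.ring L).toSubring fun s => by
      obtain ⟨g, hg, hg'⟩ := s.2
      refine ⟨g, hg, ?_⟩
      have := congrArg (algebraMap E L) hg'
      rw [hom_eval₂, map_zero] at this
      rw [← this]
      congr 1
      ext r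
      exact IsScalarTower.algebraMap_apply (RatFunc F) E L r

/-- The local degrees of the places above a given place add up. -/
theorem Place.sum_localDegree_restrict (w : Place F E) :
    ∃ s : Finset (Place F L), (∀ W, W ∈ s ↔ W.restrict E = w) ∧
      ∑ W ∈ s, W.localDegree = Module.finrank E L * w.localDegree := by
  classical
  have : FiniteDimensional E L := FiniteDimensional.right (RatFunc F) E L
  obtain ⟨v, u, hu⟩ := w
  let : Algebra (integralClosure v.ring E) (integralClosure v.ring L) := (closureMap v E L).toAlgebra
  have hst : IsScalarTower v.ring (integralClosure v.ring E) (integralClosure v.ring L) :=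
    IsScalarTower.of_algebraMap_eq fun r =>
      Subtype.ext (IsScalarTower.algebraMap_apply (RatFunc F) E L r)
  have : IsScalarTower (integralClosure v.ring E) (integralClosure v.ring L) L :=
    IsScalarTower.of_algebraMap_eq fun r => rfl
  have : IsScalarTower (integralClosure v.ring E) E L := IsScalarTower.of_algebraMap_eq fun r => rfl
  have hfin : Module.Finite (integralClosure v.ring E) (integralClosure v.ring L) :=
    Module.Finite.of_restrictScalars_finite v.ring _ _
  have : FaithfulSMul (integralClosure v.ring E) (integralClosure v.ring L) :=
    (faithfulSMul_iff_algebraMap_injective _ _).2 fun a b h =>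
      Subtype.ext ((algebraMap E L).injective (congrArg Subtype.val h))
  have htf : Module.IsTorsionFree (integralClosure v.ring E) (integralClosure v.ring L) :=
    Module.isTorsionFree_iff_faithfulSMul.2 inferInstance
  have hp0 : center v u hu ≠ ⊥ := ne_bot_of_liesOver_maximalIdeal _
  have hpmax : (center v u hu).IsMaximal := Ring.DimensionLEOne.maximalOfPrime hp0 inferInstance
  -- The fundamental identity ∑ e f = [L : E]. It needs the finiteness of the integral closure,
  -- hence the care about inseparable extensions.
  have hsum := Ideal.sum_ramification_inertia (integralClosure v.ring L) E L hp0
  set primes := IsDedekindDomain.primesOverFinset (center v u hu) (integralClosure v.ring L)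
  have hspec : ∀ Q : primes, Q.1.IsPrime ∧ Q.1.LiesOver (center v u hu) := fun Q =>
    (IsDedekindDomain.mem_primesOverFinset_iff hp0 _).1 Q.2
  have hex : ∀ Q : primes, ∃ (U : Valuation L ℝ≥0)
      (hU : ∀ x : RatFunc F, U (algebraMap (RatFunc F) L x) = v.val x), center v U hU = Q.1 := by
    intro Q
    have := (hspec Q).1
    have := (hspec Q).2
    have : Q.1.LiesOver (IsLocalRing.maximalIdeal v.ring) :=
      Ideal.LiesOver.trans Q.1 (center v u hu) _
    exact exists_center_eq Q.1
  choose U hU hcenter using hex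
  have hinj : ∀ Q Q' : primes, Place.mk v (U Q) (hU Q) = Place.mk v (U Q') (hU Q') → Q = Q' := by
    intro Q Q' h
    apply Subtype.ext
    have hUU : U Q = U Q' := by injection h
    rw [← hcenter, ← hcenter]
    ext s
    rw [mem_center, mem_center, hUU]
  let s : Finset (Place F L) := Finset.univ.image fun Q : primes => Place.mk v (U Q) (hU Q)
  have hmem : ∀ W, W ∈ s ↔ W.restrict E = ⟨v, u, hu⟩ := by
    intro W
    rw [Finset.mem_image]
    constructor
    · rintro ⟨Q, -, rfl⟩
      refine Place.ext_of_val_lt_one_iff rfl fun y (hy : IsIntegral v.ring y) => ?_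
      have h1 : closureMap v E L ⟨y, hy⟩ ∈ center v (U Q) (hU Q) ↔ U Q (algebraMap E L y) < 1 :=
        mem_center
      have h2 : (⟨y, hy⟩ : integralClosure v.ring E) ∈ center v u hu ↔ u y < 1 := mem_center
      rw [hcenter] at h1
      have h3 : (⟨y, hy⟩ : integralClosure v.ring E) ∈ center v u hu ↔
          closureMap v E L ⟨y, hy⟩ ∈ Q.1 := by
        rw [(hspec Q).2.over]; rfl
      exact h1.symm.trans (h3.symm.trans h2)
    · intro h
      obtain ⟨v', V, hV⟩ := W
      obtain rfl : v' = v := congrArg Place.base h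
      have hval : ∀ y : E, V (algebraMap E L y) = u y := fun y =>
        congrArg (fun w : Place F E => w.val y) h
      have hover : (center v' V hV).LiesOver (center v' u hu) := ⟨by
        ext y
        rw [Ideal.mem_under, mem_center, mem_center, ← hval]
        rfl⟩
      have hQ : center v' V hV ∈ primes :=
        (IsDedekindDomain.mem_primesOverFinset_iff hp0 _).2 ⟨inferInstance, hover⟩
      refine ⟨⟨_, hQ⟩, Finset.mem_univ _, ?_⟩
      refine Place.ext_of_val_lt_one_iff rfl fun y (hy : IsIntegral v'.ring y) => ?_
      have h1 : (⟨y, hy⟩ : integralClosure v'.ring L) ∈ center v' (U ⟨_, hQ⟩) (hU ⟨_, hQ⟩) ↔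
        U ⟨_, hQ⟩ y < 1 := mem_center
      have h2 : (⟨y, hy⟩ : integralClosure v'.ring L) ∈ center v' V hV ↔ V y < 1 := mem_center
      rw [hcenter] at h1
      exact h1.symm.trans h2
  refine ⟨s, hmem, ?_⟩
  rw [Finset.sum_image (fun Q _ Q' _ h => hinj _ _ h), ← hsum, Finset.sum_mul,
    ← Finset.sum_attach primes, ← Finset.univ_eq_attach]
  refine Finset.sum_congr rfl fun Q _ => ?_
  have := (hspec Q).1
  have := (hspec Q).2
  -- Multiplicativity of e and f in towers turns the relative degrees of the identity into local
  -- degrees over `k`.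
  have h3 : ramIdx Q.1 = ramIdx (center v u hu) * Ideal.ramificationIdx' (center v u hu) Q.1 :=
    Ideal.ramificationIdx'_algebra_tower' (IsLocalRing.maximalIdeal v.ring) _ Q.1
  have h4 : inertDeg Q.1 = inertDeg (center v u hu) * Ideal.inertiaDeg' (center v u hu) Q.1 :=
    Ideal.inertiaDeg'_algebra_tower (IsLocalRing.maximalIdeal v.ring) _ Q.1
  rw [localDegree_mk, localDegree_mk, hcenter, h3, h4]
  ring

end PlaceOfPrime

/-! ### Averages over places, weighted by local degrees -/

section PlaceSums

set_option linter.unusedSectionVars false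

variable {F : Type*} [Field F] [Fintype F]
variable {E : Type*} [Field E] [Algebra (RatFunc F) E] [FiniteDimensional (RatFunc F) E]
variable {L : Type*} [Field L] [Algebra (RatFunc F) L] [FiniteDimensional (RatFunc F) L]

/-- Summation along the fibres of π, which are finite; m records the total weight of each fibre. -/
theorem finsum_mul_comp {α β : Type*} (π : α → β) (n : α → ℝ) (m g : β → ℝ)
    (hg : g.support.Finite)
    (hfib : ∀ b, ∃ s : Finset α, (∀ a, a ∈ s ↔ π a = b) ∧ ∑ a ∈ s, n a = m b) :
    ∑ᶠ a, n a * g (π a) = ∑ᶠ b, m b * g b := by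
  classical
  choose s hs hsum using hfib
  have hb : (fun b => m b * g b).support ⊆ (hg.toFinset : Set β) := by
    intro b hb
    simpa using right_ne_zero_of_mul hb
  have ha : (fun a => n a * g (π a)).support ⊆ (hg.toFinset.biUnion s : Set α) := by
    intro a ha
    have : g (π a) ≠ 0 := right_ne_zero_of_mul ha
    simp only [Finset.coe_biUnion, Set.mem_iUnion]
    exact ⟨π a, by simpa using this, by simpa using (hs _ a).2 rfl⟩
  rw [finsum_eq_sum_of_support_subset _ hb, finsum_eq_sum_of_support_subset _ ha,
    Finset.sum_biUnion]
  · refine Finset.sum_congr rfl fun b _ => ?_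
    rw [← hsum, Finset.sum_mul]
    exact Finset.sum_congr rfl fun a ha => by rw [(hs b a).1 ha]
  · intro b _ b' _ hbb'
    refine Finset.disjoint_left.2 fun a ha ha' => hbb' ?_
    rw [← (hs b a).1 ha, ← (hs b' a).1 ha']

/-- The place of `k` itself attached to a base place. -/
def BasePlace.toPlace (v : BasePlace F) : Place F (RatFunc F) := ⟨v, v.val, fun _ => rfl⟩

theorem BasePlace.localDegree_toPlace (v : BasePlace F) : v.toPlace.localDegree = 1 := by
  have h1 : v.toPlace.ramificationIndex = 1 := Subgroup.relIndex_self _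
  have h2 : v.toPlace.inertiaDegree = 1 := by
    refine finrank_eq_one_iff'.2 ⟨1, one_ne_zero, fun z => ?_⟩
    obtain ⟨y, rfl⟩ := IsLocalRing.residue_surjective z
    refine ⟨IsLocalRing.residue _ y, ?_⟩
    rw [Algebra.smul_def, mul_one]
    rfl
  rw [Place.localDegree, h1, h2]

theorem exists_finset_base_eq (v : BasePlace F) : ∃ s : Finset (Place F L),
    (∀ W, W ∈ s ↔ W.base = v) ∧ ∑ W ∈ s, W.localDegree = Module.finrank (RatFunc F) L := by
  obtain ⟨s, hs, hsum⟩ := Place.sum_localDegree_restrict (L := L) v.toPlace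
  refine ⟨s, fun W => (hs W).trans ⟨fun h => congrArg Place.base h, fun h => ?_⟩, ?_⟩
  · subst h
    obtain ⟨v, u, hu⟩ := W
    have : (u.comap (algebraMap (RatFunc F) L)) = v.val := Valuation.ext hu
    simp only [Place.restrict, BasePlace.toPlace, this]
  · rw [hsum, BasePlace.localDegree_toPlace, mul_one]

/-- The place below, with respect to a homomorphism. -/
def Place.comap (W : Place F L) (φ : E →ₐ[RatFunc F] L) : Place F E where
  base := W.base
  val := W.val.comap (φ : E →+* L)
  val_algebraMap x := by
    rw [Valuation.comap_apply]
    exact (congrArg W.val (φ.commutes x)).trans (W.val_algebraMap x)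

variable (F) in
/-- The normalised sum over the places of `E`, with the local degrees as weights. -/
def avg (E : Type*) [Field E] [Algebra (RatFunc F) E] (g : Place F E → ℝ) : ℝ :=
  (Module.finrank (RatFunc F) E : ℝ)⁻¹ * ∑ᶠ w : Place F E, (w.localDegree : ℝ) * g w

/-- The local degrees above w add up to [L : E] n_w, and the normalisation cancels [L : E]. Heights
therefore do not depend on the field, and averages are invariant under automorphisms. -/
theorem avg_comap (φ : E →ₐ[RatFunc F] L) {g : Place F E → ℝ} (hg : g.support.Finite) :
    avg F L (fun W => g (W.comap φ)) = avg F E g := by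
  let : Algebra E L := φ.toAlgebra
  have : IsScalarTower (RatFunc F) E L := IsScalarTower.of_algebraMap_eq fun x => (φ.commutes x).symm
  have hfin : FiniteDimensional E L := FiniteDimensional.right (RatFunc F) E L
  have h := finsum_mul_comp (fun W : Place F L => W.comap φ) (fun W => (W.localDegree : ℝ))
    (fun w => Module.finrank E L * (w.localDegree : ℝ)) g hg (fun w => by
      obtain ⟨s, hs, hsum⟩ := Place.sum_localDegree_restrict (L := L) w
      exact ⟨s, hs, by exact_mod_cast hsum⟩)
  rw [avg, h, avg]
  simp_rw [mul_assoc]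
  rw [← mul_finsum _, ← Module.finrank_mul_finrank (RatFunc F) E L]
  have h0 : (Module.finrank E L : ℝ) ≠ 0 := by exact_mod_cast Module.finrank_pos.ne'
  push_cast
  field_simp

theorem avg_base {g : BasePlace F → ℝ} (hg : g.support.Finite) :
    avg F L (fun W => g W.base) = ∑ᶠ v, g v := by
  have h := finsum_mul_comp (fun W : Place F L => W.base) (fun W => (W.localDegree : ℝ))
    (fun _ => (Module.finrank (RatFunc F) L : ℝ)) g hg (fun w => by
      obtain ⟨s, hs, hsum⟩ := exists_finset_base_eq (L := L) w
      exact ⟨s, hs, by exact_mod_cast hsum⟩)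
  have h0 : (Module.finrank (RatFunc F) L : ℝ) ≠ 0 := by exact_mod_cast Module.finrank_pos.ne'
  rw [avg, h, ← mul_finsum _, inv_mul_cancel_left₀ h0]

theorem avg_add {g h : Place F L → ℝ} (hg : g.support.Finite) (hh : h.support.Finite) :
    avg F L (fun W => g W + h W) = avg F L g + avg F L h := by
  rw [avg, avg, avg, ← mul_add, ← finsum_add_distrib]
  · simp_rw [mul_add]
  · exact hg.subset fun w hw => right_ne_zero_of_mul hw
  · exact hh.subset fun w hw => right_ne_zero_of_mul hw

theorem avg_const_mul (c : ℝ) (g : Place F L → ℝ) :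
    avg F L (fun W => c * g W) = c * avg F L g := by
  rw [avg, avg]
  simp_rw [mul_left_comm _ c]
  rw [← mul_finsum, mul_left_comm]

theorem avg_zero : avg F L (fun _ => 0) = 0 := by simp [avg]

theorem avg_sum {ι : Type*} (s : Finset ι) {g : ι → Place F L → ℝ}
    (hg : ∀ i ∈ s, (g i).support.Finite) :
    (Function.support fun W => ∑ i ∈ s, g i W).Finite ∧
      avg F L (fun W => ∑ i ∈ s, g i W) = ∑ i ∈ s, avg F L (g i) := by
  classical
  induction s using Finset.induction_on with
  | empty => simp [avg_zero]
  | insert a s ha ih =>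
    obtain ⟨h1, h2⟩ := ih fun i hi => hg i (Finset.mem_insert_of_mem hi)
    have h3 := hg a (Finset.mem_insert_self _ _)
    simp_rw [Finset.sum_insert ha]
    exact ⟨(h3.union h1).subset (Function.support_add _ _), by rw [avg_add h3 h1, h2]⟩

theorem avg_mono {g f : Place F L → ℝ} (hg : g.support.Finite) (hf : f.support.Finite)
    (hle : ∀ W, g W ≤ f W) : avg F L g ≤ avg F L f := by
  have h := avg_add hf (h := fun W => -1 * g W) (hg.subset fun W hW => right_ne_zero_of_mul hW)
  rw [avg_const_mul] at h
  have h0 : 0 ≤ avg F L (fun W => f W + -1 * g W) :=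
    mul_nonneg (by positivity) (finsum_nonneg fun W => mul_nonneg (Nat.cast_nonneg _) (by
      linarith [hle W]))
  linarith

theorem avg_nonneg {g : Place F L → ℝ} (hg : ∀ W, 0 ≤ g W) : 0 ≤ avg F L g :=
  mul_nonneg (by positivity) (finsum_nonneg fun W => mul_nonneg (Nat.cast_nonneg _) (hg W))

open scoped Classical in
/-- The mass of the places above a given place of `k`. -/
theorem avg_ite_base (v : BasePlace F) :
    (Function.support fun W : Place F L => if W.base = v then (1 : ℝ) else 0).Finite ∧
      avg F L (fun W => if W.base = v then 1 else 0) = 1 := by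
  obtain ⟨s, hs, -⟩ := exists_finset_base_eq (L := L) v
  refine ⟨s.finite_toSet.subset fun W hW => ?_, ?_⟩
  · by_contra hcon
    exact hW (if_neg fun h => hcon (by simpa using (hs W).2 h))
  · have := avg_base (L := L) (g := fun u => if u = v then (1 : ℝ) else 0)
      ((Set.finite_singleton v).subset fun u hu => by
        by_contra hcon
        exact hu (if_neg hcon))
    rw [this, finsum_eq_single _ v fun u hu => if_neg hu, if_pos rfl]

end PlaceSums

/-! ### Finiteness of the set of places where an element is not a unit -/

section Finiteness

set_option linter.unusedSectionVars false

variable {F : Type*} [Field F] [Fintype F]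
variable {L : Type*} [Field L] [Algebra (RatFunc F) L] [FiniteDimensional (RatFunc F) L]

theorem BasePlace.val_some_le_one (l : MonicPrime F) (f : F[X]) :
    BasePlace.val (some l) (algebraMap F[X] (RatFunc F) f) ≤ 1 := by
  rw [BasePlace.val, realVal, Valuation.map_apply]
  exact (WithZeroMulInt.toNNReal_le_one_iff (one_lt_q_pow (F := F) l.2.2.natDegree_pos)).2
    (HeightOneSpectrum.valuation_le_one _ _)

theorem BasePlace.val_some_lt_one_iff (l : MonicPrime F) (f : F[X]) :
    BasePlace.val (some l) (algebraMap F[X] (RatFunc F) f) < 1 ↔ l.1 ∣ f := by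
  rw [BasePlace.val, realVal, Valuation.map_apply]
  refine (WithZeroMulInt.toNNReal_lt_one_iff (one_lt_q_pow (F := F) l.2.2.natDegree_pos)).trans ?_
  rw [HeightOneSpectrum.valuation_lt_one_iff_mem]
  exact Ideal.mem_span_singleton

theorem finite_monicPrime_dvd {f : F[X]} (hf : f ≠ 0) : {l : MonicPrime F | l.1 ∣ f}.Finite := by
  classical
  refine Set.Finite.of_finite_image (f := Subtype.val) ?_ Subtype.val_injective.injOn
  refine (UniqueFactorizationMonoid.normalizedFactors f).toFinset.finite_toSet.subset ?_
  rintro _ ⟨l, hl, rfl⟩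
  simp only [Finset.mem_coe, Multiset.mem_toFinset]
  obtain ⟨p, hp, hlp⟩ := UniqueFactorizationMonoid.exists_mem_normalizedFactors_of_dvd hf l.2.2 hl
  have : l.1 = p := by
    have h1 : normalize l.1 = l.1 := l.2.1.normalize_eq_self
    rw [← h1, ← UniqueFactorizationMonoid.normalize_normalized_factor p hp]
    exact normalize_eq_normalize_iff_associated.2 hlp
  rwa [this]

theorem BasePlace.finite_one_lt_val (x : RatFunc F) : {v : BasePlace F | 1 < v.val x}.Finite := by
  have h0 : algebraMap F[X] (RatFunc F) x.denom ≠ 0 := by simpa using x.denom_ne_zero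
  refine (((finite_monicPrime_dvd x.denom_ne_zero).image some).union
    (Set.finite_singleton none)).subset ?_
  intro v hv
  cases v with
  | none => exact Or.inr rfl
  | some l =>
    refine Or.inl ⟨l, ?_, rfl⟩
    rw [Set.mem_ofPred_eq, ← BasePlace.val_some_lt_one_iff]
    by_contra! hcon
    refine absurd (show 1 < BasePlace.val (some l) x from hv) (not_lt.2 ?_)
    rw [← RatFunc.num_div_denom x, map_div₀, le_antisymm (val_some_le_one l _) hcon, div_one]
    exact val_some_le_one l _

theorem finite_base_mem {s : Set (BasePlace F)} (hs : s.Finite) :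
    {W : Place F L | W.base ∈ s}.Finite := by
  have : {W : Place F L | W.base ∈ s} = ⋃ v ∈ s, {W : Place F L | W.base = v} := by
    ext W; simp
  rw [this]
  refine hs.biUnion fun v _ => ?_
  obtain ⟨t, ht, -⟩ := exists_finset_base_eq (L := L) v
  exact t.finite_toSet.subset fun W hW => by simpa using (ht W).2 hW

/-- If all coefficients of the minimal polynomial of y are integral at the place below, so is y.
Only finitely many places of `k` are poles of some coefficient. -/
theorem Place.finite_one_lt_val (y : L) : {W : Place F L | 1 < W.val y}.Finite := by
  have hint : IsIntegral (RatFunc F) y := Algebra.IsIntegral.isIntegral y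
  have hfin : (⋃ i ∈ (minpoly (RatFunc F) y).support,
      {v : BasePlace F | 1 < v.val ((minpoly (RatFunc F) y).coeff i)}).Finite :=
    Set.Finite.biUnion (Finset.finite_toSet _) fun i _ => BasePlace.finite_one_lt_val _
  refine (finite_base_mem (L := L) hfin).subset fun W hW => ?_
  by_contra hcon
  have hle : ∀ i, W.base.val ((minpoly (RatFunc F) y).coeff i) ≤ 1 := by
    intro i
    by_cases hi : i ∈ (minpoly (RatFunc F) y).support
    · by_contra! h
      exact hcon (by simp only [Set.mem_ofPred_eq, Set.mem_iUnion]; exact ⟨i, hi, h⟩)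
    · rw [notMem_support_iff.1 hi, map_zero]
      exact zero_le_one
  refine absurd hW (not_lt.2 (W.val_le_one_of_isIntegral ?_))
  have hlift : minpoly (RatFunc F) y ∈ lifts (algebraMap W.base.ring (RatFunc F)) := by
    rw [lifts_iff_coeff_lifts]
    exact fun i => ⟨⟨_, hle i⟩, rfl⟩
  obtain ⟨g, hg1, -, hg2⟩ := lifts_and_degree_eq_and_monic hlift (minpoly.monic hint)
  refine ⟨g, hg2, ?_⟩
  have h3 : eval₂ (algebraMap (RatFunc F) L) y (g.map (algebraMap W.base.ring (RatFunc F))) = 0 := by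
    rw [hg1]; exact minpoly.aeval (RatFunc F) y
  rw [eval₂_map] at h3
  exact h3

theorem Place.finite_val_ne_one {y : L} (hy : y ≠ 0) : {W : Place F L | W.val y ≠ 1}.Finite := by
  refine ((Place.finite_one_lt_val y).union (Place.finite_one_lt_val y⁻¹)).subset fun W hW => ?_
  rcases lt_or_gt_of_ne (show W.val y ≠ 1 from hW) with h | h
  · refine Or.inr ?_
    have hpos : 0 < W.val y := zero_lt_iff.2 ((Valuation.ne_zero_iff _).2 hy)
    rw [Set.mem_ofPred_eq, map_inv₀]
    exact (one_lt_inv₀ hpos).2 h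
  · exact Or.inl h

/-- The logarithm of the absolute value of a place, to the base `q`. -/
def Place.log (W : Place F L) (y : L) : ℝ := Real.logb (q F) (W.val y)

theorem Place.log_mul (W : Place F L) {y z : L} (hy : y ≠ 0) (hz : z ≠ 0) :
    W.log (y * z) = W.log y + W.log z := by
  rw [Place.log, map_mul, NNReal.coe_mul, Real.logb_mul, Place.log, Place.log]
  · exact_mod_cast (Valuation.ne_zero_iff _).2 hy
  · exact_mod_cast (Valuation.ne_zero_iff _).2 hz

theorem Place.log_support_finite {y : L} (hy : y ≠ 0) :
    (Function.support fun W : Place F L => W.log y).Finite :=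
  (Place.finite_val_ne_one hy).subset fun W hW h => hW (by
    change Real.logb _ _ = _
    rw [h]; simp)

end Finiteness

/-! ### The product formula -/

section ProductFormula

set_option linter.unusedSectionVars false

variable {F : Type*} [Field F] [Fintype F]
variable {L : Type*} [Field L] [Algebra (RatFunc F) L] [FiniteDimensional (RatFunc F) L]

/-- The logarithm of the absolute value of a place of `k`. -/
def BasePlace.log (v : BasePlace F) (x : RatFunc F) : ℝ := Real.logb (q F) (v.val x)

theorem BasePlace.log_mul (v : BasePlace F) {x y : RatFunc F} (hx : x ≠ 0) (hy : y ≠ 0) :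
    v.log (x * y) = v.log x + v.log y := by
  rw [BasePlace.log, map_mul, NNReal.coe_mul, Real.logb_mul, BasePlace.log, BasePlace.log]
  · exact_mod_cast (Valuation.ne_zero_iff _).2 hx
  · exact_mod_cast (Valuation.ne_zero_iff _).2 hy

theorem BasePlace.log_support_finite {x : RatFunc F} (hx : x ≠ 0) :
    (Function.support fun v : BasePlace F => v.log x).Finite := by
  refine ((BasePlace.finite_one_lt_val x).union (BasePlace.finite_one_lt_val x⁻¹)).subset
    fun v hv => ?_
  have hne : v.val x ≠ 1 := fun h => hv (by
    change Real.logb _ _ = _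
    rw [h]; simp)
  have hpos : 0 < v.val x := zero_lt_iff.2 ((Valuation.ne_zero_iff _).2 hx)
  rcases lt_or_gt_of_ne hne with h | h
  · refine Or.inr ?_
    rw [Set.mem_ofPred_eq, map_inv₀]
    exact (one_lt_inv₀ hpos).2 h
  · exact Or.inl h

theorem BasePlace.finsum_log_mul {x y : RatFunc F} (hx : x ≠ 0) (hy : y ≠ 0) :
    ∑ᶠ v : BasePlace F, v.log (x * y) = ∑ᶠ v : BasePlace F, v.log x + ∑ᶠ v : BasePlace F, v.log y := by
  rw [← finsum_add_distrib (BasePlace.log_support_finite hx) (BasePlace.log_support_finite hy)]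
  exact finsum_congr fun v => v.log_mul hx hy

theorem BasePlace.finsum_log_C {c : F} (hc : c ≠ 0) :
    ∑ᶠ v : BasePlace F, v.log (algebraMap F[X] (RatFunc F) (C c)) = 0 := by
  have h : ∀ v : BasePlace F, v.val (algebraMap F[X] (RatFunc F) (C c)) = 1 := by
    intro v
    cases v with
    | none =>
      rw [BasePlace.val_none (by simpa using hc), RatFunc.intDegree_polynomial]
      simp
    | some l =>
      refine le_antisymm (val_some_le_one l _) (not_lt.1 fun h => ?_)
      rw [BasePlace.val_some_lt_one_iff] at h
      exact l.2.2.not_isUnit (isUnit_of_dvd_unit h (isUnit_C.2 hc.isUnit))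
  simp_rw [BasePlace.log, h]
  simp

theorem BasePlace.finsum_log_monicPrime (l : MonicPrime F) :
    ∑ᶠ v : BasePlace F, v.log (algebraMap F[X] (RatFunc F) l.1) = 0 := by
  classical
  have hq := one_lt_q (F := F)
  have hsub : (Function.support fun v : BasePlace F => v.log (algebraMap F[X] (RatFunc F) l.1)) ⊆
      (({none, some l} : Finset (BasePlace F)) : Set (BasePlace F)) := by
    intro v hv
    cases v with
    | none => simp
    | some l' =>
      by_cases hll : l'.1 ∣ l.1
      · have : l' = l := by
          apply Subtype.ext
          exact eq_of_monic_of_associated l'.2.1 l.2.1 (l'.2.2.associated_of_dvd l.2.2 hll)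
        simp [this]
      · exfalso
        apply hv
        change Real.logb _ _ = _
        have h1 : BasePlace.val (some l') (algebraMap F[X] (RatFunc F) l.1) = 1 :=
          le_antisymm (val_some_le_one l' _) (not_lt.1 fun h => hll ((val_some_lt_one_iff l' _).1 h))
        rw [h1]
        simp
  rw [finsum_eq_sum_of_support_subset _ hsub, Finset.sum_pair (by simp), BasePlace.log,
    BasePlace.log, val_some_self, val_none (by simpa using l.2.2.ne_zero),
    RatFunc.intDegree_polynomial, zpow_natCast, NNReal.coe_inv, Real.logb_inv]
  simp

theorem BasePlace.finsum_log_polynomial {f : F[X]} (hf : f ≠ 0) :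
    ∑ᶠ v : BasePlace F, v.log (algebraMap F[X] (RatFunc F) f) = 0 := by
  induction f using UniqueFactorizationMonoid.induction_on_prime with
  | h₁ => exact absurd rfl hf
  | h₂ x hx =>
    obtain ⟨c, hc, rfl⟩ := isUnit_iff.1 hx
    exact finsum_log_C hc.ne_zero
  | h₃ a p ha hp ih =>
    have hlc : p.leadingCoeff ≠ 0 := leadingCoeff_ne_zero.2 hp.ne_zero
    have hC : C p.leadingCoeff * C p.leadingCoeff⁻¹ = 1 := by
      rw [← C_mul, mul_inv_cancel₀ hlc, C_1]
    let l : MonicPrime F := ⟨p * C p.leadingCoeff⁻¹, monic_mul_leadingCoeff_inv hp.ne_zero,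
      (associated_mul_unit_right p _ (isUnit_C.2 (inv_ne_zero hlc).isUnit)).irreducible
        hp.irreducible⟩
    have hp' : p = C p.leadingCoeff * l.1 := by
      change p = C p.leadingCoeff * (p * C p.leadingCoeff⁻¹)
      rw [mul_left_comm, hC, mul_one]
    have h1 : algebraMap F[X] (RatFunc F) (C p.leadingCoeff) ≠ 0 :=
      (map_ne_zero_iff _ (IsFractionRing.injective _ _)).2 (C_ne_zero.2 hlc)
    have h2 : algebraMap F[X] (RatFunc F) l.1 ≠ 0 :=
      (map_ne_zero_iff _ (IsFractionRing.injective _ _)).2 l.2.2.ne_zero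
    have h3 : algebraMap F[X] (RatFunc F) a ≠ 0 :=
      (map_ne_zero_iff _ (IsFractionRing.injective _ _)).2 ha
    have h4 : algebraMap F[X] (RatFunc F) (p * a) = algebraMap F[X] (RatFunc F) (C p.leadingCoeff) *
        (algebraMap F[X] (RatFunc F) l.1 * algebraMap F[X] (RatFunc F) a) := by
      rw [← map_mul, ← map_mul, ← mul_assoc, ← hp']
    rw [h4, finsum_log_mul h1 (mul_ne_zero h2 h3), finsum_log_mul h2 h3, finsum_log_C hlc,
      finsum_log_monicPrime, ih ha]
    simp

/-- The product formula on `k`. -/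
theorem BasePlace.finsum_log {x : RatFunc F} (hx : x ≠ 0) : ∑ᶠ v : BasePlace F, v.log x = 0 := by
  have hnum : x.num ≠ 0 := RatFunc.num_ne_zero hx
  have h0 : algebraMap F[X] (RatFunc F) x.denom ≠ 0 := by simpa using x.denom_ne_zero
  have h1 := finsum_log_mul hx h0
  have h2 : x * algebraMap F[X] (RatFunc F) x.denom = algebraMap F[X] (RatFunc F) x.num := by
    have := RatFunc.num_div_denom x
    rw [div_eq_iff h0] at this
    exact this.symm
  rw [h2, finsum_log_polynomial hnum, finsum_log_polynomial x.denom_ne_zero, add_zero] at h1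
  exact h1.symm

/-- The product formula for elements of `k`. -/
theorem avg_log_algebraMap {x : RatFunc F} (hx : x ≠ 0) :
    avg F L (fun W => W.log (algebraMap (RatFunc F) L x)) = 0 := by
  rw [← BasePlace.finsum_log hx, ← avg_base (L := L) (BasePlace.log_support_finite hx)]
  congr
  ext W
  rw [Place.log, W.val_algebraMap, BasePlace.log]

theorem avg_log_algEquiv {y : L} (hy : y ≠ 0) (σ : L ≃ₐ[RatFunc F] L) :
    avg F L (fun W => W.log (σ y)) = avg F L (fun W => W.log y) :=
  avg_comap (σ : L →ₐ[RatFunc F] L) (Place.log_support_finite hy)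

theorem avg_log_multiset_prod (s : Multiset L) (hs : (0 : L) ∉ s) :
    avg F L (fun W => W.log s.prod) = (s.map fun y => avg F L fun W => W.log y).sum := by
  induction s using Multiset.induction_on with
  | empty => simp [Place.log, avg_zero]
  | cons a s ih =>
    have ha : a ≠ 0 := fun h => hs (by simp [h])
    have hs' : (0 : L) ∉ s := fun h => hs (Multiset.mem_cons_of_mem h)
    have hp : s.prod ≠ 0 := Multiset.prod_ne_zero hs'
    rw [Multiset.prod_cons, Multiset.map_cons, Multiset.sum_cons, ← ih hs',
      ← avg_add (Place.log_support_finite ha) (Place.log_support_finite hp)]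
    congr
    ext W
    exact W.log_mul ha hp

/-- The product formula on a normal extension of `k`. -/
theorem avg_log [Normal (RatFunc F) L] {y : L} (hy : y ≠ 0) : avg F L (fun W => W.log y) = 0 := by
  have hint : IsIntegral (RatFunc F) y := Algebra.IsIntegral.isIntegral y
  set m := minpoly (RatFunc F) y with hm
  have hmm : m.Monic := minpoly.monic hint
  have hsplit : (m.map (algebraMap (RatFunc F) L)).Splits := Normal.splits inferInstance y
  set s := (m.map (algebraMap (RatFunc F) L)).roots with hs
  have hc0 : m.coeff 0 ≠ 0 := minpoly.coeff_zero_ne_zero hint hy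
  have hroot : ∀ z ∈ s, ∃ σ : L ≃ₐ[RatFunc F] L, σ y = z := by
    intro z hz
    have hz' : aeval z m = 0 := by
      have := isRoot_of_mem_roots hz
      rwa [IsRoot, eval_map_algebraMap] at this
    have : IsConjRoot (RatFunc F) y z := isConjRoot_of_aeval_eq_zero hint hz'
    exact isConjRoot_iff_exists_algEquiv.1 this.symm
  have hs0 : (0 : L) ∉ s := by
    intro h
    obtain ⟨σ, hσ⟩ := hroot 0 h
    exact hy ((map_eq_zero_iff σ σ.injective).1 hσ)
  have hprod := hsplit.coeff_zero_eq_prod_roots_of_monic (hmm.map _)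
  have hcard : Multiset.card s = m.natDegree := by
    rw [hs, ← hsplit.natDegree_eq_card_roots, natDegree_map]
  -- All roots of the minimal polynomial, counted with multiplicity, are images of y under
  -- automorphisms and have the same average. Their product is up to sign the constant term, which
  -- lies in `k`, so its average vanishes.
  have h1 := avg_log_multiset_prod (F := F) s hs0
  have h2 : (s.map fun z => avg F L fun W => W.log z) =
      s.map fun _ => avg F L fun W => W.log y := by
    refine Multiset.map_congr rfl fun z hz => ?_
    obtain ⟨σ, rfl⟩ := hroot z hz
    exact avg_log_algEquiv hy σ
  have h3 : avg F L (fun W => W.log s.prod) = 0 := by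
    rw [← avg_log_algebraMap (F := F) (L := L) hc0]
    congr
    ext W
    rw [← coeff_map, hprod, Place.log, Place.log, map_mul, map_pow, Valuation.map_neg, map_one,
      one_pow, one_mul]
  rw [h2, h3, Multiset.map_const', Multiset.sum_replicate, nsmul_eq_mul, hcard] at h1
  rcases mul_eq_zero.1 h1.symm with h | h
  · exact absurd h (by exact_mod_cast (minpoly.natDegree_pos hint).ne')
  · exact h

end ProductFormula

/-! ### Heights computed in an arbitrary finite extension -/

section Heights

set_option linter.unusedSectionVars false

variable {F : Type*} [Field F] [Fintype F]
variable {L : Type*} [Field L] [Algebra (RatFunc F) L] [FiniteDimensional (RatFunc F) L]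

theorem one_lt_q_real : (1 : ℝ) < q F := by exact_mod_cast one_lt_q (F := F)

/-- The logarithm to the base `q` of `max {1, |y|}`. -/
def Place.posLog (W : Place F L) (y : L) : ℝ := Real.logb (q F) (max 1 (W.val y) : ℝ≥0)

/-- `max {1, |b i|}`, the maximum being over all `i`. -/
def coeffMax {ι : Type*} [Fintype ι] (v : Valuation L ℝ≥0) (b : ι → L) : ℝ≥0 :=
  max 1 (Finset.univ.sup fun i => v (b i))

theorem one_le_coeffMax {ι : Type*} [Fintype ι] (v : Valuation L ℝ≥0) (b : ι → L) :
    1 ≤ coeffMax v b := le_max_left _ _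

theorem le_coeffMax {ι : Type*} [Fintype ι] (v : Valuation L ℝ≥0) (b : ι → L) (i : ι) :
    v (b i) ≤ coeffMax v b :=
  (Finset.le_sup (f := fun i => v (b i)) (Finset.mem_univ i)).trans (le_max_right _ _)

/-- The logarithm to the base `q` of `max {1, |b i|}`. -/
def Place.coeffLog {ι : Type*} [Fintype ι] (W : Place F L) (b : ι → L) : ℝ :=
  Real.logb (q F) (coeffMax W.val b)

theorem logb_le_logb_of_le_of_one_le {x y : ℝ≥0} (hxy : x ≤ y) (hy : 1 ≤ y) :
    Real.logb (q F) x ≤ Real.logb (q F) y := by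
  rcases eq_or_ne x 0 with rfl | hx
  · simpa using Real.logb_nonneg one_lt_q_real (by exact_mod_cast hy)
  · exact Real.logb_le_logb_of_le one_lt_q_real (by exact_mod_cast zero_lt_iff.2 hx)
      (by exact_mod_cast hxy)

theorem Place.posLog_nonneg (W : Place F L) (y : L) : 0 ≤ W.posLog y :=
  Real.logb_nonneg one_lt_q_real (by exact_mod_cast le_max_left 1 (W.val y))

theorem Place.coeffLog_nonneg {ι : Type*} [Fintype ι] (W : Place F L) (b : ι → L) :
    0 ≤ W.coeffLog b :=
  Real.logb_nonneg one_lt_q_real (by exact_mod_cast one_le_coeffMax _ _)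

theorem Place.posLog_le_coeffLog {ι : Type*} [Fintype ι] (W : Place F L) (b : ι → L) (i : ι) :
    W.posLog (b i) ≤ W.coeffLog b :=
  logb_le_logb_of_le_of_one_le (max_le (one_le_coeffMax _ _) (le_coeffMax _ b i))
    (one_le_coeffMax _ _)

/-- The default value `Real.logb (q F) 0 = 0` for vanishing entries does no harm, because of the
maximum with 0. -/
theorem Place.coeffLog_eq_iSup {ι : Type*} [Fintype ι] [Nonempty ι] (W : Place F L) (b : ι → L) :
    ⨆ i, max 0 (- W.ord (b i)) = W.coeffLog b := by
  simp_rw [Place.ord, neg_neg]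
  have hle : ∀ i, max 0 (Real.logb (q F) (W.val (b i))) ≤ W.coeffLog b := fun i =>
    max_le (W.coeffLog_nonneg b) (logb_le_logb_of_le_of_one_le (le_coeffMax _ _ _)
      (one_le_coeffMax _ _))
  have hbdd : BddAbove (Set.range fun i => max 0 (Real.logb (q F) (W.val (b i)))) :=
    ⟨_, by rintro _ ⟨i, rfl⟩; exact hle i⟩
  refine le_antisymm (ciSup_le hle) ?_
  obtain ⟨i, -, hi⟩ := Finset.exists_mem_eq_sup Finset.univ Finset.univ_nonempty
    (fun i => W.val (b i))
  refine le_trans ?_ (le_ciSup hbdd i)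
  rw [Place.coeffLog, coeffMax, hi]
  rcases le_total (W.val (b i)) 1 with h | h
  · rw [max_eq_left h]; simp
  · rw [max_eq_right h]; exact le_max_right _ _

theorem Place.coeffLog_support_finite {ι : Type*} [Fintype ι] (b : ι → L) :
    (Function.support fun W : Place F L => W.coeffLog b).Finite := by
  refine (Set.finite_iUnion fun i => Place.finite_one_lt_val (F := F) (b i)).subset fun W hW => ?_
  by_contra hcon
  simp only [Set.mem_iUnion, Set.mem_ofPred_eq, not_exists, not_lt] at hcon
  apply hW
  change Real.logb _ _ = _
  rw [coeffMax, max_eq_left (Finset.sup_le fun i _ => hcon i)]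
  simp

theorem Place.posLog_eq_coeffLog (W : Place F L) (y : L) :
    W.posLog y = W.coeffLog fun _ : Unit => y := by
  simp [Place.posLog, Place.coeffLog, coeffMax]

theorem Place.posLog_support_finite (y : L) :
    (Function.support fun W : Place F L => W.posLog y).Finite := by
  simp_rw [Place.posLog_eq_coeffLog]
  exact Place.coeffLog_support_finite _

/-- The height can be computed in every finite extension. -/
theorem affineHeight_comp {ι : Type*} [Fintype ι] [Nonempty ι] (φ : L →ₐ[RatFunc F] Bar F)
    (b : ι → L) : affineHeight (fun i => φ (b i)) = avg F L (fun W => W.coeffLog b) := by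
  set β : ι → Bar F := fun i => φ (b i) with hβ
  have hle : fieldOf β ≤ φ.fieldRange := by
    rw [IntermediateField.adjoin_le_iff]
    rintro _ ⟨i, rfl⟩
    exact ⟨b i, rfl⟩
  -- The inverse of φ on k(β), which lies in the range of φ; the average is then pulled back along
  -- it.
  let ψ : fieldOf β →ₐ[RatFunc F] L :=
    ((AlgEquiv.ofInjectiveField φ).symm : φ.range →ₐ[RatFunc F] L).comp
      ((fieldOf β).val.codRestrict φ.range fun z => hle z.2)
  have hφψ : ∀ z, φ (ψ z) = z := fun z =>
    congrArg Subtype.val ((AlgEquiv.ofInjectiveField φ).apply_symm_apply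
      ((fieldOf β).val.codRestrict φ.range (fun z => hle z.2) z))
  have hψ : ∀ i, ψ (toFieldOf β i) = b i := fun i => φ.injective (hφψ _)
  have hfin : FiniteDimensional (RatFunc F) (fieldOf β) :=
    FiniteDimensional.of_injective ψ.toLinearMap ψ.injective
  change avg F (fieldOf β) _ = _
  simp_rw [Place.coeffLog_eq_iSup]
  rw [← avg_comap ψ (Place.coeffLog_support_finite _)]
  congr
  ext W
  have : ∀ i, (W.comap ψ).val (toFieldOf β i) = W.val (b i) := fun i => congrArg W.val (hψ i)
  rw [Place.coeffLog, Place.coeffLog, coeffMax, coeffMax]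
  simp_rw [this]

theorem weilHeight_comp (φ : L →ₐ[RatFunc F] Bar F) (y : L) :
    weilHeight (φ y) = avg F L (fun W => W.posLog y) := by
  simp_rw [Place.posLog_eq_coeffLog]
  exact affineHeight_comp φ fun _ : Unit => y

theorem Place.posLog_eq (W : Place F L) (y : L) : W.posLog y = max 0 (W.log y) := by
  rw [Place.posLog_eq_coeffLog, ← Place.coeffLog_eq_iSup]
  simp [Place.ord, Place.log]

theorem Place.log_inv (W : Place F L) (y : L) : W.log y⁻¹ = - W.log y := by
  simp [Place.log]

theorem Place.posLog_inv (W : Place F L) (y : L) : W.posLog y⁻¹ + W.log y = W.posLog y := by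
  rw [Place.posLog_eq, Place.posLog_eq, Place.log_inv]
  rcases le_total 0 (W.log y) with h | h
  · rw [max_eq_right h, max_eq_left (by linarith)]; ring
  · rw [max_eq_left h, max_eq_right (by linarith)]; ring

/-- The two integrands differ by log |y|, whose average vanishes by the product formula. -/
theorem avg_posLog_inv [Normal (RatFunc F) L] {y : L} (hy : y ≠ 0) :
    avg F L (fun W => W.posLog y⁻¹) = avg F L (fun W => W.posLog y) := by
  have h := avg_add (Place.posLog_support_finite (F := F) y⁻¹) (Place.log_support_finite hy)
  simp_rw [Place.posLog_inv] at h
  rw [h, avg_log hy, add_zero]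

/-- T has poles only above infinity, and the places there have total mass 1. This yields h(Φ) ≥ 1.
-/
theorem avg_posLog_X : avg F L (fun W => W.posLog (algebraMap (RatFunc F) L RatFunc.X)) = 1 := by
  classical
  rw [← (avg_ite_base (L := L) (F := F) none).2]
  congr
  ext W
  rw [Place.posLog, W.val_algebraMap]
  rcases hW : W.base with _ | l
  · rw [BasePlace.val_none RatFunc.X_ne_zero]
    have := one_lt_q (F := F)
    rw [RatFunc.intDegree_X, zpow_one, max_eq_right (by exact_mod_cast this.le), if_pos rfl]
    exact Real.logb_self_eq_one one_lt_q_real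
  · have := BasePlace.val_some_le_one l X
    rw [RatFunc.algebraMap_X] at this
    rw [max_eq_left this, if_neg (by simp)]
    simp

/-- Finitely many algebraic elements lie in a finite normal extension of `k`. -/
theorem exists_normal_of_finite {S : Set (Bar F)} (hS : S.Finite) :
    ∃ L : IntermediateField (RatFunc F) (Bar F), FiniteDimensional (RatFunc F) L ∧
      Normal (RatFunc F) L ∧ S ⊆ L := by
  let K := IntermediateField.adjoin (RatFunc F) S
  have hK : FiniteDimensional (RatFunc F) K := by
    have := hS.to_subtype
    exact IntermediateField.finiteDimensional_adjoin
      fun x _ => Algebra.IsIntegral.isIntegral x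
  refine ⟨IntermediateField.normalClosure (RatFunc F) K (Bar F), inferInstance, inferInstance, ?_⟩
  exact (IntermediateField.subset_adjoin _ _).trans
    (IntermediateField.le_normalClosure K)

end Heights

/-! ### Local estimates for the action of `F[T]`, and their logarithmic form -/

section LocalEstimates

set_option linter.unusedSectionVars false

variable {F : Type*} [Field F] [Fintype F] {d : ℕ}
variable {L : Type*} [Field L] [Algebra F L] (v : Valuation L ℝ≥0) (a : Fin (d + 1) → L)

theorem frobenius_pow_apply (n : ℕ) (y : L) :
    ((FiniteField.frobeniusAlgHom F L).toLinearMap ^ n) y = y ^ (q F ^ n) := by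
  induction n generalizing y with
  | zero => simp
  | succ n ih => simp [pow_succ, ih, q, ← pow_mul, mul_comm]

theorem tOp_apply (z : L) : tOp (F := F) a z = ∑ i, a i * z ^ (q F ^ (i : ℕ)) := by
  simp [tOp, frobenius_pow_apply]

/-- The action of `F[T]` given by the coefficients `a`. -/
def act : F[X] →ₐ[F] Module.End F L := aeval (tOp a)

theorem act_X : act (F := F) a X = tOp a := by simp [act]

theorem act_mul_apply (f g : F[X]) (z : L) : act a (f * g) z = act a f (act a g z) := by
  rw [map_mul, Module.End.mul_apply]

theorem act_X_pow_succ (n : ℕ) (z : L) :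
    act (F := F) a (X ^ (n + 1)) z = tOp (F := F) a (act (F := F) a (X ^ n) z) := by
  rw [pow_succ', act_mul_apply, act_X]

theorem act_comm (f g : F[X]) (z : L) : act a f (act a g z) = act a g (act a f z) := by
  rw [← act_mul_apply, mul_comm, act_mul_apply]

theorem act_apply_eq_sum (f : F[X]) (z : L) :
    act a f z = f.sum fun n b => algebraMap F L b * act (F := F) a (X ^ n) z := by
  conv_lhs => rw [act, aeval_endomorphism]
  simp [Algebra.smul_def, act]

theorem map_tOp {E : Type*} [Field E] [Algebra F E] (φ : E →ₐ[F] L) (b : Fin (d + 1) → E) (z : E) :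
    φ (tOp (F := F) b z) = tOp (F := F) (fun i => φ (b i)) (φ z) := by
  simp [tOp_apply]

theorem map_act {E : Type*} [Field E] [Algebra F E] (φ : E →ₐ[F] L) (b : Fin (d + 1) → E)
    (f : F[X]) (z : E) : φ (act b f z) = act (fun i => φ (b i)) f (φ z) := by
  have h : ∀ n, φ (act (F := F) b (X ^ n) z) = act (F := F) (fun i => φ (b i)) (X ^ n) (φ z) := by
    intro n
    induction n with
    | zero => simp
    | succ n ih => rw [act_X_pow_succ, act_X_pow_succ, map_tOp, ih]
  rw [act_apply_eq_sum, act_apply_eq_sum, Polynomial.sum, Polynomial.sum, map_sum]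
  simp_rw [map_mul, h, AlgHom.commutes]

theorem one_lt_card_q : 1 < q F := Fintype.one_lt_card

theorem q_pow_le_q_pow {i j : ℕ} (h : i ≤ j) : q F ^ i ≤ q F ^ j :=
  Nat.pow_le_pow_right (zero_lt_one.trans (one_lt_card_q (F := F))) h

theorem max_one_tOp_le (z : L) :
    max 1 (v (tOp (F := F) a z)) ≤ coeffMax v a * max 1 (v z) ^ (q F ^ d) := by
  have h1 : (1 : ℝ≥0) ≤ max 1 (v z) := le_max_left _ _
  refine max_le (one_le_mul (one_le_coeffMax _ _) (one_le_pow₀ h1)) ?_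
  rw [tOp_apply]
  refine v.map_sum_le fun i _ => ?_
  rw [map_mul, map_pow]
  refine mul_le_mul' (le_coeffMax v a i) ?_
  exact (pow_le_pow_left' (le_max_right 1 _) _).trans
    (pow_le_pow_right₀ h1 (q_pow_le_q_pow (Nat.lt_succ_iff.1 i.2)))

/-- If |z|^{q^d} > R², where R bounds |a_i| and |a_i / a_d|, then the top term of Φ(T)(z) dominates:
the exponent gap q^d - q^i is at least q^d/2, so |z| raised to the gap exceeds R. Otherwise the
factor R² alone suffices. -/
theorem pow_max_one_le (ha : a (Fin.last d) ≠ 0) (z : L) :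
    max 1 (v z) ^ (q F ^ d) ≤
      max 1 (v (tOp (F := F) a z)) * (coeffMax v a * max 1 (v (a (Fin.last d))⁻¹)) ^ 2 := by
  set R := coeffMax v a * max 1 (v (a (Fin.last d))⁻¹) with hR
  have hR1 : 1 ≤ R := one_le_mul (one_le_coeffMax _ _) (le_max_left _ _)
  by_cases hz : max 1 (v z) ^ (q F ^ d) ≤ R ^ 2
  · exact hz.trans (le_mul_of_one_le_left' (le_max_left _ _))
  push Not at hz
  have hz1 : 1 < v z := by
    by_contra hcon
    rw [max_eq_left (not_lt.1 hcon), one_pow] at hz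
    exact hz.not_ge (one_le_pow₀ hR1)
  rw [max_eq_right hz1.le] at hz ⊢
  have had : v (a (Fin.last d)) ≠ 0 := (Valuation.ne_zero_iff _).2 ha
  have hz0 : v z ≠ 0 := (zero_lt_one.trans hz1).ne'
  have hdom : ∀ i : Fin d, v (a i.castSucc * z ^ (q F ^ (i : ℕ))) <
      v (a (Fin.last d) * z ^ (q F ^ d)) := by
    intro i
    have hqi : 2 * q F ^ (i : ℕ) ≤ q F ^ d := by
      calc 2 * q F ^ (i : ℕ) ≤ q F * q F ^ (i : ℕ) := Nat.mul_le_mul_right _ one_lt_card_q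
        _ = q F ^ ((i : ℕ) + 1) := by rw [pow_succ']
        _ ≤ q F ^ d := q_pow_le_q_pow i.2
    obtain ⟨e, he⟩ := Nat.exists_eq_add_of_le (show q F ^ (i : ℕ) ≤ q F ^ d by omega)
    have h2 : R < v z ^ e := by
      refine lt_of_pow_lt_pow_left₀ 2 (zero_le) (hz.trans_le ?_)
      rw [← pow_mul]
      exact pow_le_pow_right₀ hz1.le (by omega)
    have h3 : v (a i.castSucc) < v (a (Fin.last d)) * v z ^ e := by
      have h4 : v (a i.castSucc) * (v (a (Fin.last d)))⁻¹ ≤ R :=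
        mul_le_mul' (le_coeffMax v a _) (by rw [map_inv₀]; exact le_max_right _ _)
      have h5 := h4.trans_lt h2
      rwa [← div_eq_mul_inv, div_lt_iff₀ (zero_lt_iff.2 had), mul_comm] at h5
    rw [map_mul, map_mul, map_pow, map_pow, he, add_comm, pow_add, ← mul_assoc]
    exact mul_lt_mul_of_pos_right h3 (pow_pos (zero_lt_iff.2 hz0) _)
  have hval : v (tOp (F := F) a z) = v (a (Fin.last d)) * v z ^ (q F ^ d) := by
    rw [tOp_apply, Fin.sum_univ_castSucc]
    have hpos : v (a (Fin.last d) * z ^ (q F ^ d)) ≠ 0 := by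
      rw [map_mul, map_pow]
      exact mul_ne_zero had (pow_ne_zero _ hz0)
    have hlt : v (∑ i : Fin d, a i.castSucc * z ^ (q F ^ ((i.castSucc : Fin (d + 1)) : ℕ))) <
        v (a (Fin.last d) * z ^ (q F ^ ((Fin.last d : Fin (d + 1)) : ℕ))) :=
      v.map_sum_lt hpos fun i _ => hdom i
    rw [v.map_add_eq_of_lt_right hlt]
    simp
  calc v z ^ (q F ^ d) = v (tOp (F := F) a z) * v (a (Fin.last d))⁻¹ := by
        rw [hval, map_inv₀, mul_right_comm, mul_inv_cancel₀ had, one_mul]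
    _ ≤ max 1 (v (tOp (F := F) a z)) * R ^ 2 := by
        refine mul_le_mul' (le_max_right _ _) ?_
        refine le_trans ?_ (le_self_pow₀ hR1 two_ne_zero)
        exact (le_max_right _ _).trans (le_mul_of_one_le_left' (one_le_coeffMax _ _))

theorem val_algebraMap_le_one (c : F) : v (algebraMap F L c) ≤ 1 := by
  by_contra h
  push Not at h
  have h1 : v (algebraMap F L c) ^ Fintype.card F = v (algebraMap F L c) := by
    rw [← map_pow, ← map_pow, FiniteField.pow_card]
  exact (lt_self_pow₀ h Fintype.one_lt_card).ne' h1

/-- The extra factor A = `coeffMax v a` on the left lets the induction close: one step gives A · A,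
and A² ≤ A^{q^d} because q^d ≥ 2. -/
theorem coeffMax_mul_max_one_act_X_pow_le (hd : 0 < d) (z : L) (n : ℕ) :
    coeffMax v a * max 1 (v (act (F := F) a (X ^ n) z)) ≤
      (coeffMax v a * max 1 (v z)) ^ ((q F ^ d) ^ n) := by
  induction n with
  | zero => simp
  | succ n ih =>
    have hB : 2 ≤ q F ^ d := Nat.le_trans (one_lt_card_q (F := F)) (Nat.le_self_pow hd.ne' _)
    calc coeffMax v a * max 1 (v (act (F := F) a (X ^ (n + 1)) z))
        ≤ coeffMax v a * (coeffMax v a * max 1 (v (act (F := F) a (X ^ n) z)) ^ (q F ^ d)) := by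
          rw [act_X_pow_succ]
          exact mul_le_mul_right (max_one_tOp_le v a _) _
      _ = coeffMax v a ^ 2 * max 1 (v (act (F := F) a (X ^ n) z)) ^ (q F ^ d) := by ring
      _ ≤ coeffMax v a ^ (q F ^ d) * max 1 (v (act (F := F) a (X ^ n) z)) ^ (q F ^ d) :=
          mul_le_mul_left (pow_le_pow_right₀ (one_le_coeffMax _ _) hB) _
      _ = (coeffMax v a * max 1 (v (act (F := F) a (X ^ n) z))) ^ (q F ^ d) := by rw [mul_pow]
      _ ≤ ((coeffMax v a * max 1 (v z)) ^ ((q F ^ d) ^ n)) ^ (q F ^ d) := pow_le_pow_left' ih _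
      _ = _ := by rw [← pow_mul, pow_succ]

theorem max_one_act_le (hd : 0 < d) (f : F[X]) (z : L) :
    max 1 (v (act a f z)) ≤ (coeffMax v a * max 1 (v z)) ^ ((q F ^ d) ^ f.natDegree) := by
  have h1 : 1 ≤ coeffMax v a * max 1 (v z) := one_le_mul (one_le_coeffMax _ _) (le_max_left _ _)
  refine max_le (one_le_pow₀ h1) ?_
  rw [act_apply_eq_sum, Polynomial.sum]
  refine v.map_sum_le fun n hn => ?_
  rw [map_mul]
  refine (mul_le_of_le_one_left' (val_algebraMap_le_one v _)).trans ?_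
  refine (le_max_right 1 _).trans ((le_mul_of_one_le_left' (one_le_coeffMax v a)).trans ?_)
  refine (coeffMax_mul_max_one_act_X_pow_le v a hd z n).trans (pow_le_pow_right₀ h1 ?_)
  exact Nat.pow_le_pow_right (pow_pos (zero_lt_one.trans one_lt_card_q) _) (le_natDegree_of_mem_supp _ hn)

end LocalEstimates

section PlaceEstimates

set_option linter.unusedSectionVars false

variable {F : Type*} [Field F] [Fintype F] {d : ℕ}
variable {L : Type*} [Field L] [Algebra F L] [Algebra (RatFunc F) L] [FiniteDimensional (RatFunc F) L]
  (W : Place F L) (a : Fin (d + 1) → L)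

theorem logb_mul_nnreal {x y : ℝ≥0} (hx : 1 ≤ x) (hy : 1 ≤ y) :
    Real.logb (q F) (x * y : ℝ≥0) = Real.logb (q F) x + Real.logb (q F) y := by
  rw [NNReal.coe_mul, Real.logb_mul]
  · exact_mod_cast (zero_lt_one.trans_le hx).ne'
  · exact_mod_cast (zero_lt_one.trans_le hy).ne'

theorem logb_pow_nnreal (x : ℝ≥0) (n : ℕ) :
    Real.logb (q F) (x ^ n : ℝ≥0) = n * Real.logb (q F) x := by
  rw [NNReal.coe_pow, Real.logb_pow]

theorem logb_le_logb_nnreal {x y : ℝ≥0} (hx : 1 ≤ x) (hxy : x ≤ y) :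
    Real.logb (q F) x ≤ Real.logb (q F) y :=
  logb_le_logb_of_le_of_one_le hxy (hx.trans hxy)

theorem Place.posLog_tOp_le (z : L) :
    W.posLog (tOp (F := F) a z) ≤ q F ^ d * W.posLog z + W.coeffLog a := by
  have h := logb_le_logb_nnreal (F := F) (le_max_left _ _) (max_one_tOp_le (F := F) W.val a z)
  rw [logb_mul_nnreal (one_le_coeffMax _ _) (one_le_pow₀ (le_max_left _ _)), logb_pow_nnreal] at h
  push_cast at h
  unfold Place.posLog Place.coeffLog
  push_cast
  linarith

theorem Place.mul_posLog_le (ha : a (Fin.last d) ≠ 0) (z : L) :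
    q F ^ d * W.posLog z ≤
      W.posLog (tOp (F := F) a z) + 2 * (W.coeffLog a + W.posLog (a (Fin.last d))⁻¹) := by
  have h := logb_le_logb_nnreal (F := F) (one_le_pow₀ (le_max_left _ _))
    (pow_max_one_le (F := F) W.val a ha z)
  have h1 : 1 ≤ coeffMax W.val a * max 1 (W.val (a (Fin.last d))⁻¹) :=
    one_le_mul (one_le_coeffMax _ _) (le_max_left _ _)
  rw [logb_mul_nnreal (le_max_left _ _) (one_le_pow₀ h1), logb_pow_nnreal, logb_pow_nnreal,
    logb_mul_nnreal (one_le_coeffMax _ _) (le_max_left _ _)] at h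
  unfold Place.posLog Place.coeffLog
  push_cast at h ⊢
  linarith

theorem Place.posLog_act_le (hd : 0 < d) (f : F[X]) (z : L) :
    W.posLog (act a f z) ≤ (q F ^ d) ^ f.natDegree * (W.coeffLog a + W.posLog z) := by
  have h := logb_le_logb_nnreal (F := F) (le_max_left _ _) (max_one_act_le W.val a hd f z)
  rw [logb_pow_nnreal, logb_mul_nnreal (one_le_coeffMax _ _) (le_max_left _ _)] at h
  unfold Place.posLog Place.coeffLog
  push_cast at h ⊢
  linarith

end PlaceEstimates

/-! ### The canonical height -/

section CanonicalHeight

set_option linter.unusedSectionVars false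

variable {F : Type*} [Field F] [Fintype F] {d : ℕ} (Φ : DrinfeldModule F d)

namespace DrinfeldModule

theorem hom_eq_act : Φ.hom = act Φ.coeff := rfl

/-- Finitely many points and the coefficients of `Φ` lie in a finite normal extension of `k`. -/
theorem exists_model {S : Set (Bar F)} (hS : S.Finite) :
    ∃ (L : IntermediateField (RatFunc F) (Bar F)) (a : Fin (d + 1) → L),
      FiniteDimensional (RatFunc F) L ∧ Normal (RatFunc F) L ∧ S ⊆ L ∧
      (fun i => (a i : Bar F)) = Φ.coeff := by
  obtain ⟨L, h1, h2, h3⟩ := exists_normal_of_finite (hS.union (Set.finite_range Φ.coeff))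
  exact ⟨L, fun i => ⟨Φ.coeff i, h3 (Or.inr ⟨i, rfl⟩)⟩, h1, h2,
    Set.subset_union_left.trans h3, rfl⟩

section Model

variable {L : IntermediateField (RatFunc F) (Bar F)} {a : Fin (d + 1) → L}
  (ha : (fun i => (a i : Bar F)) = Φ.coeff)
include ha

theorem coe_act (f : F[X]) (z : L) : ((act a f z : L) : Bar F) = Φ.hom f z := by
  rw [hom_eq_act, ← ha]
  exact map_act (L.val.restrictScalars F) a f z

theorem height_eq_avg [FiniteDimensional (RatFunc F) L] :
    Φ.height = avg F L (fun W => W.coeffLog a) := by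
  rw [height, ← ha]
  exact affineHeight_comp L.val a

theorem weilHeight_hom_eq_avg [FiniteDimensional (RatFunc F) L] (f : F[X]) (z : L) :
    weilHeight (Φ.hom f z) = avg F L (fun W => W.posLog (act a f z)) := by
  rw [← Φ.coe_act ha]
  exact weilHeight_comp L.val _

theorem coeff_last_ne_zero_of_model : a (Fin.last d) ≠ 0 := by
  intro h
  apply Φ.coeff_last
  rw [← ha]
  simp [h]

end Model

/-- The coefficient a_0 = T already has height 1. -/
theorem one_le_height : 1 ≤ Φ.height := by
  obtain ⟨L, a, h1, h2, -, ha⟩ := Φ.exists_model Set.finite_empty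
  rw [Φ.height_eq_avg ha, ← avg_posLog_X (F := F) (L := L)]
  refine avg_mono (Place.posLog_support_finite _) (Place.coeffLog_support_finite _) fun W => ?_
  have : a 0 = algebraMap (RatFunc F) L RatFunc.X := by
    apply Subtype.ext
    rw [show ((a 0 : L) : Bar F) = Φ.coeff 0 from congrFun ha 0, Φ.coeff_zero]
    rfl
  rw [← this]
  exact W.posLog_le_coeffLog a 0

theorem weilHeight_hom_le (f : F[X]) (y : Bar F) :
    weilHeight (Φ.hom f y) ≤ ((q F : ℝ) ^ d) ^ f.natDegree * (Φ.height + weilHeight y) := by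
  obtain ⟨L, a, h1, h2, hS, ha⟩ := Φ.exists_model (Set.finite_singleton y)
  obtain ⟨z, rfl⟩ : ∃ z : L, (z : Bar F) = y := ⟨⟨y, hS rfl⟩, rfl⟩
  have hz := weilHeight_comp L.val z
  rw [IntermediateField.coe_val] at hz
  rw [Φ.weilHeight_hom_eq_avg ha, Φ.height_eq_avg ha, hz,
    ← avg_add (Place.coeffLog_support_finite _) (Place.posLog_support_finite _), ← avg_const_mul]
  refine avg_mono (Place.posLog_support_finite _) ?_ fun W => ?_
  · refine ((Place.coeffLog_support_finite (F := F) a).union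
      (Place.posLog_support_finite (F := F) z)).subset fun W hW => ?_
    by_contra hcon
    simp only [Set.mem_union, Function.mem_support, not_or, not_not] at hcon
    exact hW (by simp [hcon])
  · exact W.posLog_act_le a Φ.rank_pos f z

theorem weilHeight_hom_X_le (y : Bar F) :
    weilHeight (Φ.hom X y) ≤ (q F : ℝ) ^ d * weilHeight y + Φ.height := by
  obtain ⟨L, a, h1, h2, hS, ha⟩ := Φ.exists_model (Set.finite_singleton y)
  obtain ⟨z, rfl⟩ : ∃ z : L, (z : Bar F) = y := ⟨⟨y, hS rfl⟩, rfl⟩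
  have hz := weilHeight_comp L.val z
  rw [IntermediateField.coe_val] at hz
  have hfin : (Function.support fun W : Place F L => (q F : ℝ) ^ d * W.posLog z).Finite :=
    (Place.posLog_support_finite (F := F) z).subset fun W hW => right_ne_zero_of_mul hW
  rw [Φ.weilHeight_hom_eq_avg ha, Φ.height_eq_avg ha, hz, ← avg_const_mul,
    ← avg_add hfin (Place.coeffLog_support_finite _)]
  refine avg_mono (Place.posLog_support_finite _) ?_ fun W => ?_
  · exact (hfin.union (Place.coeffLog_support_finite (F := F) a)).subset
      (Function.support_add _ _)
  · rw [act_X]; exact W.posLog_tOp_le a z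

/-- The constant is 4 = 2 · 2: the local error is 2 (log max{1, |a_i|} + log⁺ |1/a_d|), and h(1/a_d)
= h(a_d) ≤ h(Φ). -/
theorem mul_weilHeight_le (y : Bar F) :
    (q F : ℝ) ^ d * weilHeight y ≤ weilHeight (Φ.hom X y) + 4 * Φ.height := by
  obtain ⟨L, a, h1, h2, hS, ha⟩ := Φ.exists_model (Set.finite_singleton y)
  obtain ⟨z, rfl⟩ : ∃ z : L, (z : Bar F) = y := ⟨⟨y, hS rfl⟩, rfl⟩
  have hz := weilHeight_comp L.val z
  rw [IntermediateField.coe_val] at hz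
  have had := Φ.coeff_last_ne_zero_of_model ha
  have hfin : (Function.support fun W : Place F L => (q F : ℝ) ^ d * W.posLog z).Finite :=
    (Place.posLog_support_finite (F := F) z).subset fun W hW => right_ne_zero_of_mul hW
  have hf1 := Place.posLog_support_finite (F := F) (act (F := F) a X z)
  have hf2 := Place.coeffLog_support_finite (F := F) a
  have hf3 := Place.posLog_support_finite (F := F) (a (Fin.last d))⁻¹
  have hf23 := (hf2.union hf3).subset (Function.support_add _ _)
  have hf4 : (Function.support fun W : Place F L =>
      (2 : ℝ) * (W.coeffLog a + W.posLog (a (Fin.last d))⁻¹)).Finite :=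
    hf23.subset fun W hW => right_ne_zero_of_mul hW
  have h := avg_mono hfin ((hf1.union hf4).subset (Function.support_add _ _)) fun W => by
    have := W.mul_posLog_le a had z
    rw [← act_X] at this
    exact this
  rw [avg_const_mul] at h
  rw [avg_add hf1 hf4, avg_const_mul, avg_add hf2 hf3, avg_posLog_inv had] at h
  have h5 := avg_mono (Place.posLog_support_finite (F := F) (a (Fin.last d))) hf2
    fun W => W.posLog_le_coeffLog a (Fin.last d)
  rw [Φ.weilHeight_hom_eq_avg ha, Φ.height_eq_avg ha, hz]
  linarith

theorem weilHeight_nonneg (y : Bar F) : 0 ≤ weilHeight y := by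
  obtain ⟨L, h1, h2, hS⟩ := exists_normal_of_finite (Set.finite_singleton y)
  rw [show y = L.val ⟨y, hS rfl⟩ from rfl, weilHeight_comp]
  exact avg_nonneg fun W => W.posLog_nonneg _

theorem weilHeight_map (σ : Bar F →ₐ[RatFunc F] Bar F) (y : Bar F) :
    weilHeight (σ y) = weilHeight y := by
  obtain ⟨L, h1, h2, hS⟩ := exists_normal_of_finite (Set.finite_singleton y)
  have e1 := weilHeight_comp L.val ⟨y, hS rfl⟩
  have e2 := weilHeight_comp (σ.comp L.val) ⟨y, hS rfl⟩
  exact e2.trans e1.symm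

theorem two_le_q_pow (Φ : DrinfeldModule F d) : (2 : ℝ) ≤ (q F : ℝ) ^ d := by
  have : 2 ≤ q F ^ d := Nat.le_trans (one_lt_card_q (F := F)) (Nat.le_self_pow Φ.rank_pos.ne' _)
  exact_mod_cast this

theorem hom_X_pow_succ (n : ℕ) (y : Bar F) : Φ.hom (X ^ (n + 1)) y = Φ.hom X (Φ.hom (X ^ n) y) := by
  rw [pow_succ', map_mul, Module.End.mul_apply]

/-- The bound |h(Φ(T)(y)) - q^d h(y)| ≤ 4 h(Φ), applied at Φ(T^n)(y) and divided by q^{d(n+1)}.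
Geometric decay makes the sequence Cauchy. -/
theorem dist_heightSeq_le (y : Bar F) (n : ℕ) :
    dist (Φ.heightSeq y n) (Φ.heightSeq y (n + 1)) ≤
      4 * Φ.height / (q F : ℝ) ^ d * (((q F : ℝ) ^ d)⁻¹) ^ n := by
  have hB := Φ.two_le_q_pow
  have h1 := Φ.weilHeight_hom_X_le (Φ.hom (X ^ n) y)
  have h2 := Φ.mul_weilHeight_le (Φ.hom (X ^ n) y)
  have hh := Φ.one_le_height
  rw [← hom_X_pow_succ] at h1 h2
  rw [heightSeq, heightSeq, pow_mul, pow_mul]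
  generalize (q F : ℝ) ^ d = B at *
  have hB0 : 0 < B := by linarith
  have hBn : 0 < B ^ (n + 1) := pow_pos hB0 _
  have e : weilHeight (Φ.hom (X ^ n) y) / B ^ n - weilHeight (Φ.hom (X ^ (n + 1)) y) / B ^ (n + 1) =
      (B * weilHeight (Φ.hom (X ^ n) y) - weilHeight (Φ.hom (X ^ (n + 1)) y)) / B ^ (n + 1) := by
    rw [pow_succ B]; field_simp
  have e2 : 4 * Φ.height / B * (B⁻¹) ^ n = 4 * Φ.height / B ^ (n + 1) := by
    rw [pow_succ, inv_pow]; field_simp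
  rw [Real.dist_eq, e, e2, abs_div, abs_of_pos hBn]
  gcongr
  rw [abs_le]
  constructor <;> linarith

theorem tendsto_heightSeq (y : Bar F) :
    Tendsto (Φ.heightSeq y) atTop (𝓝 (Φ.canonicalHeight y)) := by
  have hB := Φ.two_le_q_pow
  exact (cauchySeq_of_le_geometric _ _ (inv_lt_one_of_one_lt₀ (by linarith))
    (Φ.dist_heightSeq_le y)).tendsto_limUnder

theorem weilHeight_le_canonicalHeight_add (y : Bar F) :
    weilHeight y ≤ Φ.canonicalHeight y + 4 * Φ.height / ((q F : ℝ) ^ d - 1) := by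
  have hB := Φ.two_le_q_pow
  have h := dist_le_of_le_geometric_of_tendsto₀ _ _ (inv_lt_one_of_one_lt₀ (by linarith))
    (Φ.dist_heightSeq_le y) (Φ.tendsto_heightSeq y)
  have h0 : Φ.heightSeq y 0 = weilHeight y := by simp [heightSeq]
  rw [h0, Real.dist_eq] at h
  have := (le_abs_self _).trans h
  have e : 4 * Φ.height / (q F : ℝ) ^ d / (1 - ((q F : ℝ) ^ d)⁻¹) =
      4 * Φ.height / ((q F : ℝ) ^ d - 1) := by
    have h1 : (q F : ℝ) ^ d ≠ 0 := by positivity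
    rw [div_div, mul_sub, mul_one, mul_inv_cancel₀ h1]
  rw [e] at this
  linarith

theorem canonicalHeight_nonneg (y : Bar F) : 0 ≤ Φ.canonicalHeight y :=
  ge_of_tendsto' (Φ.tendsto_heightSeq y) fun n =>
    div_nonneg (weilHeight_nonneg _) (by positivity)

theorem canonicalHeight_hom_X_pow (j : ℕ) (y : Bar F) :
    Φ.canonicalHeight (Φ.hom (X ^ j) y) = ((q F : ℝ) ^ d) ^ j * Φ.canonicalHeight y := by
  refine tendsto_nhds_unique (Φ.tendsto_heightSeq _) ?_
  have h := ((tendsto_add_atTop_iff_nat j).2 (Φ.tendsto_heightSeq y)).const_mul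
    (((q F : ℝ) ^ d) ^ j)
  refine h.congr fun n => ?_
  have hB := Φ.two_le_q_pow
  rw [heightSeq, heightSeq, ← Module.End.mul_apply, ← map_mul, ← pow_add, pow_mul, pow_mul]
  generalize (q F : ℝ) ^ d = B at *
  have hB0 : B ≠ 0 := by linarith
  rw [pow_add B]
  field_simp

/-- The additive h(Φ) in `weilHeight_hom_le` is divided by q^{dn} and disappears in the limit. -/
theorem canonicalHeight_hom_le (f : F[X]) (y : Bar F) :
    Φ.canonicalHeight (Φ.hom f y) ≤ ((q F : ℝ) ^ d) ^ f.natDegree * Φ.canonicalHeight y := by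
  have hB := Φ.two_le_q_pow
  have h1 : Tendsto (fun n : ℕ => (((q F : ℝ) ^ d)⁻¹) ^ n) atTop (𝓝 0) :=
    tendsto_pow_atTop_nhds_zero_of_lt_one (by positivity) (inv_lt_one_of_one_lt₀ (by linarith))
  have h2 := ((h1.const_mul Φ.height).add (Φ.tendsto_heightSeq y)).const_mul
    (((q F : ℝ) ^ d) ^ f.natDegree)
  rw [mul_zero, zero_add] at h2
  refine le_of_tendsto_of_tendsto' (Φ.tendsto_heightSeq _) h2 fun n => ?_
  have h3 := Φ.weilHeight_hom_le f (Φ.hom (X ^ n) y)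
  rw [heightSeq, heightSeq, hom_eq_act, act_comm, ← hom_eq_act, pow_mul]
  have : 0 < ((q F : ℝ) ^ d) ^ n := by positivity
  rw [div_le_iff₀ this]
  refine h3.trans (le_of_eq ?_)
  rw [inv_pow]
  field_simp

theorem canonicalHeight_map (σ : Bar F →ₐ[RatFunc F] Bar F) (hσ : ∀ i, σ (Φ.coeff i) = Φ.coeff i)
    (y : Bar F) : Φ.canonicalHeight (σ y) = Φ.canonicalHeight y := by
  refine tendsto_nhds_unique (Φ.tendsto_heightSeq _) ((Φ.tendsto_heightSeq y).congr fun n => ?_)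
  have h := map_act (σ.restrictScalars F) Φ.coeff (X ^ n) y
  have e : (fun i => σ.restrictScalars F (Φ.coeff i)) = Φ.coeff := funext hσ
  rw [e] at h
  rw [heightSeq, heightSeq, ← weilHeight_map σ]
  exact congrArg (fun z => weilHeight z / _) h

end DrinfeldModule

end CanonicalHeight

/-! ### Additivity of Φ(T)(X), and Gauss norms -/

section TPoly

set_option linter.unusedSectionVars false

variable {F : Type*} [Field F] [Fintype F] {d : ℕ}
variable {L : Type*} [Field L] [Algebra F L] (a : Fin (d + 1) → L)

theorem add_pow_q_pow {R : Type*} [CommRing R] [Algebra F R] (x y : R) (n : ℕ) :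
    (x + y) ^ (q F ^ n) = x ^ (q F ^ n) + y ^ (q F ^ n) := by
  induction n with
  | zero => simp
  | succ n ih =>
    have h := map_add (FiniteField.frobeniusAlgHom F R) (x ^ (q F ^ n)) (y ^ (q F ^ n))
    simp only [FiniteField.frobeniusAlgHom_apply] at h
    rw [pow_succ, pow_mul, pow_mul, pow_mul, ih]
    exact h

theorem eval_tPoly (z : L) : (tPoly F a).eval z = tOp (F := F) a z := by
  simp [tPoly, tOp_apply, eval_finsetSum]

/-- Additivity: Φ(T)(X + z) = Φ(T)(X) + Φ(T)(z). -/
theorem taylor_tPoly (z : L) : taylor z (tPoly F a) = tPoly F a + C (tOp (F := F) a z) := by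
  rw [taylor_apply, tPoly, tOp_apply, map_sum, ← Finset.sum_add_distrib, Polynomial.comp,
    eval₂_finsetSum]
  refine Finset.sum_congr rfl fun i _ => ?_
  rw [eval₂_mul, eval₂_C, eval₂_pow, eval₂_X, add_pow_q_pow (F := F), mul_add]
  simp

theorem natDegree_tPoly_and_leadingCoeff (ha : a (Fin.last d) ≠ 0) :
    (tPoly F a).natDegree = q F ^ d ∧ (tPoly F a).leadingCoeff = a (Fin.last d) := by
  have hcoeff : (tPoly F a).coeff (q F ^ d) = a (Fin.last d) := by
    rw [tPoly, finsetSum_coeff, Finset.sum_eq_single (Fin.last d)]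
    · simp
    · intro i _ hi
      rw [coeff_C_mul, coeff_X_pow, if_neg, mul_zero]
      intro h
      exact hi (Fin.ext (Nat.pow_right_injective one_lt_card_q h).symm)
    · simp
  have hle : (tPoly F a).natDegree ≤ q F ^ d := by
    refine natDegree_sum_le_of_forall_le _ _ fun i _ => ?_
    exact (natDegree_C_mul_X_pow_le _ _).trans (q_pow_le_q_pow (Nat.lt_succ_iff.1 i.2))
  have hdeg : (tPoly F a).natDegree = q F ^ d :=
    le_antisymm hle (le_natDegree_of_ne_zero (by rwa [hcoeff]))
  exact ⟨hdeg, by rw [leadingCoeff, hdeg, hcoeff]⟩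

end TPoly

section GaussBound

set_option linter.unusedSectionVars false

variable {L : Type*} [Field L] (v : Valuation L ℝ≥0)

/-- The Gauss norm of `f` for the radius `ρ` is at most `c`. -/
def GaussLE (ρ : ℝ≥0) (f : L[X]) (c : ℝ≥0) : Prop := ∀ k, v (f.coeff k) * ρ ^ k ≤ c

variable {v} {ρ ρ' c c' : ℝ≥0} {f g : L[X]}

theorem GaussLE.mono (h : GaussLE v ρ f c) (hc : c ≤ c') : GaussLE v ρ f c' :=
  fun k => (h k).trans hc

theorem GaussLE.add (hf : GaussLE v ρ f c) (hg : GaussLE v ρ g c) : GaussLE v ρ (f + g) c := by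
  intro k
  rw [coeff_add]
  rcases le_total (v (f.coeff k)) (v (g.coeff k)) with h | h
  · exact (mul_le_mul_left ((v.map_add _ _).trans (max_le h le_rfl)) _).trans (hg k)
  · exact (mul_le_mul_left ((v.map_add _ _).trans (max_le le_rfl h)) _).trans (hf k)

theorem GaussLE.sum {ι : Type*} {s : Finset ι} {f : ι → L[X]}
    (hf : ∀ i ∈ s, GaussLE v ρ (f i) c) : GaussLE v ρ (∑ i ∈ s, f i) c := by
  classical
  induction s using Finset.induction_on with
  | empty => intro k; simp
  | insert i s hi ih =>
    rw [Finset.sum_insert hi]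
    exact (hf i (Finset.mem_insert_self _ _)).add
      (ih fun j hj => hf j (Finset.mem_insert_of_mem hj))

theorem GaussLE.mul (hf : GaussLE v ρ f c) (hg : GaussLE v ρ g c') :
    GaussLE v ρ (f * g) (c * c') := by
  intro k
  rcases eq_or_ne (ρ ^ k) 0 with h0 | h0
  · rw [h0, mul_zero]; exact zero_le
  rw [coeff_mul, ← le_div_iff₀ (zero_lt_iff.2 h0)]
  refine v.map_sum_le fun p hp => ?_
  rw [le_div_iff₀ (zero_lt_iff.2 h0), map_mul, ← Finset.HasAntidiagonal.mem_antidiagonal.1 hp, pow_add,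
    mul_mul_mul_comm]
  exact mul_le_mul' (hf _) (hg _)

theorem GaussLE.C {x : L} (hx : v x ≤ c) : GaussLE v ρ (C x) c := by
  intro k
  rw [coeff_C]
  split_ifs with h
  · simpa [h] using hx
  · simp

theorem GaussLE.X (hρ : ρ ≤ c) : GaussLE v ρ (X : L[X]) c := by
  intro k
  rw [coeff_X]
  split_ifs with h
  · simpa [← h] using hρ
  · simp

theorem GaussLE.pow (hf : GaussLE v ρ f c) (n : ℕ) : GaussLE v ρ (f ^ n) (c ^ n) := by
  induction n with
  | zero => rw [pow_zero, pow_zero, ← C_1]; exact GaussLE.C (by simp)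
  | succ n ih => rw [pow_succ, pow_succ]; exact ih.mul hf

theorem GaussLE.comp (hf : GaussLE v ρ' f c) (hg : GaussLE v ρ g ρ') :
    GaussLE v ρ (f.comp g) c := by
  rw [Polynomial.comp, eval₂_eq_sum, Polynomial.sum]
  refine GaussLE.sum fun k _ => ?_
  exact ((GaussLE.C le_rfl).mul (hg.pow k)).mono (hf k)

variable {F : Type*} [Field F] [Fintype F] {d : ℕ} [Algebra F L] (a : Fin (d + 1) → L)

theorem GaussLE.tPoly (hρ : ρ ≤ 1) : GaussLE v ρ (tPoly F a) (coeffMax v a * ρ) := by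
  refine GaussLE.sum fun i _ => ?_
  refine ((GaussLE.C (le_coeffMax v a i)).mul ((GaussLE.X le_rfl).pow _)).mono ?_
  exact mul_le_mul_right (pow_le_of_le_one zero_le hρ
    (pow_pos (zero_lt_one.trans one_lt_card_q) _).ne') _

end GaussBound

/-! ### The basis of polynomials adapted to Φ -/

section AdaptedBasis

set_option linter.unusedSectionVars false

variable {F : Type*} [Field F] [Fintype F] {d : ℕ}
variable {L : Type*} [Field L] [Algebra F L] (v : Valuation L ℝ≥0) (a : Fin (d + 1) → L)

variable (F) in
/-- The polynomials `∏_j Φ(T^j)(X) ^ (n_j)`, where the `n_j` with `j < s` are the first `s`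
digits of `n` to the base `q ^ d`. -/
def basisPoly : ℕ → ℕ → L[X]
  | 0, _ => 1
  | s + 1, n => X ^ (n % q F ^ d) * (basisPoly s (n / q F ^ d)).comp (tPoly F a)

/-- Φ(T^j)(X) has degree (q^d)^j, so the s digits of n < (q^d)^s reassemble n. The change from
monomials is thus triangular, with powers of a_d on the diagonal. -/
theorem natDegree_basisPoly_and_leadingCoeff (ha : a (Fin.last d) ≠ 0) (s n : ℕ)
    (hn : n < (q F ^ d) ^ s) : (basisPoly F a s n).natDegree = n ∧
      ∃ e : ℕ, (basisPoly F a s n).leadingCoeff = a (Fin.last d) ^ e := by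
  have hB : 0 < q F ^ d := pow_pos (zero_lt_one.trans one_lt_card_q) _
  obtain ⟨hP1, hP2⟩ := natDegree_tPoly_and_leadingCoeff (F := F) a ha
  induction s generalizing n with
  | zero => exact ⟨by rw [basisPoly, natDegree_one]; rw [pow_zero] at hn; omega, 0, by simp [basisPoly]⟩
  | succ s ih =>
    obtain ⟨h1, e, h2⟩ := ih (n / q F ^ d) (Nat.div_lt_of_lt_mul (by rwa [← pow_succ']))
    have h3 : (basisPoly F a s (n / q F ^ d)).comp (tPoly F a) ≠ 0 := by
      rw [← leadingCoeff_ne_zero, leadingCoeff_comp (by rw [hP1]; exact hB.ne'), h2, hP2]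
      exact mul_ne_zero (pow_ne_zero _ ha) (pow_ne_zero _ ha)
    refine ⟨?_, e + n / q F ^ d, ?_⟩
    · rw [basisPoly, natDegree_mul (pow_ne_zero _ X_ne_zero) h3, natDegree_X_pow, natDegree_comp,
        h1, hP1, mul_comm]
      exact Nat.mod_add_div _ _
    · rw [basisPoly, leadingCoeff_mul, leadingCoeff_comp (by rw [hP1]; exact hB.ne'), h2, hP2, h1,
        leadingCoeff_X_pow, one_mul, pow_add]

/-- With A = `coeffMax v a`, the radii A^{-s} fit the recursion: Φ(T)(X) has Gauss norm at most
A^{-s} for the radius A^{-(s+1)}. By additivity, recentring at z recentres the inner polynomial at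
Φ(T)(z). Each digit is at most q^d - 1, whence the exponent. -/
theorem gaussLE_taylor_basisPoly (s n : ℕ) (z : L) :
    GaussLE v ((coeffMax v a)⁻¹ ^ s) (taylor z (basisPoly F a s n))
      (∏ j ∈ Finset.range s, max 1 (v (act (F := F) a (X ^ j) z)) ^ (q F ^ d - 1)) := by
  have hB : 0 < q F ^ d := pow_pos (zero_lt_one.trans one_lt_card_q) _
  have hA := one_le_coeffMax v a
  induction s generalizing n z with
  | zero =>
    rw [basisPoly, taylor_one]
    exact GaussLE.C (by simp)
  | succ s ih =>
    have hρ : (coeffMax v a)⁻¹ ^ (s + 1) ≤ 1 := pow_le_one₀ zero_le (inv_le_one_of_one_le₀ hA)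
    rw [basisPoly, taylor_mul, taylor_pow, taylor_X, Finset.prod_range_succ', mul_comm]
    have hcomp : taylor z ((basisPoly F a s (n / q F ^ d)).comp (tPoly F a)) =
        (taylor (tOp (F := F) a z) (basisPoly F a s (n / q F ^ d))).comp (tPoly F a) := by
      rw [taylor_apply, comp_assoc, ← taylor_apply, taylor_tPoly, taylor_apply, comp_assoc]
      simp
    rw [hcomp]
    refine GaussLE.mul ?_ ?_
    · have h := ih (n / q F ^ d) (tOp (F := F) a z)
      have e : ∀ j, act (F := F) a (X ^ j) (tOp (F := F) a z) = act (F := F) a (X ^ (j + 1)) z := by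
        intro j
        rw [← act_X, ← act_mul_apply, pow_succ]
      simp_rw [e] at h
      refine h.comp ((GaussLE.tPoly a hρ).mono (le_of_eq ?_))
      rw [pow_succ, mul_left_comm, mul_inv_cancel₀ (zero_lt_one.trans_le hA).ne', mul_one]
    · rw [pow_zero, map_one, Module.End.one_apply]
      have h1 : GaussLE v ((coeffMax v a)⁻¹ ^ (s + 1)) (X + C z) (max 1 (v z)) :=
        (GaussLE.X (hρ.trans (le_max_left _ _))).add (GaussLE.C (le_max_right _ _))
      refine (h1.pow (n % q F ^ d)).mono (pow_le_pow_right₀ (le_max_left _ _) ?_)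
      have := Nat.mod_lt n hB
      omega

/-- Reading the k-th Taylor coefficient off the Gauss bound for the radius A^{-s} costs A^{sk}: this
is the price of multiplicity. -/
theorem val_coeff_taylor_basisPoly_le (s n k : ℕ) (z : L) :
    v ((taylor z (basisPoly F a s n)).coeff k) ≤ coeffMax v a ^ (s * k) *
      ∏ j ∈ Finset.range s, max 1 (v (act (F := F) a (X ^ j) z)) ^ (q F ^ d - 1) := by
  have h := gaussLE_taylor_basisPoly (F := F) v a s n z k
  have hA : 0 < coeffMax v a := zero_lt_one.trans_le (one_le_coeffMax v a)
  rw [← pow_mul, inv_pow, ← div_eq_mul_inv, div_le_iff₀ (pow_pos hA _)] at h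
  rwa [mul_comm]

end AdaptedBasis

/-! ### The confluent Vandermonde determinant -/

section ConfluentVandermonde

set_option linter.unusedSectionVars false

variable {L : Type*} [Field L] {M : ℕ} (u : Fin M → L)

open scoped Classical in
/-- The number of indices `c < b` with `u c = u i`. -/
def countBefore (i b : Fin M) : ℕ := ((Finset.Iio b).filter fun c => u c = u i).card

/-- The Newton polynomials. -/
def newtonPoly (b : Fin M) : L[X] := ∏ c ∈ Finset.Iio b, (X - C (u c))

theorem newtonPoly_monic (b : Fin M) : (newtonPoly u b).Monic :=
  monic_prod_of_monic _ _ fun _ _ => monic_X_sub_C _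

theorem natDegree_newtonPoly (b : Fin M) : (newtonPoly u b).natDegree = b := by
  rw [newtonPoly, natDegree_prod_of_monic _ _ fun _ _ => monic_X_sub_C _]
  simp

open scoped Classical in
theorem taylor_newtonPoly (i b : Fin M) : taylor (u i) (newtonPoly u b) =
    X ^ countBefore u i b * ∏ c ∈ (Finset.Iio b).filter (fun c => u c ≠ u i), (X + C (u i - u c)) := by
  have h : ∀ c, (X - C (u c)).comp (X + C (u i)) = X + C (u i - u c) := by
    intro c; rw [sub_comp, X_comp, C_comp, C_sub]; ring
  rw [taylor_apply, newtonPoly, prod_comp, Finset.prod_congr rfl fun c _ => h c,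
    ← Finset.prod_filter_mul_prod_filter_not (Finset.Iio b) (fun c => u c = u i)]
  congr 1
  rw [countBefore, ← Finset.prod_const]
  refine Finset.prod_congr rfl fun c hc => ?_
  rw [(Finset.mem_filter.1 hc).2]
  simp

/-- The Newton polynomial of index b vanishes at u i to an order exceeding the order used in row i,
since i itself is one more index before b with that value. -/
theorem coeff_taylor_newtonPoly_of_lt {i b : Fin M} (h : i < b) :
    (taylor (u i) (newtonPoly u b)).coeff (countBefore u i i) = 0 := by
  classical
  rw [taylor_newtonPoly, coeff_X_pow_mul', if_neg]
  rw [not_le]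
  refine Finset.card_lt_card (Finset.ssubset_iff_of_subset (fun c hc => ?_) |>.2 ⟨i, ?_, ?_⟩)
  · simp only [Finset.mem_filter, Finset.mem_Iio] at hc ⊢
    exact ⟨hc.1.trans h, hc.2⟩
  · simpa using h
  · simp

open scoped Classical in
theorem coeff_taylor_newtonPoly_self (i : Fin M) :
    (taylor (u i) (newtonPoly u i)).coeff (countBefore u i i) =
      ∏ c ∈ (Finset.Iio i).filter (fun c => u c ≠ u i), (u i - u c) := by
  rw [taylor_newtonPoly, coeff_X_pow_mul', if_pos le_rfl, Nat.sub_self, coeff_zero_prod]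
  simp

theorem coeff_taylor_eq_sum (z : L) (k : ℕ) {f : L[X]} (hf : f.natDegree < M) :
    (taylor z f).coeff k = ∑ i : Fin M, (taylor z (X ^ (i : ℕ))).coeff k * f.coeff i := by
  conv_lhs => rw [as_sum_range' f M hf, map_sum, finsetSum_coeff]
  rw [Finset.sum_range]
  refine Finset.sum_congr rfl fun i _ => ?_
  rw [← C_mul_X_pow_eq_monomial, taylor_mul, taylor_C, coeff_C_mul, mul_comm]

open scoped Classical in
/-- The confluent Vandermonde determinant. -/
theorem det_confluent (f : Fin M → L[X]) (hf : ∀ n, (f n).natDegree ≤ n) :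
    (Matrix.of fun i n => (taylor (u i) (f n)).coeff (countBefore u i i)).det =
      (∏ n, (f n).coeff n) *
        ∏ i, ∏ c ∈ (Finset.Iio i).filter (fun c => u c ≠ u i), (u i - u c) := by
  let H : Matrix (Fin M) (Fin M) L :=
    Matrix.of fun i j => (taylor (u i) (X ^ (j : ℕ))).coeff (countBefore u i i)
  -- The polynomials enter only through their coefficients in degree n, the coefficient matrix being
  -- upper triangular. The common factor `H.det` is then computed with Newton polynomials, for which
  -- the evaluation matrix is lower triangular.
  have key : ∀ g : Fin M → L[X], (∀ n, (g n).natDegree ≤ n) →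
      (Matrix.of fun i n => (taylor (u i) (g n)).coeff (countBefore u i i)).det =
        H.det * ∏ n, (g n).coeff n := by
    intro g hg
    have h1 : (Matrix.of fun i n => (taylor (u i) (g n)).coeff (countBefore u i i)) =
        H * (Matrix.of fun j n : Fin M => (g n).coeff j) := by
      ext i n
      rw [Matrix.mul_apply]
      exact coeff_taylor_eq_sum (u i) _ ((hg n).trans_lt n.2)
    rw [h1, Matrix.det_mul, Matrix.det_of_isUpperTriangular
      (M := Matrix.of fun j n : Fin M => (g n).coeff j)]
    · rfl
    · intro j n hnj
      exact coeff_eq_zero_of_natDegree_lt ((hg n).trans_lt hnj)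
  have hN := key (newtonPoly u) fun n => (natDegree_newtonPoly u n).le
  have h1 : ∀ n : Fin M, (newtonPoly u n).coeff n = 1 := fun n => by
    have := newtonPoly_monic u n
    rwa [Monic, leadingCoeff, natDegree_newtonPoly] at this
  rw [Finset.prod_congr rfl fun n _ => h1 n, Finset.prod_const_one, mul_one,
    Matrix.det_of_isLowerTriangular] at hN
  · rw [key f hf, ← hN, mul_comm]
    congr 1
    exact Finset.prod_congr rfl fun i _ => coeff_taylor_newtonPoly_self u i
  · intro i b hib
    exact coeff_taylor_newtonPoly_of_lt u hib

end ConfluentVandermonde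

/-! ### Frobenius at places of inertia degree one -/

section ResidueDegreeOne

set_option linter.unusedSectionVars false

variable {F : Type*} [Field F] [Fintype F]

theorem MonicPrime.dvd_pow_sub (l : MonicPrime F) (f : F[X]) :
    l.1 ∣ f ^ (q F ^ l.1.natDegree) - f := by
  have : Fact (Irreducible l.1) := ⟨l.2.2⟩
  have hfin : Module.Finite F (AdjoinRoot l.1) := l.2.1.finite_adjoinRoot
  have : Finite (AdjoinRoot l.1) := Module.finite_of_finite F
  let : Fintype (AdjoinRoot l.1) := Fintype.ofFinite _
  have hcard : Fintype.card (AdjoinRoot l.1) = q F ^ l.1.natDegree := by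
    rw [Module.card_eq_pow_finrank (K := F), (AdjoinRoot.powerBasis l.2.2.ne_zero).finrank]
    rfl
  have h := FiniteField.pow_card (AdjoinRoot.mk l.1 f)
  rw [hcard] at h
  rw [← AdjoinRoot.mk_eq_zero, map_sub, map_pow, h, sub_self]

theorem BasePlace.val_pow_sub_lt_one (l : MonicPrime F) {z : RatFunc F}
    (hz : BasePlace.val (some l) z ≤ 1) :
    BasePlace.val (some l) (z ^ (q F ^ l.1.natDegree) - z) < 1 := by
  set v : Valuation (RatFunc F) ℝ≥0 := BasePlace.val (some l) with hv
  set Q := q F ^ l.1.natDegree with hQ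
  set f := z.num
  set g := z.denom
  have hg0 : algebraMap F[X] (RatFunc F) g ≠ 0 := by simpa using z.denom_ne_zero
  have hzfg : z * algebraMap F[X] (RatFunc F) g = algebraMap F[X] (RatFunc F) f := by
    have := RatFunc.num_div_denom z
    rw [div_eq_iff hg0] at this
    exact this.symm
  have hg1 : v (algebraMap F[X] (RatFunc F) g) = 1 := by
    refine le_antisymm (val_some_le_one l _) (not_lt.1 fun h => ?_)
    have h1 : v (algebraMap F[X] (RatFunc F) f) < 1 := by
      rw [← hzfg, map_mul]
      exact (mul_le_of_le_one_left' hz).trans_lt h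
    have h2 := RatFunc.isCoprime_num_denom z
    exact l.2.2.not_isUnit (h2.isUnit_of_dvd' ((val_some_lt_one_iff l _).1 h1)
      ((val_some_lt_one_iff l _).1 h))
  have hnum : v (algebraMap F[X] (RatFunc F) (f ^ Q * g - f * g ^ Q)) < 1 := by
    rw [hv, val_some_lt_one_iff]
    have : f ^ Q * g - f * g ^ Q = (f ^ Q - f) * g - f * (g ^ Q - g) := by ring
    rw [this]
    exact dvd_sub ((l.dvd_pow_sub f).mul_right _) ((l.dvd_pow_sub g).mul_left _)
  have he : (z ^ Q - z) * algebraMap F[X] (RatFunc F) g ^ (Q + 1) =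
      algebraMap F[X] (RatFunc F) (f ^ Q * g - f * g ^ Q) := by
    rw [map_sub, map_mul, map_mul, map_pow, map_pow, ← hzfg]
    ring
  have := congrArg v he
  rw [map_mul, map_pow, hg1, one_pow, mul_one] at this
  rwa [this]

variable {E : Type*} [Field E] [Algebra F E] [Algebra (RatFunc F) E] [FiniteDimensional (RatFunc F) E]
  (w : Place F E)

theorem Place.exists_sub_algebraMap_val_lt_one (hw : w.inertiaDegree = 1) {y : E}
    (hy : w.val y ≤ 1) : ∃ z : RatFunc F, w.base.val z ≤ 1 ∧
      w.val (y - algebraMap (RatFunc F) E z) < 1 := by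
  have h := (finrank_eq_one_iff_of_nonzero' (1 : IsLocalRing.ResidueField w.val.valuationSubring)
    one_ne_zero).1 hw (IsLocalRing.residue _ ⟨y, hy⟩)
  obtain ⟨c, hc⟩ := h
  obtain ⟨z, rfl⟩ := IsLocalRing.residue_surjective c
  refine ⟨z, z.2, ?_⟩
  rw [Algebra.smul_def, mul_one] at hc
  have hc' : IsLocalRing.residue w.val.valuationSubring
      (algebraMap w.base.val.valuationSubring w.val.valuationSubring z) =
        IsLocalRing.residue _ ⟨y, hy⟩ := hc
  rw [← sub_eq_zero, ← map_sub, IsLocalRing.residue_eq_zero_iff] at hc'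
  have h2 := (w.mem_maximalIdeal _).1 hc'
  rw [Valuation.map_sub_swap]
  exact h2

/-- Inertia degree one makes y congruent to an element of `k`, whose residue lies in the field
F[T]/(l) of q^{deg l} elements. -/
theorem Place.val_pow_sub_lt_one (l : MonicPrime F) (hb : w.base = some l)
    (hw : w.inertiaDegree = 1) {y : E} (hy : w.val y ≤ 1) :
    w.val (y ^ (q F ^ l.1.natDegree) - y) < 1 := by
  obtain ⟨z, hz, hyz⟩ := w.exists_sub_algebraMap_val_lt_one hw hy
  set Q := q F ^ l.1.natDegree with hQ
  set z' := algebraMap (RatFunc F) E z with hz'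
  have h1 : w.val (z' ^ Q - z') < 1 := by
    rw [hz', ← map_pow, ← map_sub, w.val_algebraMap, hb]
    rw [hb] at hz
    exact BasePlace.val_pow_sub_lt_one l hz
  have h2 : w.val ((y - z') ^ Q) < 1 := by
    rw [map_pow]
    exact pow_lt_one₀ zero_le hyz (q_pow_pos _).ne'
  have h3 : y ^ Q = (y - z') ^ Q + z' ^ Q := by
    rw [← add_pow_q_pow (F := F), sub_add_cancel]
  have h4 : y ^ Q - y = ((y - z') ^ Q - (y - z')) + (z' ^ Q - z') := by rw [h3]; ring
  rw [h4]
  exact w.val.map_add_lt (w.val.map_sub_lt h2 hyz) h1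

theorem Place.val_pow_pow_sub_lt_one (l : MonicPrime F) (hb : w.base = some l)
    (hw : w.inertiaDegree = 1) {y : E} (hy : w.val y ≤ 1) (n : ℕ) :
    w.val (y ^ (q F ^ (n * l.1.natDegree)) - y) < 1 := by
  induction n with
  | zero => simp
  | succ n ih =>
    have h1 := w.val_pow_sub_lt_one l hb hw (y := y ^ (q F ^ (n * l.1.natDegree)))
      (by rw [map_pow]; exact pow_le_one₀ zero_le hy)
    rw [← pow_mul, ← pow_add, ← Nat.succ_mul] at h1
    have h2 := w.val.map_add_lt h1 ih
    rwa [sub_add_sub_cancel] at h2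

theorem Place.localDegree_le : w.localDegree ≤ Module.finrank (RatFunc F) E := by
  obtain ⟨s, hs, hsum⟩ := exists_finset_base_eq (L := E) w.base
  rw [← hsum]
  exact Finset.single_le_sum (f := fun W : Place F E => W.localDegree) (fun _ _ => Nat.zero_le _)
    ((hs w).2 rfl)

/-- An absolute value `< 1` at a place of inertia degree one is bounded away from `1`. -/
theorem Place.exists_val_le (l : MonicPrime F) (hb : w.base = some l) (hw : w.inertiaDegree = 1) :
    ∃ θ : ℝ≥0, 0 < θ ∧ θ < 1 ∧ (∀ y, w.val y < 1 → w.val y ≤ θ) ∧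
      Real.logb (q F) θ ≤ - (l.1.natDegree / Module.finrank (RatFunc F) E) := by
  obtain ⟨C, hC, hCe, h⟩ := w.exists_val_eq
  rw [← w.ramificationIndex_eq, hb] at hCe
  have he : w.ramificationIndex ≤ Module.finrank (RatFunc F) E := by
    have := w.localDegree_le
    rwa [localDegree, hw, mul_one] at this
  have hC0 : 0 < C := zero_lt_one.trans hC
  -- C⁻¹ is the absolute value of a uniformizer. Since C^e = q^{deg l} and e ≤ [E : k], its
  -- logarithm is at most -deg l / [E : k].
  refine ⟨C⁻¹, inv_pos.2 hC0, inv_lt_one_of_one_lt₀ hC, fun y hy => ?_, ?_⟩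
  · rcases eq_or_ne y 0 with rfl | hy0
    · simp
    rw [h y hy0] at hy ⊢
    have hlt : WithZero.log (w.spec.valuation E y) < 0 := by
      by_contra hcon
      exact hy.not_ge (one_le_zpow₀ hC.le (not_lt.1 hcon))
    rw [← zpow_neg_one]
    exact zpow_le_zpow_right₀ hC.le (by omega)
  · have h1 := congrArg (fun x : ℝ≥0 => Real.logb (q F) x) hCe
    simp only [NNReal.coe_pow, NNReal.coe_natCast, Real.logb_pow] at h1
    rw [Real.logb_self_eq_one one_lt_q_real, mul_one] at h1
    change _ = ((l.1.natDegree : ℕ) : ℝ) at h1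
    have hlogC : 0 ≤ Real.logb (q F) C :=
      Real.logb_nonneg one_lt_q_real (by exact_mod_cast hC.le)
    have hc : (0 : ℝ) < Module.finrank (RatFunc F) E := by exact_mod_cast Module.finrank_pos
    rw [NNReal.coe_inv, Real.logb_inv, neg_le_neg_iff, div_le_iff₀ hc, ← h1, mul_comm]
    have : (w.ramificationIndex : ℝ) ≤ Module.finrank (RatFunc F) E := by exact_mod_cast he
    gcongr

end ResidueDegreeOne

/-! ### Ultrametric determinants, and the Frobenius congruence at roots of a polynomial -/

section DetBound

theorem val_det_le {L : Type*} [Field L] (v : Valuation L ℝ≥0) {ι : Type*} [Fintype ι]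
    [DecidableEq ι] (V : Matrix ι ι L) (c : ι → ℝ≥0) (h : ∀ i n, v (V i n) ≤ c i) :
    v V.det ≤ ∏ i, c i := by
  rw [Matrix.det_apply]
  refine v.map_sum_le fun σ _ => ?_
  have h1 : v (Equiv.Perm.sign σ • ∏ i, V (σ i) i) = v (∏ i, V (σ i) i) := by
    rcases Int.units_eq_one_or (Equiv.Perm.sign σ) with h | h <;> rw [h] <;> simp
  rw [h1, map_prod, ← Equiv.prod_comp σ c]
  exact Finset.prod_le_prod' fun i _ => h _ _

end DetBound

section FrobeniusCongruence

set_option linter.unusedSectionVars false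

variable {K L : Type*} [Field K] [Field L] (φ : K →+* L) (v : Valuation L ℝ≥0)

theorem val_add_pow_sub_pow_le {m θ : ℝ≥0} (hθ : θ ≤ 1) {A ε : L} (hA : v A ≤ m)
    (hε : v ε ≤ θ * m) (i : ℕ) : v ((A + ε) ^ i - A ^ i) ≤ θ * m ^ i := by
  induction i with
  | zero => simp
  | succ i ih =>
    have e : (A + ε) ^ (i + 1) - A ^ (i + 1) = (A + ε) * ((A + ε) ^ i - A ^ i) + ε * A ^ i := by ring
    have hAε : v (A + ε) ≤ m :=
      (v.map_add _ _).trans (max_le hA (hε.trans (mul_le_of_le_one_left' hθ)))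
    rw [e]
    refine (v.map_add _ _).trans (max_le ?_ ?_)
    · rw [map_mul, pow_succ', mul_left_comm]
      exact mul_le_mul' hAε ih
    · rw [map_mul, map_pow, pow_succ', ← mul_assoc]
      exact mul_le_mul' hε (pow_le_pow_left' hA _)

theorem val_eval_map_le {R : K[X]} {x : L} {θ : ℝ≥0} {Q : ℕ} (hR : ∀ i, v (φ (R.coeff i)) ≤ θ)
    (hdeg : R.natDegree ≤ Q) : v ((R.map φ).eval x) ≤ θ * max 1 (v x) ^ Q := by
  rw [eval_map, eval₂_eq_sum, Polynomial.sum]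
  refine v.map_sum_le fun i hi => ?_
  rw [map_mul, map_pow]
  refine mul_le_mul' (hR i) ?_
  exact (pow_le_pow_left' (le_max_right 1 _) _).trans
    (pow_le_pow_right₀ (le_max_left _ _) ((le_natDegree_of_mem_supp i hi).trans hdeg))

variable {F : Type*} [Field F] [Fintype F] [Algebra F L]

variable {θ : ℝ≥0} {n : ℕ}

/-- Frobenius fixes the coefficients of G modulo the place, so G(x^Q) is close to G(x)^Q = 0, and
the small perturbation R(x) does little. As x need not be integral, the estimate carries powers of
max{1, |x|}. -/
theorem val_eval_frobenius_le (hθ1 : θ ≤ 1) (hθ : ∀ y, v (φ y) < 1 → v (φ y) ≤ θ)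
    (hfrob : ∀ y, v (φ y) ≤ 1 → v (φ (y ^ (q F ^ n) - y)) < 1)
    {G R : K[X]} (hG : ∀ i, v (φ (G.coeff i)) ≤ 1) (hR : ∀ i, v (φ (R.coeff i)) < 1)
    (hdeg : R.natDegree ≤ q F ^ n) {x : L} (hx : (G.map φ).eval x = 0) :
    v ((G.map φ).eval (x ^ (q F ^ n) + (R.map φ).eval x)) ≤
      θ * (max 1 (v x) ^ (q F ^ n)) ^ G.natDegree := by
  set Q := q F ^ n with hQ
  set m := max 1 (v x) with hm
  have hm1 : 1 ≤ m := le_max_left _ _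
  set ε := (R.map φ).eval x with hε
  have hεle : v ε ≤ θ * m ^ Q := val_eval_map_le φ v (fun i => hθ _ (hR i)) hdeg
  have hA : v (x ^ Q) ≤ m ^ Q := by rw [map_pow]; exact pow_le_pow_left' (le_max_right _ _) _
  have hzero : ∑ i ∈ G.support, φ (G.coeff i) ^ Q * (x ^ Q) ^ i = 0 := by
    have h1 := congrArg ((FiniteField.frobeniusAlgHom F L).toLinearMap ^ n) hx
    rw [eval_map, eval₂_eq_sum, Polynomial.sum, map_sum, map_zero] at h1
    simp_rw [frobenius_pow_apply, ← hQ, mul_pow, ← pow_mul, mul_comm _ Q, pow_mul] at h1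
    exact h1
  have hsum : (G.map φ).eval (x ^ Q + ε) = ∑ i ∈ G.support,
      (φ (G.coeff i) * ((x ^ Q + ε) ^ i - (x ^ Q) ^ i) -
        φ (G.coeff i ^ Q - G.coeff i) * (x ^ Q) ^ i) := by
    -- Subtracting G(x)^Q = 0 termwise separates the effect of the perturbation from the failure of
    -- the coefficients to be fixed by Frobenius.
    rw [← sub_zero (eval _ _), ← hzero, eval_map, eval₂_eq_sum, Polynomial.sum,
      ← Finset.sum_sub_distrib]
    refine Finset.sum_congr rfl fun i _ => ?_
    rw [map_sub, map_pow]
    ring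
  rw [hsum]
  refine v.map_sum_le fun i hi => ?_
  have hpow : (m ^ Q) ^ i ≤ (m ^ Q) ^ G.natDegree :=
    pow_le_pow_right₀ (one_le_pow₀ hm1) (le_natDegree_of_mem_supp i hi)
  refine (v.map_sub _ _).trans (max_le ?_ ?_)
  · rw [map_mul]
    refine (mul_le_of_le_one_left' (hG i)).trans ?_
    exact (val_add_pow_sub_pow_le v hθ1 hA hεle i).trans (mul_le_mul_right hpow _)
  · rw [map_mul, map_pow]
    exact mul_le_mul' (hθ _ (hfrob _ (hG i))) ((pow_le_pow_left' hA _).trans hpow)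

/-- The values `P(Φ(l) x)` at the roots `x` of `P` are small at the places above `l`. -/
theorem val_prod_frobenius_sub_le (hθ1 : θ ≤ 1) (hθ : ∀ y, v (φ y) < 1 → v (φ y) ≤ θ)
    (hfrob : ∀ y, v (φ y) ≤ 1 → v (φ (y ^ (q F ^ n) - y)) < 1)
    {P R : K[X]} (hP : P.Monic) (hR : ∀ i, v (φ (R.coeff i)) < 1)
    (hdeg : R.natDegree ≤ q F ^ n) {D : ℕ} {x : Fin D → L} (hPx : P.map φ = ∏ i, (X - C (x i)))
    (j : Fin D) :
    ∏ i, v (x j ^ (q F ^ n) + (R.map φ).eval (x j) - x i) ≤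
      θ * ((∏ i, max 1 (v (x i))) * (max 1 (v (x j)) ^ (q F ^ n)) ^ D) := by
  have hPD : P.natDegree = D := by
    rw [← natDegree_map φ, hPx, natDegree_prod_of_monic _ _ fun _ _ => monic_X_sub_C _]
    simp
  -- P need not be integral, so it is divided by its largest coefficient μ; |μ| is bounded by the
  -- Gauss norm of ∏ (X - x_i).
  obtain ⟨i₀, hi₀, hmax⟩ := Finset.exists_max_image P.support (fun i => v (φ (P.coeff i)))
    (support_nonempty.2 hP.ne_zero)
  set μ := P.coeff i₀ with hμ
  have hμ0 : μ ≠ 0 := mem_support_iff.1 hi₀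
  have hφμ0 : v (φ μ) ≠ 0 := (Valuation.ne_zero_iff _).2 ((map_ne_zero φ).2 hμ0)
  have hμle : v (φ μ) ≤ ∏ i, max 1 (v (x i)) := by
    have hg : GaussLE v 1 (P.map φ) (∏ i, max 1 (v (x i))) := by
      rw [hPx]
      have : ∀ s : Finset (Fin D), GaussLE v 1 (∏ i ∈ s, (X - C (x i))) (∏ i ∈ s, max 1 (v (x i))) := by
        intro s
        classical
        induction s using Finset.induction_on with
        | empty => rw [Finset.prod_empty, Finset.prod_empty, ← C_1]; exact GaussLE.C (by simp)
        | insert i s hi ih =>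
          rw [Finset.prod_insert hi, Finset.prod_insert hi, sub_eq_add_neg, ← C_neg]
          exact GaussLE.mul ((GaussLE.X (le_max_left _ _)).add
            (GaussLE.C (by rw [Valuation.map_neg]; exact le_max_right _ _))) ih
      exact this _
    have := hg i₀
    rwa [coeff_map, one_pow, mul_one] at this
  have hG : ∀ i, v (φ ((C μ⁻¹ * P).coeff i)) ≤ 1 := by
    intro i
    rw [coeff_C_mul, map_mul, map_mul, map_inv₀, map_inv₀]
    by_cases hi : i ∈ P.support
    · exact (mul_le_mul_right (hmax i hi) _).trans (inv_mul_cancel₀ hφμ0).le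
    · rw [notMem_support_iff.1 hi]; simp
  have hroot : ((C μ⁻¹ * P).map φ).eval (x j) = 0 := by
    rw [Polynomial.map_mul, eval_mul, hPx, eval_prod, Finset.prod_eq_zero (Finset.mem_univ j),
      mul_zero]
    simp
  have h := val_eval_frobenius_le φ v hθ1 hθ hfrob hG hR hdeg hroot
  rw [natDegree_C_mul (inv_ne_zero hμ0), hPD, Polynomial.map_mul, eval_mul, hPx, eval_prod,
    map_mul, map_C, eval_C, map_inv₀, map_inv₀, map_prod] at h
  simp only [eval_sub, eval_X, eval_C] at h
  rw [inv_mul_le_iff₀ (zero_lt_iff.2 hφμ0)] at h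
  refine h.trans ?_
  rw [mul_left_comm]
  gcongr

end FrobeniusCongruence

/-! ### Consequences of RV: unit leading coefficient and growth of the action -/

section GoodReduction

set_option linter.unusedSectionVars false

variable {F : Type*} [Field F] [Fintype F] {d : ℕ}
variable {L : Type*} [Field L] [Algebra F L] (v : Valuation L ℝ≥0) (a : Fin (d + 1) → L)

theorem eval_actionPoly (f : F[X]) (z : L) : (actionPoly a f).eval z = act a f z := by
  have hn : ∀ n : ℕ, ((tPoly F a).comp^[n] X).eval z = act (F := F) a (X ^ n) z := by
    intro n
    induction n with
    | zero => simp
    | succ n ih => rw [Function.iterate_succ_apply', eval_comp, ih, eval_tPoly, act_X_pow_succ]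
  rw [act_apply_eq_sum, actionPoly, Polynomial.sum, Polynomial.sum, eval_finsetSum]
  refine Finset.sum_congr rfl fun n _ => ?_
  rw [eval_mul, eval_C, hn]

theorem natDegree_iterate_tPoly (ha : a (Fin.last d) ≠ 0) (n : ℕ) :
    ((tPoly F a).comp^[n] X).natDegree = (q F ^ d) ^ n ∧
      ∃ e : ℕ, n ≤ e ∧ ((tPoly F a).comp^[n] X).leadingCoeff = a (Fin.last d) ^ e := by
  obtain ⟨h1, h2⟩ := natDegree_tPoly_and_leadingCoeff (F := F) a ha
  induction n with
  | zero => exact ⟨by simp, 0, le_rfl, by simp⟩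
  | succ n ih =>
    obtain ⟨h3, e, hne, h4⟩ := ih
    rw [Function.iterate_succ_apply']
    refine ⟨by rw [natDegree_comp, h1, h3, pow_succ'], 1 + e * q F ^ d, ?_, ?_⟩
    · have := Nat.le_mul_of_pos_right e (q_pow_pos (F := F) d)
      omega
    rw [leadingCoeff_comp (by rw [h3]; exact (pow_pos (q_pow_pos _) _).ne'), h1, h2, h4,
      pow_add, pow_one, pow_mul]

theorem natDegree_actionPoly_le (ha : a (Fin.last d) ≠ 0) (f : F[X]) :
    (actionPoly a f).natDegree ≤ (q F ^ d) ^ f.natDegree := by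
  rw [actionPoly, Polynomial.sum]
  refine natDegree_sum_le_of_forall_le _ _ fun n hn => ?_
  refine (natDegree_C_mul_le _ _).trans ?_
  rw [(natDegree_iterate_tPoly a ha n).1]
  exact Nat.pow_le_pow_right (q_pow_pos _) (le_natDegree_of_mem_supp n hn)

theorem exists_coeff_actionPoly_eq (hd : 0 < d) (ha : a (Fin.last d) ≠ 0) {f : F[X]}
    (hf : f.Monic) : ∃ e : ℕ, f.natDegree ≤ e ∧
      (actionPoly a f).coeff ((q F ^ d) ^ f.natDegree) = a (Fin.last d) ^ e := by
  obtain ⟨h1, e, hne, h2⟩ := natDegree_iterate_tPoly (F := F) a ha f.natDegree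
  refine ⟨e, hne, ?_⟩
  have hB : 1 < q F ^ d := Nat.one_lt_pow hd.ne' one_lt_card_q
  rw [actionPoly, Polynomial.sum, finsetSum_coeff, Finset.sum_eq_single f.natDegree]
  · rw [coeff_C_mul, coeff_natDegree, hf, map_one, one_mul, ← h2, leadingCoeff, h1]
  · intro n hn hne
    rw [coeff_C_mul, coeff_eq_zero_of_natDegree_lt (p := _^[n] X), mul_zero]
    rw [(natDegree_iterate_tPoly a ha n).1]
    exact Nat.pow_lt_pow_right hB (lt_of_le_of_ne (le_natDegree_of_mem_supp n hn) hne)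
  · intro h
    rw [notMem_support_iff] at h
    simp [h]

/-- The coefficient of Φ(f)(X) in degree q^{d deg f} is a power of a_d with positive exponent, and
the congruence makes it ≡ 1; this excludes |a_d| < 1. -/
theorem val_coeff_last_eq_one (hd : 0 < d) (ha : a (Fin.last d) ≠ 0) {f : F[X]}
    (hf : f.Monic) (hf0 : 0 < f.natDegree) (hai : ∀ i, v (a i) ≤ 1)
    (hR : ∀ n, v ((actionPoly a f - X ^ (q F ^ (d * f.natDegree))).coeff n) < 1) :
    v (a (Fin.last d)) = 1 := by
  obtain ⟨e, hne, he⟩ := exists_coeff_actionPoly_eq a hd ha hf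
  refine le_antisymm (hai _) (not_lt.1 fun hlt => ?_)
  have h := hR (q F ^ (d * f.natDegree))
  rw [coeff_sub, coeff_X_pow_self, pow_mul, he] at h
  have h1 : v (a (Fin.last d) ^ e) < 1 := by
    rw [map_pow]; exact pow_lt_one₀ zero_le hlt (by omega)
  have h2 := v.map_sub_lt h1 h
  rw [sub_sub_cancel, map_one] at h2
  exact lt_irrefl _ h2

variable {v a}

theorem coeffMax_eq_one (hai : ∀ i, v (a i) ≤ 1) : coeffMax v a = 1 :=
  max_eq_left (Finset.sup_le fun i _ => hai i)

theorem max_one_pow_le_act_X_pow (hai : ∀ i, v (a i) ≤ 1) (had : v (a (Fin.last d)) = 1) (z : L)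
    (j : ℕ) : max 1 (v z) ^ ((q F ^ d) ^ j) ≤ max 1 (v (act (F := F) a (X ^ j) z)) := by
  have ha : a (Fin.last d) ≠ 0 := by
    rw [← Valuation.ne_zero_iff v, had]; exact one_ne_zero
  induction j with
  | zero => simp
  | succ j ih =>
    have h := pow_max_one_le (F := F) v a ha (act (F := F) a (X ^ j) z)
    rw [coeffMax_eq_one hai, map_inv₀, had, inv_one, max_self, mul_one, one_pow, mul_one,
      ← act_X_pow_succ] at h
    rw [pow_succ, pow_mul]
    exact (pow_le_pow_left' ih _).trans h

/-- A telescoping of (B - 1) ∑_{j<s} B^j = B^s - 1 with B = q^d. The Vandermonde product gives each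
point the exponent M - 1 ≤ B^s - 1, so its growth fits into the orbit products. -/
theorem max_one_pow_le_prod (hai : ∀ i, v (a i) ≤ 1) (had : v (a (Fin.last d)) = 1) (z : L)
    (s : ℕ) : max 1 (v z) ^ ((q F ^ d) ^ s - 1) ≤
      ∏ j ∈ Finset.range s, max 1 (v (act (F := F) a (X ^ j) z)) ^ (q F ^ d - 1) := by
  induction s with
  | zero => simp
  | succ s ih =>
    rw [Finset.prod_range_succ]
    have h : (q F ^ d) ^ (s + 1) - 1 = ((q F ^ d) ^ s - 1) + (q F ^ d) ^ s * (q F ^ d - 1) := by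
      have h1 : 1 ≤ (q F ^ d) ^ s := pow_pos (q_pow_pos _) _
      have h2 : 1 ≤ q F ^ d := q_pow_pos _
      obtain ⟨B, hB⟩ := Nat.exists_eq_add_of_le h2
      obtain ⟨C, hC⟩ := Nat.exists_eq_add_of_le h1
      rw [pow_succ, hC, hB]
      simp only [Nat.add_sub_cancel_left]
      have : (1 + C) * (1 + B) = 1 + (C + (1 + C) * B) := by ring
      omega
    rw [h, pow_add, pow_mul]
    exact mul_le_mul' ih (pow_le_pow_left' (max_one_pow_le_act_X_pow hai had z s) _)

theorem act_eq_pow_add (f : F[X]) (Q : ℕ) (z : L) :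
    act a f z = z ^ Q + (actionPoly a f - X ^ Q).eval z := by
  rw [eval_sub, eval_actionPoly, eval_pow, eval_X]
  ring

/-- For |z| > 1 the power z^Q dominates, as the remaining polynomial has degree at most Q and
coefficients of absolute value below 1. -/
theorem max_one_pow_le_act (ha : a (Fin.last d) ≠ 0) {f : F[X]}
    (hR : ∀ n, v ((actionPoly a f - X ^ (q F ^ (d * f.natDegree))).coeff n) < 1) (z : L) :
    max 1 (v z) ^ (q F ^ (d * f.natDegree)) ≤ max 1 (v (act a f z)) := by
  rcases le_or_gt (v z) 1 with hz | hz
  · rw [max_eq_left hz, one_pow]; exact le_max_left _ _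
  set R := actionPoly a f - X ^ (q F ^ (d * f.natDegree)) with hRdef
  have hdeg : R.natDegree ≤ q F ^ (d * f.natDegree) := by
    refine (natDegree_sub_le _ _).trans (max_le ?_ (natDegree_X_pow_le _))
    rw [pow_mul]
    exact natDegree_actionPoly_le a ha f
  have hRz : v (R.eval z) < v (z ^ (q F ^ (d * f.natDegree))) := by
    rw [eval_eq_sum, Polynomial.sum]
    refine v.map_sum_lt (by rw [map_pow]; exact pow_ne_zero _ (zero_lt_one.trans hz).ne')
      fun i hi => ?_
    rw [map_mul, map_pow, map_pow]
    calc v (R.coeff i) * v z ^ i < 1 * v z ^ i :=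
          mul_lt_mul_of_pos_right (hR i) (pow_pos (zero_lt_one.trans hz) _)
      _ ≤ v z ^ (q F ^ (d * f.natDegree)) := by
          rw [one_mul]
          exact pow_le_pow_right₀ hz.le ((le_natDegree_of_mem_supp i hi).trans hdeg)
  rw [max_eq_right hz.le, act_eq_pow_add f (q F ^ (d * f.natDegree)) z,
    v.map_add_eq_of_lt_left hRz, map_pow]
  exact le_max_right _ _

end GoodReduction

/-! ### Products of differences, and the sequence of interpolation points -/

section PairProducts

set_option linter.unusedSectionVars false

variable {L : Type*} [Field L] (v : Valuation L ℝ≥0) {M : ℕ}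

theorem prod_Iio_mul_eq (μ : Fin M → ℝ≥0) :
    ∏ i, ∏ c ∈ Finset.Iio i, (μ i * μ c) = ∏ i, μ i ^ (M - 1) := by
  simp_rw [Finset.prod_mul_distrib]
  have h : ∏ i, ∏ c ∈ Finset.Iio i, μ c = ∏ c, ∏ i ∈ Finset.Ioi c, μ c :=
    Finset.prod_comm' (by simp)
  rw [h, ← Finset.prod_mul_distrib]
  refine Finset.prod_congr rfl fun i _ => ?_
  rw [Finset.prod_const, Finset.prod_const, ← pow_add, Fin.card_Iio, Fin.card_Ioi]
  congr 1
  omega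

theorem val_sub_div_le_one (x y : L) : v (x - y) / (max 1 (v x) * max 1 (v y)) ≤ 1 := by
  have h1 : (1 : ℝ≥0) ≤ max 1 (v x) := le_max_left _ _
  have h2 : (1 : ℝ≥0) ≤ max 1 (v y) := le_max_left _ _
  refine div_le_one_of_le₀ ((v.map_sub _ _).trans (max_le ?_ ?_)) zero_le
  · exact (le_max_right 1 _).trans (le_mul_of_one_le_right' h2)
  · exact (le_max_right 1 _).trans (le_mul_of_one_le_left' h1)

-- Divided by max{1, |x|} max{1, |y|}, each difference is at most 1, so every pair outside T may be
-- dropped. Each point occurs in at most M - 1 pairs.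
open scoped Classical in
theorem prod_val_sub_le (u : Fin M → L) (T : Finset (Fin M × Fin M))
    (hT : ∀ p ∈ T, p.2 < p.1 ∧ u p.2 ≠ u p.1) :
    ∏ i, ∏ c ∈ (Finset.Iio i).filter (fun c => u c ≠ u i), v (u i - u c) ≤
      (∏ i, max 1 (v (u i)) ^ (M - 1)) *
        ∏ p ∈ T, v (u p.1 - u p.2) / (max 1 (v (u p.1)) * max 1 (v (u p.2))) := by
  set β : Fin M × Fin M → ℝ≥0 :=
    fun p => v (u p.1 - u p.2) / (max 1 (v (u p.1)) * max 1 (v (u p.2))) with hβ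
  set μ : Fin M → ℝ≥0 := fun i => max 1 (v (u i)) with hμ
  have hμ1 : ∀ i, 1 ≤ μ i := fun i => le_max_left _ _
  have hμ0 : ∀ i, μ i ≠ 0 := fun i => (zero_lt_one.trans_le (hμ1 i)).ne'
  have hvβ : ∀ i c, v (u i - u c) = (μ i * μ c) * β (i, c) := fun i c =>
    (mul_div_cancel₀ _ (mul_ne_zero (hμ0 i) (hμ0 c))).symm
  have h1 : ∏ i, ∏ c ∈ (Finset.Iio i).filter (fun c => u c ≠ u i), v (u i - u c) =
      (∏ i, ∏ c ∈ (Finset.Iio i).filter (fun c => u c ≠ u i), (μ i * μ c)) *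
        ∏ i, ∏ c ∈ (Finset.Iio i).filter (fun c => u c ≠ u i), β (i, c) := by
    simp_rw [hvβ, Finset.prod_mul_distrib]
  rw [h1, ← prod_Iio_mul_eq μ]
  refine mul_le_mul' ?_ ?_
  · refine Finset.prod_le_prod' fun i _ => ?_
    exact Finset.prod_le_prod_of_subset_of_one_le' (Finset.filter_subset _ _)
      fun c _ _ => one_le_mul (hμ1 i) (hμ1 c)
  · have h2 : ∏ i, ∏ c ∈ (Finset.Iio i).filter (fun c => u c ≠ u i), β (i, c) =
        ∏ p ∈ Finset.univ.filter (fun p : Fin M × Fin M => p.2 < p.1 ∧ u p.2 ≠ u p.1), β p := by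
      rw [Finset.prod_filter, Fintype.prod_prod_type]
      refine Finset.prod_congr rfl fun i _ => ?_
      rw [← Finset.prod_filter]
      refine Finset.prod_congr ?_ fun _ _ => rfl
      ext c
      simp
    rw [h2]
    refine Finset.prod_le_prod_of_subset_of_le_one' (fun p hp => ?_) fun p _ _ =>
      val_sub_div_le_one v _ _
    simpa using hT p hp

end PairProducts

section PointSequence

set_option linter.unusedSectionVars false

variable {L : Type*} {D m : ℕ} (x : Fin D → L) (y : Fin m × Fin D → L) (t : ℕ)

/-- The points `x i`, each taken `t` times, and the points `y p`. -/
def points : (Fin t × Fin D) ⊕ (Fin m × Fin D) → L := Sum.elim (fun p => x p.2) y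

/-- The numbering of the points. -/
def pointIndex (t m D : ℕ) : (Fin t × Fin D) ⊕ (Fin m × Fin D) ≃ Fin (t * D + m * D) :=
  (Equiv.sumCongr finProdFinEquiv finProdFinEquiv).trans finSumFinEquiv

/-- The points, as a sequence. -/
def pointSeq : Fin (t * D + m * D) → L := fun i => points x y t ((pointIndex t m D).symm i)

theorem pointSeq_pointIndex (p) : pointSeq x y t (pointIndex t m D p) = points x y t p := by
  rw [pointSeq, Equiv.symm_apply_apply]

/-- The numbering puts the x before the y, so that the pairs carrying the gain have the order
required in the Vandermonde product. -/
theorem pointIndex_inl_lt (p : Fin t × Fin D) (p' : Fin m × Fin D) :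
    pointIndex t m D (Sum.inl p) < pointIndex t m D (Sum.inr p') := by
  simp only [pointIndex, Equiv.trans_apply, Equiv.sumCongr_apply, Sum.map_inl, Sum.map_inr,
    finSumFinEquiv_apply_left, finSumFinEquiv_apply_right, Fin.lt_def, Fin.val_castAdd,
    Fin.val_natAdd]
  exact Nat.lt_of_lt_of_le (Fin.isLt _) (Nat.le_add_right _ _)

variable {x y} (hx : Function.Injective x) (hy : Function.Injective y) (hxy : ∀ p i, y p ≠ x i)
include hx hy hxy

theorem sum_countBefore_le :
    ∑ i, countBefore (pointSeq x y t) i i ≤ t * D * t := by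
  classical
  rw [← Equiv.sum_comp (pointIndex t m D), Fintype.sum_sum_type]
  have h1 : ∀ p : Fin t × Fin D, countBefore (pointSeq x y t) (pointIndex t m D (Sum.inl p))
      (pointIndex t m D (Sum.inl p)) ≤ t := by
    intro p
    rw [countBefore]
    refine (Finset.card_le_card (t := (Finset.univ : Finset (Fin t)).image
      fun τ => pointIndex t m D (Sum.inl (τ, p.2))) fun c hc => ?_).trans
      (Finset.card_image_le.trans (by simp))
    obtain ⟨q, rfl⟩ := (pointIndex t m D).surjective c
    have hq := (Finset.mem_filter.1 hc).2
    rw [pointSeq_pointIndex, pointSeq_pointIndex] at hq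
    rcases q with ⟨τ, i⟩ | q
    · have : i = p.2 := hx hq
      subst this
      exact Finset.mem_image.2 ⟨τ, Finset.mem_univ _, rfl⟩
    · exact absurd hq (hxy q p.2)
  have h2 : ∀ p : Fin m × Fin D, countBefore (pointSeq x y t) (pointIndex t m D (Sum.inr p))
      (pointIndex t m D (Sum.inr p)) = 0 := by
    intro p
    rw [countBefore, Finset.card_eq_zero, Finset.filter_eq_empty_iff]
    intro c hc hq
    obtain ⟨q, rfl⟩ := (pointIndex t m D).surjective c
    rw [pointSeq_pointIndex, pointSeq_pointIndex] at hq
    rcases q with ⟨τ, i⟩ | q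
    · exact hxy p i hq.symm
    · have : q = p := hy hq
      subst this
      exact lt_irrefl _ (Finset.mem_Iio.1 hc)
  simp_rw [h2]
  refine (Nat.add_le_add_right (Finset.sum_le_sum fun p _ => h1 p) _).trans ?_
  simp

variable {t}

-- T consists of the pairs of some y (l₀, j) with some copy τ of some x i. For each of the t · D
-- choices of (τ, j), the product over i of the normalised differences is at most θ.
open scoped Classical in
theorem prod_val_pointSeq_sub_le [Field L] (v : Valuation L ℝ≥0) {θ : ℝ≥0} (l₀ : Fin m)
    (hsmall : ∀ j, ∏ i, v (y (l₀, j) - x i) ≤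
      θ * ((∏ i, max 1 (v (x i))) * max 1 (v (y (l₀, j))) ^ D)) :
    ∏ i, ∏ c ∈ (Finset.Iio i).filter (fun c => pointSeq x y t c ≠ pointSeq x y t i),
      v (pointSeq x y t i - pointSeq x y t c) ≤
      (∏ p, max 1 (v (points x y t p)) ^ (t * D + m * D - 1)) * θ ^ (t * D) := by
  let T : Finset (Fin (t * D + m * D) × Fin (t * D + m * D)) :=
    (Finset.univ : Finset ((Fin t × Fin D) × Fin D)).image fun r =>
      (pointIndex t m D (Sum.inr (l₀, r.1.2)), pointIndex t m D (Sum.inl (r.1.1, r.2)))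
  have hinj : Function.Injective fun r : (Fin t × Fin D) × Fin D =>
      (pointIndex t m D (Sum.inr (l₀, r.1.2)), pointIndex t m D (Sum.inl (r.1.1, r.2))) := by
    rintro ⟨⟨τ, j⟩, i⟩ ⟨⟨τ', j'⟩, i'⟩ h
    simp only [Prod.mk.injEq, EmbeddingLike.apply_eq_iff_eq, Sum.inr.injEq, Sum.inl.injEq,
      true_and] at h
    obtain ⟨rfl, rfl, rfl⟩ := h
    rfl
  refine (prod_val_sub_le v (pointSeq x y t) T fun p hp => ?_).trans (mul_le_mul' ?_ ?_)
  · obtain ⟨r, -, rfl⟩ := Finset.mem_image.1 hp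
    refine ⟨pointIndex_inl_lt _ _ _, ?_⟩
    rw [pointSeq_pointIndex, pointSeq_pointIndex]
    exact (hxy _ _).symm
  · rw [← Equiv.prod_comp (pointIndex t m D)]
    simp_rw [pointSeq_pointIndex]
    exact le_rfl
  · rw [Finset.prod_image hinj.injOn]
    simp_rw [pointSeq_pointIndex]
    rw [Fintype.prod_prod_type]
    have hle : ∀ p : Fin t × Fin D, ∏ i : Fin D,
        v (points x y t (Sum.inr (l₀, p.2)) - points x y t (Sum.inl (p.1, i))) /
          (max 1 (v (points x y t (Sum.inr (l₀, p.2)))) *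
            max 1 (v (points x y t (Sum.inl (p.1, i))))) ≤ θ := by
      intro p
      simp only [points, Sum.elim_inl, Sum.elim_inr]
      rw [Finset.prod_div_distrib, Finset.prod_mul_distrib, Finset.prod_const, Finset.card_univ,
        Fintype.card_fin]
      refine div_le_of_le_mul₀ zero_le zero_le ((hsmall p.2).trans (le_of_eq ?_))
      rw [mul_comm (∏ i, _)]
    refine (Finset.prod_le_prod' fun p _ => hle p).trans (le_of_eq ?_)
    simp

end PointSequence

/-! ### The interpolation determinant -/

section InterpolationDeterminant

set_option linter.unusedSectionVars false

variable {F : Type*} [Field F] [Fintype F] {d : ℕ}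
variable {L : Type*} [Field L] [Algebra F L] (v : Valuation L ℝ≥0) (a : Fin (d + 1) → L)

/-- `∏_{j < s} max {1, |Φ(T^j)(z)|} ^ (q^d - 1)`. -/
def orbitProd (s : ℕ) (z : L) : ℝ≥0 :=
  ∏ j ∈ Finset.range s, max 1 (v (act (F := F) a (X ^ j) z)) ^ (q F ^ d - 1)

theorem one_le_orbitProd (s : ℕ) (z : L) : 1 ≤ orbitProd (F := F) v a s z :=
  Finset.one_le_prod' fun _ _ => one_le_pow₀ (le_max_left _ _)

variable {D m : ℕ} (x : Fin D → L) (y : Fin m × Fin D → L) (t s : ℕ)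

variable (F) in
/-- The interpolation determinant of the polynomials `basisPoly` at the points `x` with
multiplicity `t` and the points `y` with multiplicity one. -/
def interpDet : L :=
  (Matrix.of fun i n : Fin (t * D + m * D) => (taylor (pointSeq x y t i) (basisPoly F a s n)).coeff
    (countBefore (pointSeq x y t) i i)).det

section

open scoped Classical in
theorem interpDet_eq (ha : a (Fin.last d) ≠ 0) (hM : t * D + m * D ≤ (q F ^ d) ^ s) :
    ∃ e : ℕ, interpDet F a x y t s = a (Fin.last d) ^ e *
      ∏ i, ∏ c ∈ (Finset.Iio i).filter (fun c => pointSeq x y t c ≠ pointSeq x y t i),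
        (pointSeq x y t i - pointSeq x y t c) := by
  have h := fun n : Fin (t * D + m * D) =>
    natDegree_basisPoly_and_leadingCoeff (F := F) a ha s n (n.2.trans_le hM)
  choose e he using fun n => (h n).2
  refine ⟨∑ n, e n, ?_⟩
  rw [interpDet, det_confluent _ _ fun n => (h n).1.le, ← Finset.prod_pow_eq_pow_sum]
  congr 1
  refine Finset.prod_congr rfl fun n _ => ?_
  rw [← he n, leadingCoeff, (h n).1]

theorem interpDet_ne_zero (ha : a (Fin.last d) ≠ 0) (hM : t * D + m * D ≤ (q F ^ d) ^ s) :
    interpDet F a x y t s ≠ 0 := by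
  classical
  obtain ⟨e, he⟩ := interpDet_eq a x y t s ha hM
  rw [he]
  refine mul_ne_zero (pow_ne_zero _ ha) (Finset.prod_ne_zero_iff.2 fun i _ =>
    Finset.prod_ne_zero_iff.2 fun c hc => sub_ne_zero.2 ?_)
  exact ((Finset.mem_filter.1 hc).2).symm

variable {x y} (hx : Function.Injective x) (hy : Function.Injective y) (hxy : ∀ p i, y p ≠ x i)
include hx hy hxy

theorem val_interpDet_le :
    v (interpDet F a x y t s) ≤
      coeffMax v a ^ (s * (t * D * t)) * ∏ p, orbitProd (F := F) v a s (points x y t p) := by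
  refine (val_det_le v _ (fun i => coeffMax v a ^ (s * countBefore (pointSeq x y t) i i) *
    orbitProd (F := F) v a s (pointSeq x y t i))
    fun i n => val_coeff_taylor_basisPoly_le v a s n _ _).trans ?_
  rw [Finset.prod_mul_distrib, Finset.prod_pow_eq_pow_sum, ← Finset.mul_sum]
  refine mul_le_mul' (pow_le_pow_right₀ (one_le_coeffMax v a)
    (Nat.mul_le_mul_left _ (sum_countBefore_le t hx hy hxy))) ?_
  rw [← Equiv.prod_comp (pointIndex t m D)]
  simp_rw [pointSeq_pointIndex]
  exact le_rfl

/-- Here the closed formula replaces the row bound: |a_d| = 1 leaves the Vandermonde product, which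
contains the gain, and `max_one_pow_le_prod` absorbs the growth of the points. -/
theorem val_interpDet_le_of_good (hM : t * D + m * D ≤ (q F ^ d) ^ s)
    (hai : ∀ i, v (a i) ≤ 1) (had : v (a (Fin.last d)) = 1) {θ : ℝ≥0} (l₀ : Fin m)
    (hsmall : ∀ j, ∏ i, v (y (l₀, j) - x i) ≤
      θ * ((∏ i, max 1 (v (x i))) * max 1 (v (y (l₀, j))) ^ D)) :
    v (interpDet F a x y t s) ≤
      (∏ p, orbitProd (F := F) v a s (points x y t p)) * θ ^ (t * D) := by
  classical
  have ha : a (Fin.last d) ≠ 0 := by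
    rw [← Valuation.ne_zero_iff v, had]; exact one_ne_zero
  obtain ⟨e, he⟩ := interpDet_eq (F := F) a x y t s ha hM
  rw [he, map_mul, map_pow, had, one_pow, one_mul, map_prod]
  simp_rw [map_prod]
  refine (prod_val_pointSeq_sub_le hx hy hxy v l₀ hsmall).trans
    (mul_le_mul_left (Finset.prod_le_prod' fun p _ => ?_) _)
  refine le_trans (pow_le_pow_right₀ (le_max_left _ _) ?_) (max_one_pow_le_prod (F := F) hai had _ s)
  omega

end

end InterpolationDeterminant

/-! ### Local bounds summed by the product formula -/

section MainInequality

set_option linter.unusedSectionVars false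

variable {F : Type*} [Field F] [Fintype F] {d : ℕ}

theorem map_tPoly {K L : Type*} [Field K] [Field L] (φ : K →+* L) (a : Fin (d + 1) → K) :
    (tPoly F a).map φ = tPoly F fun i => φ (a i) := by
  simp [tPoly, Polynomial.map_sum]

theorem map_actionPoly {K L : Type*} [Field K] [Field L] [Algebra F K] [Algebra F L]
    (φ : K →ₐ[F] L) (a : Fin (d + 1) → K) (f : F[X]) :
    (actionPoly a f).map (φ : K →+* L) = actionPoly (fun i => φ (a i)) f := by
  have h : ∀ n, (((tPoly F a).comp^[n] X).map (φ : K →+* L)) =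
      (tPoly F fun i => φ (a i)).comp^[n] X := by
    intro n
    induction n with
    | zero => simp
    | succ n ih =>
      rw [Function.iterate_succ_apply', Function.iterate_succ_apply', map_comp, ih, map_tPoly]
      rfl
  rw [actionPoly, actionPoly, Polynomial.sum, Polynomial.sum, Polynomial.map_sum]
  refine Finset.sum_congr rfl fun n _ => ?_
  rw [Polynomial.map_mul, h, map_C]
  congr 2
  exact φ.commutes _

variable {K : Type*} [Field K] [Algebra F K] [Algebra (RatFunc F) K] [IsScalarTower F (RatFunc F) K]
  [FiniteDimensional (RatFunc F) K]
variable {L : Type*} [Field L] [Algebra F L] [Algebra (RatFunc F) L] [IsScalarTower F (RatFunc F) L]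
  [FiniteDimensional (RatFunc F) L]

/-- The condition RV, for a prime `l` and coefficients `a` in a field `K`. -/
def GoodPrime (a : Fin (d + 1) → K) (l : MonicPrime F) : Prop :=
  ∀ w : Place F K, w.base = some l →
    (∀ i, w.val (a i) ≤ 1) ∧
    (∀ n, w.val ((actionPoly a l.1 - X ^ (q F ^ (d * l.1.natDegree))).coeff n) < 1) ∧
    w.inertiaDegree = 1

/-- The conditions on l are used at the place of K below W. Only the coefficients of P, not its
roots in L, need residue degree one. -/
theorem exists_small_of_goodPrime (hd : 0 < d) (φ : K →ₐ[RatFunc F] L) {a : Fin (d + 1) → K}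
    (ha : a (Fin.last d) ≠ 0) {l : MonicPrime F} (hl : GoodPrime a l) {P : K[X]} (hP : P.Monic)
    {D : ℕ} {x : Fin D → L} (hPx : P.map (φ : K →+* L) = ∏ i, (X - C (x i)))
    (W : Place F L) (hW : W.base = some l) :
    (∀ i, W.val (φ (a i)) ≤ 1) ∧ W.val (φ (a (Fin.last d))) = 1 ∧
    ∃ θ : ℝ≥0, 0 < θ ∧ Real.logb (q F) θ ≤ - (l.1.natDegree / Module.finrank (RatFunc F) K) ∧
      ∀ j, ∏ i, W.val (act (fun i => φ (a i)) l.1 (x j) - x i) ≤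
        θ * ((∏ i, max 1 (W.val (x i))) *
          max 1 (W.val (act (fun i => φ (a i)) l.1 (x j))) ^ D) := by
  obtain ⟨h1, h2, h3⟩ := hl (W.comap φ) hW
  set w := W.comap φ with hw
  have hwφ : ∀ z, w.val z = W.val (φ z) := fun _ => rfl
  obtain ⟨θ, hθ0, hθ1, hθ, hlog⟩ := w.exists_val_le l hW h3
  set R := actionPoly a l.1 - X ^ (q F ^ (d * l.1.natDegree)) with hR
  set b : Fin (d + 1) → L := fun i => φ (a i) with hb
  have hmap : R.map (φ : K →+* L) = actionPoly b l.1 - X ^ (q F ^ (d * l.1.natDegree)) := by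
    rw [hR, Polynomial.map_sub, Polynomial.map_pow, map_X]
    exact congrArg (· - _) (map_actionPoly (φ.restrictScalars F) a l.1)
  have hdeg : R.natDegree ≤ q F ^ (d * l.1.natDegree) := by
    refine (natDegree_sub_le _ _).trans (max_le ?_ (natDegree_X_pow_le _))
    rw [pow_mul]
    exact natDegree_actionPoly_le a ha l.1
  have hbl : b (Fin.last d) ≠ 0 := (map_ne_zero φ).2 ha
  have hRb : ∀ n, W.val ((actionPoly b l.1 - X ^ (q F ^ (d * l.1.natDegree))).coeff n) < 1 := by
    intro n
    rw [← hmap, coeff_map]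
    exact h2 n
  refine ⟨h1, val_coeff_last_eq_one W.val b hd hbl l.2.1 l.2.2.natDegree_pos h1 hRb, θ, hθ0, hlog,
    fun j => ?_⟩
  have h := val_prod_frobenius_sub_le (F := F) (n := d * l.1.natDegree) (φ : K →+* L) W.val hθ1.le
    (fun y => hθ y)
    (fun y hy => w.val_pow_pow_sub_lt_one l hW h3 hy d) hP h2 hdeg hPx j
  rw [hmap] at h
  simp_rw [← act_eq_pow_add] at h
  refine h.trans ?_
  gcongr
  exact max_one_pow_le_act hbl hRb (x j)

/-- `(q^d - 1) ∑_{j < s} log max {1, |Φ(T^j)(z)|}`. -/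
def Place.orbitLog (W : Place F L) (b : Fin (d + 1) → L) (s : ℕ) (z : L) : ℝ :=
  (q F ^ d - 1) * ∑ j ∈ Finset.range s, W.posLog (act (F := F) b (X ^ j) z)

theorem Place.logb_orbitProd (W : Place F L) (b : Fin (d + 1) → L) (s : ℕ) (z : L) :
    Real.logb (q F) (orbitProd (F := F) W.val b s z) = W.orbitLog b s z := by
  have h1 : ((q F ^ d - 1 : ℕ) : ℝ) = (q F : ℝ) ^ d - 1 := by
    rw [Nat.cast_sub (q_pow_pos _)]; simp
  rw [orbitProd, NNReal.coe_prod, Real.logb_prod, Place.orbitLog, Finset.mul_sum]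
  · refine Finset.sum_congr rfl fun j _ => ?_
    rw [logb_pow_nnreal, h1]
    rfl
  · intro j _
    have : (0 : ℝ≥0) < max 1 (W.val (act (F := F) b (X ^ j) z)) :=
      zero_lt_one.trans_le (le_max_left _ _)
    exact_mod_cast (pow_pos this _).ne'

theorem Place.logb_prod_orbitProd {ι : Type*} [Fintype ι] (W : Place F L) (b : Fin (d + 1) → L)
    (s : ℕ) (z : ι → L) :
    Real.logb (q F) (∏ p, orbitProd (F := F) W.val b s (z p) : ℝ≥0) = ∑ p, W.orbitLog b s (z p) := by
  rw [NNReal.coe_prod, Real.logb_prod]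
  · exact Finset.sum_congr rfl fun p _ => W.logb_orbitProd b s _
  · intro p _
    exact_mod_cast (zero_lt_one.trans_le (one_le_orbitProd (F := F) W.val b s (z p))).ne'

-- At most one l i lies below W, so at most one indicator is nonzero. The gain is used there and the
-- row bound at all other places.
open scoped Classical in
theorem Place.log_interpDet_le (hd : 0 < d) (φ : K →ₐ[RatFunc F] L) {a : Fin (d + 1) → K}
    (ha : a (Fin.last d) ≠ 0) {m : ℕ} {l : Fin m → MonicPrime F} (hl : ∀ i, GoodPrime a (l i))
    (hlinj : Function.Injective l) {N : ℕ} (hN : ∀ i, (l i).1.natDegree = N)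
    {P : K[X]} (hP : P.Monic)
    {D : ℕ} {x : Fin D → L} (hPx : P.map (φ : K →+* L) = ∏ i, (X - C (x i)))
    {y : Fin m × Fin D → L} (hyx : ∀ i j, y (i, j) = act (fun i => φ (a i)) (l i).1 (x j))
    (hx : Function.Injective x) (hy : Function.Injective y) (hxy : ∀ p i, y p ≠ x i)
    (t s : ℕ) (hM : t * D + m * D ≤ (q F ^ d) ^ s) (W : Place F L) :
    W.log (interpDet F (fun i => φ (a i)) x y t s) +
      ∑ i, (t * D * (N / Module.finrank (RatFunc F) K) : ℝ) *
        (if W.base = some (l i) then 1 else 0) ≤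
      (s * (t * D * t) : ℝ) * W.coeffLog (fun i => φ (a i)) +
        ∑ p, W.orbitLog (fun i => φ (a i)) s (points x y t p) := by
  set b : Fin (d + 1) → L := fun i => φ (a i) with hb
  have hbl : b (Fin.last d) ≠ 0 := (map_ne_zero φ).2 ha
  have hΔ := interpDet_ne_zero (F := F) b x y t s hbl hM
  have hΔ0 : 0 < W.val (interpDet F b x y t s) := zero_lt_iff.2 ((Valuation.ne_zero_iff _).2 hΔ)
  have hprod : (1 : ℝ≥0) ≤ ∏ p, orbitProd (F := F) W.val b s (points x y t p) :=
    Finset.one_le_prod' fun p _ => one_le_orbitProd _ _ _ _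
  by_cases hW : ∃ i₀, W.base = some (l i₀)
  · obtain ⟨i₀, hi₀⟩ := hW
    obtain ⟨h1, h2, θ, hθ0, hθ, h3⟩ := exists_small_of_goodPrime hd φ ha (hl i₀) hP hPx W hi₀
    have hle := val_interpDet_le_of_good (F := F) W.val b t s hx hy hxy hM h1 h2 i₀
      (fun j => by rw [hyx]; exact h3 j)
    have hlog : W.log (interpDet F b x y t s) ≤ ∑ p, W.orbitLog b s (points x y t p) +
        (t * D : ℕ) * Real.logb (q F) θ := by
      rw [← W.logb_prod_orbitProd b s, ← logb_pow_nnreal, ← Real.logb_mul]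
      · exact Real.logb_le_logb_of_le one_lt_q_real (by exact_mod_cast hΔ0) (by exact_mod_cast hle)
      · exact_mod_cast (zero_lt_one.trans_le hprod).ne'
      · exact_mod_cast (pow_pos hθ0 _).ne'
    have hsum : ∑ i, (t * D * (N / Module.finrank (RatFunc F) K) : ℝ) *
        (if W.base = some (l i) then 1 else 0) = t * D * (N / Module.finrank (RatFunc F) K) := by
      rw [Finset.sum_eq_single i₀]
      · rw [if_pos hi₀, mul_one]
      · intro i _ hne
        rw [if_neg, mul_zero]
        rw [hi₀]
        intro h
        exact hne (hlinj (Option.some.inj h)).symm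
      · simp
    rw [hsum]
    rw [hN] at hθ
    have h4 : ((t * D : ℕ) : ℝ) * Real.logb (q F) θ ≤
        ((t * D : ℕ) : ℝ) * -(N / Module.finrank (RatFunc F) K) := by gcongr
    have h5 : 0 ≤ (s * (t * D * t) : ℝ) * W.coeffLog b :=
      mul_nonneg (by positivity) (W.coeffLog_nonneg b)
    push_cast at h4 hlog
    linarith
  · have hsum : ∑ i, (t * D * (N / Module.finrank (RatFunc F) K) : ℝ) *
        (if W.base = some (l i) then 1 else 0) = 0 := by
      refine Finset.sum_eq_zero fun i _ => ?_
      rw [if_neg fun h => hW ⟨i, h⟩, mul_zero]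
    have hle := val_interpDet_le (F := F) W.val b t s hx hy hxy
    have h1 := Real.logb_le_logb_of_le (one_lt_q_real (F := F)) (by exact_mod_cast hΔ0)
      (NNReal.coe_le_coe.2 hle)
    rw [logb_mul_nnreal (one_le_pow₀ (one_le_coeffMax _ _)) hprod, logb_pow_nnreal,
      W.logb_prod_orbitProd b s] at h1
    rw [hsum, add_zero]
    push_cast at h1
    exact h1

/-- The averaged form of the estimates for the interpolation determinant. -/
theorem mul_le_avg_of_goodPrime [Normal (RatFunc F) L] (hd : 0 < d) (φ : K →ₐ[RatFunc F] L)
    {a : Fin (d + 1) → K}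
    (ha : a (Fin.last d) ≠ 0) {m : ℕ} {l : Fin m → MonicPrime F} (hl : ∀ i, GoodPrime a (l i))
    (hlinj : Function.Injective l) {N : ℕ} (hN : ∀ i, (l i).1.natDegree = N)
    {P : K[X]} (hP : P.Monic)
    {D : ℕ} {x : Fin D → L} (hPx : P.map (φ : K →+* L) = ∏ i, (X - C (x i)))
    {y : Fin m × Fin D → L} (hyx : ∀ i j, y (i, j) = act (fun i => φ (a i)) (l i).1 (x j))
    (hx : Function.Injective x) (hy : Function.Injective y) (hxy : ∀ p i, y p ≠ x i)
    (t s : ℕ) (hM : t * D + m * D ≤ (q F ^ d) ^ s) :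
    (m * (t * D * (N / Module.finrank (RatFunc F) K)) : ℝ) ≤
      (s * (t * D * t) : ℝ) * avg F L (fun W => W.coeffLog (fun i => φ (a i))) +
        ∑ p, (q F ^ d - 1) * ∑ j ∈ Finset.range s,
          avg F L (fun W => W.posLog (act (F := F) (fun i => φ (a i)) (X ^ j) (points x y t p))) := by
  classical
  set b : Fin (d + 1) → L := fun i => φ (a i) with hb
  have hbl : b (Fin.last d) ≠ 0 := (map_ne_zero φ).2 ha
  have hΔ := interpDet_ne_zero (F := F) b x y t s hbl hM
  have f1 := Place.log_support_finite (F := F) hΔ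
  have f2 := fun i => (avg_ite_base (L := L) (some (l i) : BasePlace F))
  have f2' : ∀ i ∈ (Finset.univ : Finset (Fin m)), (Function.support fun W : Place F L =>
      (t * D * (N / Module.finrank (RatFunc F) K) : ℝ) *
        (if W.base = some (l i) then 1 else 0)).Finite := fun i _ =>
    (f2 i).1.subset fun W hW => right_ne_zero_of_mul hW
  have f3 := avg_sum Finset.univ f2'
  have f4 : (Function.support fun W : Place F L => (s * (t * D * t) : ℝ) * W.coeffLog b).Finite :=
    (Place.coeffLog_support_finite (F := F) b).subset fun W hW => right_ne_zero_of_mul hW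
  have f5 := fun p : (Fin t × Fin D) ⊕ (Fin m × Fin D) => avg_sum (Finset.range s) fun j _ =>
    Place.posLog_support_finite (F := F) (act (F := F) b (X ^ j) (points x y t p))
  have f5' : ∀ p ∈ (Finset.univ : Finset ((Fin t × Fin D) ⊕ (Fin m × Fin D))), (Function.support fun W : Place F L =>
      W.orbitLog b s (points x y t p)).Finite := fun p _ =>
    (f5 p).1.subset fun W hW => right_ne_zero_of_mul hW
  have f6 := avg_sum Finset.univ f5'
  have h := avg_mono (F := F) (L := L) ((f1.union f3.1).subset (Function.support_add _ _))
    ((f4.union f6.1).subset (Function.support_add _ _))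
    (fun W => W.log_interpDet_le hd φ ha hl hlinj hN hP hPx hyx hx hy hxy t s hM)
  -- The product formula removes log |Δ|; each l i then contributes its full gain because the places
  -- above it have total mass 1.
  rw [avg_add f1 f3.1, avg_add f4 f6.1, avg_log hΔ, f3.2, f6.2, avg_const_mul, zero_add] at h
  simp_rw [avg_const_mul] at h
  rw [Finset.sum_congr rfl fun i _ => congrArg _ (f2 i).2] at h
  simp only [mul_one, Finset.sum_const, Finset.card_univ, Fintype.card_fin, nsmul_eq_mul] at h
  refine h.trans (le_of_eq (congrArg (_ + ·) (Finset.sum_congr rfl fun p _ => ?_)))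
  rw [← (f5 p).2, ← avg_const_mul]
  rfl

end MainInequality

/-! ### Distinctness of the points Φ(l)(z) -/

section Conjugates

set_option linter.unusedSectionVars false

variable {F : Type*} [Field F] [Fintype F] {d : ℕ} (Φ : DrinfeldModule F d)

namespace DrinfeldModule

theorem map_hom (σ : Bar F ≃ₐ[Φ.coeffField] Bar F) (f : F[X]) (z : Bar F) :
    σ (Φ.hom f z) = Φ.hom f (σ z) := by
  have hσ : ∀ i, σ (Φ.coeff i) = Φ.coeff i := fun i => σ.commutes (toFieldOf Φ.coeff i)
  have h := map_act (((σ : Bar F →ₐ[Φ.coeffField] Bar F).restrictScalars (RatFunc F)).restrictScalars F) Φ.coeff f z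
  have e : (fun i => (((σ : Bar F →ₐ[Φ.coeffField] Bar F).restrictScalars (RatFunc F)).restrictScalars F) (Φ.coeff i)) =
      Φ.coeff := funext hσ
  rw [e] at h
  exact h

theorem canonicalHeight_algEquiv (σ : Bar F ≃ₐ[Φ.coeffField] Bar F) (z : Bar F) :
    Φ.canonicalHeight (σ z) = Φ.canonicalHeight z :=
  Φ.canonicalHeight_map ((σ : Bar F →ₐ[Φ.coeffField] Bar F).restrictScalars (RatFunc F))
    (fun i => σ.commutes (toFieldOf Φ.coeff i)) z

theorem hom_mul_apply (f g : F[X]) (z : Bar F) : Φ.hom (f * g) z = Φ.hom f (Φ.hom g z) := by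
  rw [map_mul, Module.End.mul_apply]

theorem hom_comm (f g : F[X]) (z : Bar F) : Φ.hom f (Φ.hom g z) = Φ.hom g (Φ.hom f z) := by
  rw [← hom_mul_apply, mul_comm, hom_mul_apply]

theorem isAlgClosure_coeffField : IsAlgClosure Φ.coeffField (Bar F) :=
  ⟨inferInstance, Algebra.IsAlgebraic.tower_top (K := RatFunc F) Φ.coeffField⟩

/-- σ acts injectively on the finite set of roots of the minimal polynomial of y. -/
theorem exists_pow_apply_eq (σ : Bar F ≃ₐ[Φ.coeffField] Bar F) (y : Bar F) :
    ∃ n : ℕ, 0 < n ∧ σ^[n] y = y := by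
  have := Φ.isAlgClosure_coeffField
  have hint : IsIntegral Φ.coeffField y :=
    (Algebra.IsIntegral.isIntegral (R := RatFunc F) y).tower_top
  have hne := minpoly.ne_zero hint
  have hmaps : Set.MapsTo σ ((minpoly Φ.coeffField y).rootSet (Bar F))
      ((minpoly Φ.coeffField y).rootSet (Bar F)) := by
    intro z hz
    rw [mem_rootSet_of_ne hne] at hz ⊢
    rw [aeval_algHom_apply σ z, hz, map_zero]
  have hfin : Finite ((minpoly Φ.coeffField y).rootSet (Bar F)) :=
    (rootSet_finite _ _).to_subtype
  have hy : y ∈ (minpoly Φ.coeffField y).rootSet (Bar F) := by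
    rw [mem_rootSet_of_ne hne]; exact minpoly.aeval _ _
  have hinj : Function.Injective (hmaps.restrict) := fun u v h =>
    Subtype.ext (σ.injective (congrArg Subtype.val h))
  obtain ⟨n, hn, hper⟩ := Function.Injective.mem_periodicPts hinj ⟨y, hy⟩
  refine ⟨n, hn, ?_⟩
  have h := congrArg Subtype.val hper
  rw [Set.MapsTo.iterate_restrict hmaps n] at h
  simpa using h

theorem hom_pow_eq {f g : F[X]} (σ : Bar F ≃ₐ[Φ.coeffField] Bar F) {y : Bar F}
    (h : Φ.hom f y = Φ.hom g (σ y)) (n : ℕ) : Φ.hom (f ^ n) y = Φ.hom (g ^ n) (σ^[n] y) := by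
  induction n with
  | zero => simp
  | succ n ih =>
    rw [pow_succ, hom_mul_apply, h, hom_comm, ← map_hom, ih, map_hom, ← hom_mul_apply, ← pow_succ',
      Function.iterate_succ_apply']

/-- σ commutes with Φ, so the relation iterates to Φ(f^n)(y) = Φ(g^n)(σ^n y). When σ^n y = y, the
polynomial f^n - g^n annihilates y. -/
theorem exists_pow_eq_pow {f g : F[X]} (σ : Bar F ≃ₐ[Φ.coeffField] Bar F) {y : Bar F}
    (hy : ¬ Φ.IsTorsion y) (h : Φ.hom f y = Φ.hom g (σ y)) : ∃ n : ℕ, 0 < n ∧ f ^ n = g ^ n := by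
  obtain ⟨n, hn, hσ⟩ := Φ.exists_pow_apply_eq σ y
  refine ⟨n, hn, ?_⟩
  by_contra hne
  refine hy ⟨f ^ n - g ^ n, sub_ne_zero.2 hne, ?_⟩
  rw [map_sub, LinearMap.sub_apply, Φ.hom_pow_eq σ h n, hσ, sub_self]

theorem eq_of_hom_eq (σ : Bar F ≃ₐ[Φ.coeffField] Bar F) {y : Bar F} (hy : ¬ Φ.IsTorsion y)
    {l l' : MonicPrime F} (h : Φ.hom l.1 y = Φ.hom l'.1 (σ y)) : l = l' := by
  obtain ⟨n, hn, hpow⟩ := Φ.exists_pow_eq_pow σ hy h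
  have h1 : l.1 ∣ l'.1 ^ n := hpow ▸ dvd_pow_self _ hn.ne'
  exact Subtype.ext (eq_of_monic_of_associated l.2.1 l'.2.1
    (l.2.2.associated_of_dvd l'.2.2 (l.2.2.prime.dvd_of_dvd_pow h1)))

theorem hom_ne_apply (σ : Bar F ≃ₐ[Φ.coeffField] Bar F) {y : Bar F} (hy : ¬ Φ.IsTorsion y)
    (l : MonicPrime F) : Φ.hom l.1 y ≠ σ y := by
  intro h
  have h' : Φ.hom l.1 y = Φ.hom 1 (σ y) := by rw [h, map_one, Module.End.one_apply]
  obtain ⟨n, hn, hpow⟩ := Φ.exists_pow_eq_pow σ hy h'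
  rw [one_pow] at hpow
  have h1 : l.1 ∣ 1 := hpow ▸ dvd_pow_self _ hn.ne'
  exact l.2.2.not_isUnit (isUnit_of_dvd_one h1)

/-- A set of conjugates on which `Φ(l)` is not injective for all `l` in `T` has at least
`2 ^ #T` elements. -/
theorem two_pow_card_le {R : Finset (Bar F)}
    (htrans : ∀ z ∈ R, ∀ z' ∈ R, ∃ σ : Bar F ≃ₐ[Φ.coeffField] Bar F, σ z = z')
    (hstab : ∀ σ : Bar F ≃ₐ[Φ.coeffField] Bar F, ∀ z ∈ R, σ z ∈ R) (hR : R.Nonempty)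
    (T : Finset (MonicPrime F))
    (hT : ∀ l ∈ T, ∃ z ∈ R, ∃ z' ∈ R, z ≠ z' ∧ Φ.hom l.1 z = Φ.hom l.1 z') :
    2 ^ T.card ≤ R.card := by
  classical
  -- The stronger claim suits induction: each further prime of T at least halves the image of R
  -- under the product of the primes.
  suffices h : 2 ^ T.card * (R.image fun z => Φ.hom (∏ l ∈ T, l.1) z).card ≤ R.card from
    (Nat.le_mul_of_pos_right _ (Finset.card_pos.2 (hR.image _))).trans h
  induction T using Finset.induction_on with
  | empty => simp
  | insert l T hl ih =>
    have ih' := ih fun l' hl' => hT l' (Finset.mem_insert_of_mem hl')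
    obtain ⟨z, hz, z', hz', hne, heq⟩ := hT l (Finset.mem_insert_self _ _)
    set f := ∏ l ∈ T, l.1 with hf
    have hcop : IsCoprime f l.1 := by
      rw [hf]
      refine IsCoprime.prod_left fun l' hl' => ?_
      rw [Irreducible.coprime_iff_not_dvd l'.2.2]
      intro hdvd
      have : l' = l := Subtype.ext (eq_of_monic_of_associated l'.2.1 l.2.1
        (l'.2.2.associated_of_dvd l.2.2 hdvd))
      exact hl (this ▸ hl')
    -- A point killed by both Φ(f) and Φ(l) is zero by coprimality, so the collision under Φ(l) has
    -- not already happened under Φ(f).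
    have hfne : Φ.hom f z ≠ Φ.hom f z' := by
      intro h
      obtain ⟨u, w, huw⟩ := hcop
      apply hne
      rw [← sub_eq_zero]
      have h1 : Φ.hom f (z - z') = 0 := by rw [map_sub, h, sub_self]
      have h2 : Φ.hom l.1 (z - z') = 0 := by rw [map_sub, heq, sub_self]
      calc z - z' = Φ.hom (u * f + w * l.1) (z - z') := by
            rw [huw, map_one, Module.End.one_apply]
        _ = 0 := by
            rw [map_add, LinearMap.add_apply, hom_mul_apply, hom_mul_apply, h1, h2, map_zero,
              map_zero, add_zero]
    have himg : (R.image fun z => Φ.hom (∏ l ∈ insert l T, l.1) z) =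
        (R.image fun z => Φ.hom f z).image fun z => Φ.hom l.1 z := by
      rw [Finset.image_image]
      refine Finset.image_congr fun z _ => ?_
      simp only [Function.comp_apply]
      rw [Finset.prod_insert hl, hom_mul_apply]
    -- Automorphisms carry the one colliding pair into every fibre, by transitivity on R.
    have hfib : 2 * ((R.image fun z => Φ.hom f z).image fun z => Φ.hom l.1 z).card ≤
        (R.image fun z => Φ.hom f z).card := by
      refine Finset.mul_card_image_le_card _ _ fun c hc => ?_
      rw [Finset.image_image] at hc
      obtain ⟨z₁, hz₁, rfl⟩ := Finset.mem_image.1 hc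
      obtain ⟨σ, rfl⟩ := htrans z hz z₁ hz₁
      refine Nat.succ_le_of_lt (Finset.one_lt_card.2 ?_)
      refine ⟨Φ.hom f (σ z), ?_, Φ.hom f (σ z'), ?_, ?_⟩
      · exact Finset.mem_filter.2 ⟨Finset.mem_image_of_mem _ (hstab σ z hz), rfl⟩
      · refine Finset.mem_filter.2 ⟨Finset.mem_image_of_mem _ (hstab σ z' hz'), ?_⟩
        simp only [Function.comp_apply]
        rw [hom_comm, ← map_hom, ← heq, map_hom, hom_comm]
      · rw [← map_hom, ← map_hom]
        exact fun h => hfne (σ.injective h)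
    rw [himg, Finset.card_insert_of_notMem hl, pow_succ, mul_assoc]
    exact (Nat.mul_le_mul_left _ hfib).trans ih'

end DrinfeldModule

end Conjugates

/-! ### The height inequality -/

section HeightInequality

set_option linter.unusedSectionVars false

variable {F : Type*} [Field F] [Fintype F] {d : ℕ} (Φ : DrinfeldModule F d)

namespace DrinfeldModule

/-- The geometric sum (B - 1) ∑ B^j = B^s - 1 with B = q^d, together with s errors 4 h(Φ)/(B - 1),
in which the factor B - 1 cancels. -/
theorem sum_weilHeight_le (s : ℕ) (z : Bar F) :
    ((q F : ℝ) ^ d - 1) * ∑ j ∈ Finset.range s, weilHeight (Φ.hom (X ^ j) z) ≤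
      ((q F : ℝ) ^ d) ^ s * Φ.canonicalHeight z + 4 * s * Φ.height := by
  have hB := Φ.two_le_q_pow
  have h0 := Φ.canonicalHeight_nonneg z
  have h1 : ∀ j, weilHeight (Φ.hom (X ^ j) z) ≤ ((q F : ℝ) ^ d) ^ j * Φ.canonicalHeight z +
      4 * Φ.height / ((q F : ℝ) ^ d - 1) := by
    intro j
    rw [← canonicalHeight_hom_X_pow]
    exact Φ.weilHeight_le_canonicalHeight_add _
  generalize (q F : ℝ) ^ d = B at *
  have hB1 : 0 < B - 1 := by linarith
  calc (B - 1) * ∑ j ∈ Finset.range s, weilHeight (Φ.hom (X ^ j) z)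
      ≤ (B - 1) * ∑ j ∈ Finset.range s, (B ^ j * Φ.canonicalHeight z + 4 * Φ.height / (B - 1)) := by
        gcongr with j _
        exact h1 j
    _ = (B ^ s - 1) * Φ.canonicalHeight z + 4 * s * Φ.height := by
        rw [Finset.sum_add_distrib, ← Finset.sum_mul, Finset.sum_const, Finset.card_range,
          nsmul_eq_mul, mul_add, ← mul_assoc, mul_geom_sum]
        field_simp
    _ ≤ _ := by linarith

theorem finiteDimensional_coeffField : FiniteDimensional (RatFunc F) Φ.coeffField :=
  have := (Set.finite_range Φ.coeff).to_subtype
  IntermediateField.finiteDimensional_adjoin fun x _ => Algebra.IsIntegral.isIntegral x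

theorem isTorsion_of_isTorsion_apply (σ : Bar F ≃ₐ[Φ.coeffField] Bar F) {z : Bar F}
    (h : Φ.IsTorsion (σ z)) : Φ.IsTorsion z := by
  obtain ⟨f, hf, hz⟩ := h
  refine ⟨f, hf, ?_⟩
  rw [← map_hom] at hz
  exact (map_eq_zero_iff σ σ.injective).1 hz

/-- The conjugates over `k(Φ)` of a point which is separable over `k`. -/
theorem exists_conjugates (x : Bar F) (hsep : IsSeparable (RatFunc F) x) :
    ∃ (P : Φ.coeffField[X]) (R : Finset (Bar F)), P.Monic ∧ x ∈ R ∧ R.card ≤ degree x ∧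
      P.map (algebraMap Φ.coeffField (Bar F)) = ∏ z ∈ R, (X - C z) ∧
      (∀ z ∈ R, ∀ z' ∈ R, ∃ σ : Bar F ≃ₐ[Φ.coeffField] Bar F, σ z = z') ∧
      ∀ σ : Bar F ≃ₐ[Φ.coeffField] Bar F, ∀ z ∈ R, σ z ∈ R := by
  classical
  have := Φ.isAlgClosure_coeffField
  have hnormal : Normal Φ.coeffField (Bar F) := IsAlgClosure.normal _ _
  have hint : IsIntegral Φ.coeffField x :=
    (Algebra.IsIntegral.isIntegral (R := RatFunc F) x).tower_top
  have hsepK : IsSeparable Φ.coeffField x := hsep.tower_top _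
  set P := minpoly Φ.coeffField x with hP
  have hPm : P.Monic := minpoly.monic hint
  have hsplit : (P.map (algebraMap Φ.coeffField (Bar F))).Splits := IsAlgClosed.splits _
  have hnd : (P.map (algebraMap Φ.coeffField (Bar F))).roots.Nodup :=
    nodup_roots (Separable.map hsepK)
  set R := (P.map (algebraMap Φ.coeffField (Bar F))).roots.toFinset with hR
  have hmem : ∀ z, z ∈ R ↔ aeval z P = 0 := by
    intro z
    rw [hR, Multiset.mem_toFinset, mem_roots (hPm.map _).ne_zero, IsRoot, eval_map_algebraMap]
  have hprod : P.map (algebraMap Φ.coeffField (Bar F)) = ∏ z ∈ R, (X - C z) := by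
    have h1 := hsplit.eq_prod_roots_of_monic (hPm.map _)
    rw [Finset.prod, hR, Multiset.toFinset_val, Multiset.dedup_eq_self.2 hnd]
    exact h1
  have hcard : R.card = P.natDegree := by
    have h1 := congrArg natDegree hprod
    rw [natDegree_map, natDegree_prod_of_monic _ _ fun _ _ => monic_X_sub_C _] at h1
    simpa using h1.symm
  have hconj : ∀ z ∈ R, ∃ σ : Bar F ≃ₐ[Φ.coeffField] Bar F, σ x = z := by
    intro z hz
    have : IsConjRoot Φ.coeffField x z := isConjRoot_of_aeval_eq_zero hint ((hmem z).1 hz)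
    exact isConjRoot_iff_exists_algEquiv.1 this.symm
  refine ⟨P, R, hPm, (hmem x).2 (minpoly.aeval _ _), ?_, hprod, fun z hz z' hz' => ?_,
    fun σ z hz => ?_⟩
  · have hk : IsIntegral (RatFunc F) x := Algebra.IsIntegral.isIntegral x
    rw [hcard, degree, IntermediateField.adjoin.finrank hk,
      -- The minimal polynomial over k(Φ) divides the one over `k`, so there are at most D
      -- conjugates.
      ← natDegree_map (algebraMap (RatFunc F) Φ.coeffField)]
    exact natDegree_le_of_dvd (minpoly.dvd_map_of_isScalarTower _ _ _)
      ((minpoly.monic hk).map _).ne_zero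
  · obtain ⟨σ, rfl⟩ := hconj z hz
    obtain ⟨τ, rfl⟩ := hconj z' hz'
    exact ⟨σ.symm.trans τ, by simp⟩
  · rw [hmem] at hz ⊢
    rw [aeval_algHom_apply σ z, hz, map_zero]

/-- The inequality obtained from the interpolation determinant. -/
theorem height_inequality {x : Bar F} (hx : ¬ Φ.IsTorsion x) (hsep : IsSeparable (RatFunc F) x)
    (N t m s : ℕ) (hcount : m + Nat.log 2 (degree x) ≤ Φ.countRV N)
    (hM : (t + m) * degree x ≤ (q F ^ d) ^ s) :
    (m * t * N : ℝ) ≤ Φ.alpha * s * (t ^ 2 + 4 * (t + m)) +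
      Φ.fieldDegree * (((q F : ℝ) ^ d) ^ s * Φ.canonicalHeight x *
        (t + m * ((q F : ℝ) ^ d) ^ N)) := by
  classical
  have hfd := Φ.finiteDimensional_coeffField
  have hĥ := Φ.canonicalHeight_nonneg x
  have hh := Φ.one_le_height
  rcases Nat.eq_zero_or_pos m with rfl | hm
  · simp only [CharP.cast_eq_zero, zero_mul, add_zero]
    rw [alpha]
    positivity
  obtain ⟨P, R, hP, hxR, hRcard, hprod, htrans, hstab⟩ := Φ.exists_conjugates x hsep
  have hRpos : 0 < R.card := Finset.card_pos.2 ⟨x, hxR⟩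
  have hnt : ∀ z ∈ R, ¬ Φ.IsTorsion z := by
    intro z hz h
    obtain ⟨σ, rfl⟩ := htrans x hxR z hz
    exact hx (Φ.isTorsion_of_isTorsion_apply σ h)
  have hheight : ∀ z ∈ R, Φ.canonicalHeight z = Φ.canonicalHeight x := by
    intro z hz
    obtain ⟨σ, rfl⟩ := htrans x hxR z hz
    exact Φ.canonicalHeight_algEquiv σ x
  set S := {l : MonicPrime F | l.1.natDegree = N ∧ Φ.PrimeRV l} with hS
  have hcount' : m + Nat.log 2 (degree x) ≤ S.ncard := hcount
  -- Since m > 0 the cardinality is positive, which excludes the default value 0 of `ncard` on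
  -- infinite sets; m = 0 was treated apart.
  have hSfin : S.Finite := Set.finite_of_ncard_pos (by omega)
  let bad : MonicPrime F → Prop := fun l =>
    ∃ z ∈ R, ∃ z' ∈ R, z ≠ z' ∧ Φ.hom l.1 z = Φ.hom l.1 z'
  have hbad : (hSfin.toFinset.filter bad).card ≤ Nat.log 2 (degree x) := by
    refine Nat.le_log_of_pow_le one_lt_two ((Φ.two_pow_card_le htrans hstab ⟨x, hxR⟩ _ ?_).trans
      hRcard)
    intro l hl
    exact (Finset.mem_filter.1 hl).2
  have hgood : m ≤ (hSfin.toFinset.filter fun l => ¬ bad l).card := by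
    have h1 := Finset.card_filter_add_card_filter_not (s := hSfin.toFinset) bad
    rw [← Set.ncard_eq_toFinset_card S hSfin] at h1
    omega
  obtain ⟨G, hGsub, hGcard⟩ := Finset.exists_subset_card_eq hgood
  let eG : Fin m ≃ G := (G.equivFinOfCardEq hGcard).symm
  let l : Fin m → MonicPrime F := fun i => eG i
  have hlG : ∀ i, (l i).1.natDegree = N ∧ Φ.PrimeRV (l i) ∧ ¬ bad (l i) := by
    intro i
    have h1 := Finset.mem_filter.1 (hGsub (eG i).2)
    have h2 := (Set.Finite.mem_toFinset hSfin).1 h1.1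
    exact ⟨h2.1, h2.2, h1.2⟩
  have hlinj : Function.Injective l := Subtype.val_injective.comp eG.injective
  let eR : Fin R.card ≃ R := R.equivFin.symm
  obtain ⟨L, -, hL1, hL2, hL3, -⟩ := Φ.exists_model (S := (R : Set (Bar F)) ∪ Set.range Φ.coeff)
    (R.finite_toSet.union (Set.finite_range _))
  have hKL : Φ.coeffField ≤ L := by
    rw [IntermediateField.adjoin_le_iff]
    exact Set.subset_union_right.trans hL3
  let φ : Φ.coeffField →ₐ[RatFunc F] L := IntermediateField.inclusion hKL
  let a : Fin (d + 1) → Φ.coeffField := toFieldOf Φ.coeff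
  have ha : a (Fin.last d) ≠ 0 := fun h => Φ.coeff_last (congrArg Subtype.val h)
  have hb : (fun i => ((φ (a i) : L) : Bar F)) = Φ.coeff := rfl
  let z : Fin R.card → L := fun i => ⟨eR i, hL3 (Or.inl (eR i).2)⟩
  have hzR : ∀ i, (z i : Bar F) ∈ R := fun i => (eR i).2
  have hzinj : Function.Injective z := fun i j h =>
    eR.injective (Subtype.ext (congrArg (fun w : L => (w : Bar F)) h))
  let y : Fin m × Fin R.card → L := fun p => act (fun i => φ (a i)) (l p.1).1 (z p.2)
  have hy : ∀ p, (y p : Bar F) = Φ.hom (l p.1).1 (z p.2) := fun p => Φ.coe_act hb _ _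
  have hyinj : Function.Injective y := by
    rintro ⟨i, j⟩ ⟨i', j'⟩ h
    have h1 : Φ.hom (l i).1 (z j) = Φ.hom (l i').1 (z j') := by
      rw [← hy (i, j), ← hy (i', j'), h]
    obtain ⟨σ, hσ⟩ := htrans _ (hzR j) _ (hzR j')
    have h2 : l i = l i' := Φ.eq_of_hom_eq σ (hnt _ (hzR j)) (by rw [hσ]; exact h1)
    have h3 : i = i' := hlinj h2
    subst h3
    have h4 : j = j' := by
      by_contra hne
      exact (hlG i).2.2 ⟨_, hzR j, _, hzR j', fun h => hne (hzinj (Subtype.ext h)), h1⟩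
    rw [h4]
  have hyz : ∀ p i, y p ≠ z i := by
    intro p i h
    obtain ⟨σ, hσ⟩ := htrans _ (hzR p.2) _ (hzR i)
    refine Φ.hom_ne_apply σ (hnt _ (hzR p.2)) (l p.1) ?_
    rw [← hy, hσ, h]
  have hPz : P.map (φ : Φ.coeffField →+* L) = ∏ i, (X - C (z i)) := by
    apply Polynomial.map_injective (algebraMap L (Bar F)) (algebraMap L (Bar F)).injective
    rw [Polynomial.map_map, Polynomial.map_prod]
    have h1 : (algebraMap L (Bar F)).comp (φ : Φ.coeffField →+* L) =
        algebraMap Φ.coeffField (Bar F) := rfl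
    rw [h1, hprod, ← Finset.prod_coe_sort, ← Equiv.prod_comp eR]
    refine Finset.prod_congr rfl fun i _ => ?_
    rw [Polynomial.map_sub, map_X, map_C]
    rfl
  have hMs : t * R.card + m * R.card ≤ (q F ^ d) ^ s := by
    rw [← add_mul]
    exact (Nat.mul_le_mul_left _ hRcard).trans hM
  have hmain := mul_le_avg_of_goodPrime (F := F) Φ.rank_pos φ ha (fun i => (hlG i).2.1) hlinj
    (fun i => (hlG i).1) hP hPz (y := y) (fun _ _ => rfl) hzinj hyinj hyz t s hMs
  rw [← Φ.height_eq_avg hb] at hmain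
  simp_rw [← Φ.weilHeight_hom_eq_avg hb] at hmain
  set B := (q F : ℝ) ^ d with hB
  set c : ℝ := (Φ.fieldDegree : ℝ) with hc
  have hc' : (Module.finrank (RatFunc F) Φ.coeffField : ℝ) = c := rfl
  have hcpos : 0 < c := by
    rw [← hc']; exact_mod_cast Module.finrank_pos
  have hB0 : 0 < B := by have := Φ.two_le_q_pow; linarith
  -- Conjugates share the canonical height of x, and the points Φ(l)(z) have at most B^N times it.
  have hsum : ∑ p, (B - 1) * ∑ j ∈ Finset.range s, weilHeight (Φ.hom (X ^ j) (points z y t p : L)) ≤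
      t * R.card * (B ^ s * Φ.canonicalHeight x + 4 * s * Φ.height) +
      m * R.card * (B ^ s * (B ^ N * Φ.canonicalHeight x) + 4 * s * Φ.height) := by
    rw [Fintype.sum_sum_type]
    refine add_le_add ?_ ?_
    · have h1 : ∀ p : Fin t × Fin R.card, (B - 1) * ∑ j ∈ Finset.range s,
          weilHeight (Φ.hom (X ^ j) (points z y t (Sum.inl p) : L)) ≤
          B ^ s * Φ.canonicalHeight x + 4 * s * Φ.height := by
        intro p
        refine (Φ.sum_weilHeight_le s _).trans ?_
        rw [show points z y t (Sum.inl p) = z p.2 from rfl, hheight _ (hzR _)]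
      refine (Finset.sum_le_sum fun p _ => h1 p).trans (le_of_eq ?_)
      rw [Finset.sum_const, Finset.card_univ, Fintype.card_prod, Fintype.card_fin, Fintype.card_fin,
        nsmul_eq_mul, Nat.cast_mul]
    · have h1 : ∀ p : Fin m × Fin R.card, (B - 1) * ∑ j ∈ Finset.range s,
          weilHeight (Φ.hom (X ^ j) (points z y t (Sum.inr p) : L)) ≤
          B ^ s * (B ^ N * Φ.canonicalHeight x) + 4 * s * Φ.height := by
        intro p
        refine (Φ.sum_weilHeight_le s _).trans ?_
        rw [show points z y t (Sum.inr p) = y p from rfl, hy]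
        have h2 := Φ.canonicalHeight_hom_le (l p.1).1 (z p.2)
        rw [hheight _ (hzR _), (hlG p.1).1] at h2
        gcongr
      refine (Finset.sum_le_sum fun p _ => h1 p).trans (le_of_eq ?_)
      rw [Finset.sum_const, Finset.card_univ, Fintype.card_prod, Fintype.card_fin, Fintype.card_fin,
        nsmul_eq_mul, Nat.cast_mul]
  have hfin := hmain.trans (add_le_add_right hsum _)
  rw [hc'] at hfin
  have hR0 : (0 : ℝ) < R.card := by exact_mod_cast hRpos
  have hα : Φ.alpha = Φ.height * c := rfl
  rw [hα]
  -- Every term is proportional to the number of conjugates, which therefore cancels.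
  have key : (R.card : ℝ) * (m * t * N) ≤ R.card * (Φ.height * c * s * (t ^ 2 + 4 * (t + m)) +
      c * (B ^ s * Φ.canonicalHeight x * (t + m * B ^ N))) := by
    have h1 := mul_le_mul_of_nonneg_left hfin hcpos.le
    have e1 : c * (m * (t * R.card * (N / c)) : ℝ) = R.card * (m * t * N) := by
      field_simp
    rw [e1] at h1
    refine h1.trans (le_of_eq ?_)
    ring
  exact le_of_mul_le_mul_left key hR0

end DrinfeldModule

end HeightInequality

/-! ### Elementary bounds for logarithms -/

section Logarithms

theorem le_two_rpow {y : ℝ} (hy : 0 ≤ y) : y ≤ (2 : ℝ) ^ y := by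
  have h1 := Nat.lt_floor_add_one y
  have h2 : ((⌊y⌋₊ + 1 : ℕ) : ℝ) ≤ ((2 ^ ⌊y⌋₊ : ℕ) : ℝ) := by exact_mod_cast Nat.lt_two_pow_self
  push_cast at h2
  have h3 : (2 : ℝ) ^ (⌊y⌋₊ : ℝ) ≤ (2 : ℝ) ^ y :=
    Real.rpow_le_rpow_of_exponent_le one_le_two (Nat.floor_le hy)
  rw [Real.rpow_natCast] at h3
  linarith

variable {b : ℝ} (hb : 2 ≤ b)
include hb

theorem logb_le_self {y : ℝ} (hy : 0 < y) : Real.logb b y ≤ y := by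
  rw [Real.logb_le_iff_le_rpow (by linarith) hy]
  exact (le_two_rpow hy.le).trans (Real.rpow_le_rpow zero_le_two hb hy.le)

theorem logb_sq_le {y : ℝ} (hy : 1 ≤ y) : Real.logb b y ^ 2 ≤ 4 * y := by
  have h0 : 0 ≤ Real.logb b y := Real.logb_nonneg (by linarith) hy
  have h1 : 0 < √y := Real.sqrt_pos.2 (by linarith)
  have h2 : Real.logb b y = 2 * Real.logb b √y := by
    conv_lhs => rw [← Real.sq_sqrt (show 0 ≤ y by linarith)]
    rw [Real.logb_pow]
    simp
  have h3 := logb_le_self hb h1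
  have h4 : Real.logb b y ≤ 2 * √y := by rw [h2]; linarith
  have h5 := Real.sq_sqrt (show 0 ≤ y by linarith)
  nlinarith

theorem logb_le_of_le_pow {y : ℝ} (hy : 0 < y) {n : ℕ} (h : y ≤ 2 ^ n) : Real.logb b y ≤ n := by
  rw [Real.logb_le_iff_le_rpow (by linarith) hy, Real.rpow_natCast]
  exact h.trans (pow_le_pow_left₀ zero_le_two hb n)

/-- With y = log D this expresses loglog₊ D through log₊ D, including D = 1, where y = 0 and its
logarithm has the default value 0. -/
theorem max_logb_logb {y : ℝ} (hy : 0 ≤ y) :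
    max (Real.logb b y) 1 = max (Real.logb b (max y 1)) 1 := by
  rcases le_total y 1 with h | h
  · have h1 : Real.logb b y ≤ 0 := Real.logb_nonpos (by linarith) hy h
    rw [max_eq_right h, Real.logb_one, max_eq_right (h1.trans zero_le_one),
      max_eq_right zero_le_one]
  · rw [max_eq_left h]

end Logarithms

/-! ### The parameters t, m and s -/

section Parameters

variable {α N : ℝ}

/-- The multiplicity at the conjugates. -/
def multParam (α N : ℝ) (s : ℕ) : ℕ := ⌈16 * α * s / N⌉₊ + 4

/-- The number of primes. -/
def primeParam (α N : ℝ) (s : ℕ) : ℕ := ⌈4 * α * s * multParam α N s / N⌉₊ + multParam α N s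

theorem multParam_mono (hα : 1 ≤ α) (hN : 0 < N) : Monotone (multParam α N) := by
  intro s s' h
  have h' : (s : ℝ) ≤ s' := by exact_mod_cast h
  refine Nat.add_le_add_right (Nat.ceil_mono ?_) _
  gcongr

theorem primeParam_mono (hα : 1 ≤ α) (hN : 0 < N) : Monotone (primeParam α N) := by
  intro s s' h
  have h' : (s : ℝ) ≤ s' := by exact_mod_cast h
  have h1 := multParam_mono hα hN h
  have h1' : (multParam α N s : ℝ) ≤ multParam α N s' := by exact_mod_cast h1
  refine Nat.add_le_add (Nat.ceil_mono ?_) h1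
  gcongr

theorem multParam_le (hα : 1 ≤ α) (hN : 0 < N) (s : ℕ) :
    (multParam α N s : ℝ) ≤ 16 * (α * s / N) + 5 := by
  have h := (Nat.ceil_lt_add_one (show 0 ≤ 16 * α * s / N by positivity)).le
  have e : 16 * (α * s / N) = 16 * α * s / N := by ring
  rw [multParam, e]
  push_cast
  linarith

theorem primeParam_le (hα : 1 ≤ α) (hN : 0 < N) (s : ℕ) :
    (primeParam α N s : ℝ) ≤ 4 * (α * s / N) * multParam α N s + 1 + multParam α N s := by
  have h := (Nat.ceil_lt_add_one (show 0 ≤ 4 * α * s * multParam α N s / N by positivity)).le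
  have e : 4 * (α * s / N) * multParam α N s = 4 * α * s * multParam α N s / N := by ring
  rw [primeParam, e]
  push_cast
  linarith

theorem le_multParam (hN : 0 < N) (s : ℕ) : 16 * α * s ≤ multParam α N s * N := by
  have h := Nat.le_ceil (16 * α * s / N)
  have h2 : 16 * α * s / N ≤ multParam α N s := by rw [multParam]; push_cast; linarith
  rwa [div_le_iff₀ hN] at h2

theorem four_le_multParam (s : ℕ) : 4 ≤ multParam α N s := Nat.le_add_left _ _

theorem le_primeParam (hN : 0 < N) (s : ℕ) :
    4 * α * s * multParam α N s ≤ primeParam α N s * N := by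
  have h := Nat.le_ceil (4 * α * s * multParam α N s / N)
  have h2 : 4 * α * s * multParam α N s / N ≤ primeParam α N s := by
    rw [primeParam]
    push_cast
    have : (0 : ℝ) ≤ multParam α N s := Nat.cast_nonneg _
    linarith
  rwa [div_le_iff₀ hN] at h2

theorem multParam_le_primeParam (s : ℕ) : multParam α N s ≤ primeParam α N s :=
  Nat.le_add_left _ _

theorem multParam_add_primeParam_le (hα : 1 ≤ α) (hN : 1 ≤ N) {s : ℕ} (hs : 1 ≤ s) :
    (multParam α N s + primeParam α N s : ℝ) ≤ 127 * α ^ 2 * (s : ℝ) ^ 2 := by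
  have hN0 : 0 < N := by linarith
  have hs' : (1 : ℝ) ≤ s := by exact_mod_cast hs
  have hY : α * s / N ≤ α * s := div_le_self (by positivity) hN
  have h0 : 0 ≤ α * s / N := by positivity
  have hY1 : 1 ≤ α * s := one_le_mul_of_one_le_of_one_le hα hs'
  have h1 := multParam_le hα hN0 s
  have h2 := primeParam_le hα hN0 s
  have e : 127 * α ^ 2 * (s : ℝ) ^ 2 = 127 * (α * s) ^ 2 := by ring
  rw [e]
  generalize α * s / N = Y' at *
  generalize α * (s : ℝ) = Y at *
  generalize (multParam α N s : ℝ) = t at *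
  have ht : t ≤ 21 * Y := by linarith
  have h3 : 4 * Y' * t ≤ 4 * Y * (21 * Y) := by
    calc 4 * Y' * t ≤ 4 * Y' * (21 * Y) := by gcongr
      _ ≤ _ := by gcongr
  nlinarith

/-- s is minimal with the first inequality; it exists because t + m grows only quadratically in s.
Failure at s - 1 and the monotonicity of t and m give the second inequality, so B^s exceeds the size
of the determinant by at most a factor B. -/
theorem exists_parameter (hα : 1 ≤ α) (hN : 1 ≤ N) {B D : ℕ} (hB : 2 ≤ B) (hD : 1 ≤ D) :
    ∃ s : ℕ, 1 ≤ s ∧ (multParam α N s + primeParam α N s) * D ≤ B ^ s ∧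
      B ^ s ≤ B * ((multParam α N s + primeParam α N s) * D) := by
  have hN0 : 0 < N := by linarith
  have hex : ∃ s, (multParam α N s + primeParam α N s) * D ≤ B ^ s := by
    have hB' : (1 : ℝ) < B := by exact_mod_cast hB
    have h1 := (tendsto_pow_const_div_const_pow_of_one_lt 2 hB').const_mul (127 * α ^ 2 * D)
    rw [mul_zero] at h1
    have h2 := (h1.eventually (eventually_lt_nhds zero_lt_one)).and (eventually_ge_atTop 1)
    obtain ⟨s, hs, hs1⟩ := h2.exists
    refine ⟨s, ?_⟩
    have hBs : (0 : ℝ) < (B : ℝ) ^ s := by positivity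
    have h3 : (multParam α N s + primeParam α N s : ℝ) * D ≤ (B : ℝ) ^ s := by
      calc (multParam α N s + primeParam α N s : ℝ) * D ≤ 127 * α ^ 2 * (s : ℝ) ^ 2 * D := by
            gcongr
            exact multParam_add_primeParam_le hα hN hs1
        _ = (127 * α ^ 2 * D * ((s : ℝ) ^ 2 / (B : ℝ) ^ s)) * (B : ℝ) ^ s := by field_simp
        _ ≤ 1 * (B : ℝ) ^ s := by gcongr
        _ = _ := one_mul _
    exact_mod_cast h3
  classical
  refine ⟨Nat.find hex, ?_, Nat.find_spec hex, ?_⟩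
  · by_contra h
    have h0 : Nat.find hex = 0 := by omega
    have h1 := Nat.find_spec hex
    rw [h0, pow_zero] at h1
    have h2 := four_le_multParam (α := α) (N := N) 0
    nlinarith
  · obtain ⟨k, hk⟩ : ∃ k, Nat.find hex = k + 1 := by
      refine Nat.exists_eq_succ_of_ne_zero fun h0 => ?_
      have h1 := Nat.find_spec hex
      rw [h0, pow_zero] at h1
      have h2 := four_le_multParam (α := α) (N := N) 0
      nlinarith
    have h1 := Nat.find_min hex (m := k) (by omega)
    rw [not_le] at h1
    rw [hk, pow_succ']
    refine Nat.mul_le_mul_left _ (h1.le.trans (Nat.mul_le_mul_right _ ?_))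
    exact Nat.add_le_add (multParam_mono hα hN0 (Nat.le_succ k))
      (primeParam_mono hα hN0 (Nat.le_succ k))

/-- The size of the parameter `s`. -/
theorem parameter_le (hα : 1 ≤ α) (hN : 1 ≤ N) {b d D s : ℕ} (hb : 2 ≤ b) (hd : 1 ≤ d)
    (hD : 1 ≤ D) (hs : 1 ≤ s)
    (h : (b ^ d) ^ s ≤ b ^ d * ((multParam α N s + primeParam α N s) * D)) :
    (s : ℝ) ≤ 30 * α * max (Real.logb b D) 1 := by
  have hb' : (2 : ℝ) ≤ b := by exact_mod_cast hb
  have hs' : (1 : ℝ) ≤ s := by exact_mod_cast hs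
  have hD' : (1 : ℝ) ≤ D := by exact_mod_cast hD
  obtain ⟨k, rfl⟩ : ∃ k, s = k + 1 := Nat.exists_eq_succ_of_ne_zero (by omega)
  rw [pow_succ'] at h
  have h1 := Nat.le_of_mul_le_mul_left h (pow_pos (by omega) d)
  have h2 : b ^ k ≤ (b ^ d) ^ k := by
    rw [← pow_mul]
    exact Nat.pow_le_pow_right (by omega) (Nat.le_mul_of_pos_left _ hd)
  have h3 : (b : ℝ) ^ k ≤ (multParam α N (k + 1) + primeParam α N (k + 1)) * D := by
    exact_mod_cast h2.trans h1
  have h4 := multParam_add_primeParam_le hα hN hs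
  have h5 : (b : ℝ) ^ k ≤ 127 * α ^ 2 * ((k + 1 : ℕ) : ℝ) ^ 2 * D := h3.trans (by gcongr)
  have h6 := Real.logb_le_logb_of_le (b := b) (by linarith) (by positivity) h5
  set S : ℝ := ((k + 1 : ℕ) : ℝ) with hS
  have hkS : (k : ℝ) = S - 1 := by rw [hS]; push_cast; ring
  rw [Real.logb_pow, Real.logb_self_eq_one (by linarith), Real.logb_mul (by positivity)
    (by positivity), Real.logb_mul (by positivity) (by positivity), Real.logb_mul (by positivity)
    (by positivity), Real.logb_pow, Real.logb_pow, hkS] at h6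
  have h7 : Real.logb b 127 ≤ (7 : ℕ) := logb_le_of_le_pow hb' (by norm_num) (by norm_num)
  have h8 := logb_le_self hb' (y := α) (by linarith)
  -- The slope 1/4 is small enough for the term 2 log S to be absorbed in S.
  have h9 : Real.logb b S ≤ 2 + S / 4 := by
    have e : S = 4 * (S / 4) := by ring
    conv_lhs => rw [e]
    rw [Real.logb_mul (by norm_num) (by positivity)]
    have h10 := logb_le_self hb' (y := S / 4) (by positivity)
    have h11 : Real.logb b 4 ≤ (2 : ℕ) := logb_le_of_le_pow hb' (by norm_num) (by norm_num)
    push_cast at h11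
    linarith
  have h12 := le_max_left (Real.logb b D) 1
  have h13 := le_max_right (Real.logb b D) 1
  set ℓ := max (Real.logb b D) 1
  push_cast at h6 h7
  nlinarith [mul_nonneg (sub_nonneg.2 hα) (sub_nonneg.2 h13)]

end Parameters

/-! ### The choice of N and the resulting lower bound -/

section Optimisation

variable {b : ℕ} (hb : 2 ≤ b)
include hb

/-- The choice of the degree `N` of the primes. -/
theorem exists_degree {r ρ ℓ₁ ℓ₂ : ℝ} (hr₀ : 0 < r) (hr₁ : r ≤ 1) (hρ : 3 ≤ ρ) (hbρ : b ≤ ρ)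
    (h1 : 1 ≤ ℓ₁) (h2 : 1 ≤ ℓ₂) (h12 : ℓ₂ ≤ ℓ₁) (hlog : Real.logb b ℓ₁ ≤ ℓ₂)
    (hlog' : ℓ₂ ≤ 2 * Real.logb b ℓ₁ - Real.logb b ℓ₂ + 1) {d : ℕ} {α : ℝ} (hα : 1 ≤ α) :
    ∃ N : ℕ, 3 * Real.logb b ρ / r ≤ N ∧ ℓ₂ / r ≤ N ∧
      ρ ^ 2 / 8 * (ℓ₁ / ℓ₂) ^ 2 ≤ 1 / (2 * r) * ((b : ℝ) ^ (r * N) / N) ∧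
      ((b : ℝ) ^ d) ^ N ≤ (b : ℝ) ^ d * (ρ ^ (3 * d / r) * (ℓ₁ ^ 2 / ℓ₂) ^ (d / r * α)) := by
  have hb' : (2 : ℝ) ≤ b := by exact_mod_cast hb
  have hb1 : (1 : ℝ) < b := by linarith
  have hb0 : (0 : ℝ) < b := by linarith
  have hℓ1 : 0 < ℓ₁ := by linarith
  have hℓ2 : 0 < ℓ₂ := by linarith
  have hρ0 : 0 < ρ := by linarith
  -- N is the ceiling of log X / r. Then b^{rN} ≥ X, and dividing by 2rN ≤ 8 ρ ℓ₂ leaves ρ²/8 ·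
  -- (ℓ₁/ℓ₂)², enough for m and the discarded primes. The factor ρ³ also forces N ≥ 3 log ρ / r.
  set X : ℝ := ρ ^ 3 * (ℓ₁ ^ 2 / ℓ₂) with hX
  have hX0 : 0 < X := by positivity
  have hlogX : Real.logb b X = 3 * Real.logb b ρ + (2 * Real.logb b ℓ₁ - Real.logb b ℓ₂) := by
    rw [hX, Real.logb_mul (by positivity) (by positivity), Real.logb_div (by positivity)
      (by positivity), Real.logb_pow, Real.logb_pow]
    push_cast
    ring
  have hlogρ1 : 1 ≤ Real.logb b ρ := by
    rw [Real.le_logb_iff_rpow_le hb1 hρ0, Real.rpow_one]; exact hbρ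
  have hlogρ2 : Real.logb b ρ ≤ ρ := logb_le_self hb' hρ0
  have hℓ1log : 0 ≤ Real.logb b ℓ₁ := Real.logb_nonneg hb1 h1
  have hℓ2log : 0 ≤ Real.logb b ℓ₂ := Real.logb_nonneg hb1 h2
  have hmono : Real.logb b ℓ₂ ≤ Real.logb b ℓ₁ := Real.logb_le_logb_of_le hb1 hℓ2 h12
  set Λ := Real.logb b X with hΛ
  have hΛ0 : 0 < Λ := by linarith
  have hceil := Nat.le_ceil (Λ / r)
  have hceil2 := (Nat.ceil_lt_add_one (show 0 ≤ Λ / r by positivity)).le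
  set N := ⌈Λ / r⌉₊ with hN
  have hN0 : (0 : ℝ) < N := lt_of_lt_of_le (by positivity) hceil
  have hrN : Λ ≤ r * N := by rw [div_le_iff₀ hr₀] at hceil; linarith
  have hrN2 : r * N ≤ Λ + r := by
    have := mul_le_mul_of_nonneg_left hceil2 hr₀.le
    rw [mul_add, mul_div_cancel₀ _ hr₀.ne', mul_one] at this
    exact this
  have hbΛ : (b : ℝ) ^ Λ = X := Real.rpow_logb hb0 hb1.ne' hX0
  refine ⟨N, ?_, ?_, ?_, ?_⟩
  · refine le_trans ?_ hceil
    gcongr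
    linarith
  · refine le_trans ?_ hceil
    gcongr
    linarith
  · have hXle : X ≤ (b : ℝ) ^ (r * N) := by
      rw [← hbΛ]; exact Real.rpow_le_rpow_of_exponent_le hb1.le hrN
    have h4 : r * N ≤ 4 * ρ * ℓ₂ := by
      have : r * N ≤ 3 * ρ + 2 * ℓ₂ + 1 := by linarith
      nlinarith [mul_nonneg (sub_nonneg.2 h2) (sub_nonneg.2 hρ)]
    have e : 1 / (2 * r) * ((b : ℝ) ^ (r * N) / N) = (b : ℝ) ^ (r * N) / (2 * (r * N)) := by
      field_simp
    rw [e]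
    calc ρ ^ 2 / 8 * (ℓ₁ / ℓ₂) ^ 2 = X / (2 * (4 * ρ * ℓ₂)) := by
          rw [hX]; field_simp; ring
      _ ≤ (b : ℝ) ^ (r * N) / (2 * (r * N)) := by gcongr
  · have hq1 : 1 ≤ ℓ₁ ^ 2 / ℓ₂ := by
      rw [one_le_div hℓ2]; nlinarith
    have e1 : ((b : ℝ) ^ d) ^ N = (b : ℝ) ^ ((d : ℝ) * N) := by
      rw [← pow_mul, ← Real.rpow_natCast]; push_cast; rfl
    have e2 : (d : ℝ) * N ≤ d + Λ * (d / r) := by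
      have : (d : ℝ) * N ≤ d * (Λ / r + 1) := by gcongr
      refine this.trans (le_of_eq ?_)
      ring
    have e3 : X ^ ((d : ℝ) / r) ≤ ρ ^ (3 * d / r) * (ℓ₁ ^ 2 / ℓ₂) ^ (d / r * α) := by
      rw [hX, Real.mul_rpow (by positivity) (by positivity), ← Real.rpow_natCast ρ 3,
        ← Real.rpow_mul hρ0.le]
      have e4 : ((3 : ℕ) : ℝ) * (d / r) = 3 * d / r := by push_cast; ring
      rw [e4]
      refine mul_le_mul_of_nonneg_left (Real.rpow_le_rpow_of_exponent_le hq1 ?_) (by positivity)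
      -- The natural exponent d/r is weakened to dα/r, the one in the theorem.
      exact le_mul_of_one_le_right (by positivity) hα
    calc ((b : ℝ) ^ d) ^ N ≤ (b : ℝ) ^ (d + Λ * (d / r)) := by
          rw [e1]; exact Real.rpow_le_rpow_of_exponent_le hb1.le e2
      _ = (b : ℝ) ^ d * X ^ ((d : ℝ) / r) := by
          rw [Real.rpow_add hb0, Real.rpow_natCast, Real.rpow_mul hb0.le, hbΛ]
      _ ≤ _ := by gcongr

theorem natLog_two_le {D : ℕ} (hD : 1 ≤ D) :
    (Nat.log 2 D : ℝ) ≤ b * max (Real.logb b D) 1 := by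
  have hb1 : (1 : ℝ) < b := by exact_mod_cast hb
  have hb0 : (0 : ℝ) < b := by linarith
  have e1 : (2 : ℝ) ^ (Nat.log 2 D) ≤ D := by exact_mod_cast Nat.pow_log_le_self 2 (by omega)
  have e2 := Real.logb_le_logb_of_le hb1 (by positivity) e1
  rw [Real.logb_pow] at e2
  have e3 : 1 ≤ b * Real.logb b 2 := by
    have e4 := logb_le_self (b := 2) le_rfl hb0
    have e5 : Real.logb b 2 * Real.logb 2 b = 1 := by
      rw [Real.logb, Real.logb]
      have : Real.log 2 ≠ 0 := (Real.log_pos one_lt_two).ne'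
      have : Real.log b ≠ 0 := (Real.log_pos hb1).ne'
      field_simp
    have e6 : 0 ≤ Real.logb b 2 := Real.logb_nonneg hb1 one_le_two
    nlinarith
  have e7 := le_max_left (Real.logb b D) 1
  calc (Nat.log 2 D : ℝ) ≤ Nat.log 2 D * (b * Real.logb b 2) :=
        le_mul_of_one_le_right (Nat.cast_nonneg _) e3
    _ = b * (Nat.log 2 D * Real.logb b 2) := by ring
    _ ≤ b * max (Real.logb b D) 1 := by gcongr; linarith

omit hb in
theorem primeParam_le_sq {α N : ℝ} {s : ℕ} (hα : 1 ≤ α) (hN : 0 < N) {Y : ℝ} (hY30 : 30 ≤ Y)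
    (hY : α * s / N ≤ Y) : (primeParam α N s : ℝ) ≤ 70 * Y ^ 2 := by
  have ht1 := multParam_le hα hN s
  have hm1 := primeParam_le hα hN s
  have hY0 : 0 ≤ α * s / N := by positivity
  have ht17 : (multParam α N s : ℝ) ≤ 17 * Y := by linarith
  have h3 : 4 * (α * s / N) * multParam α N s ≤ 4 * Y * (17 * Y) := by gcongr
  have h4 : 30 * Y ≤ Y * Y := by gcongr
  have e : 70 * Y ^ 2 = 4 * Y * (17 * Y) + 2 * (Y * Y) := by ring
  rw [e]
  linarith

/-- This is where the size of ρ is needed: m together with the discarded primes must not exceed the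
supply of RV primes. The bound for m is 70 (30 α² ℓ₁/ℓ₂)² = 63000 α⁴ (ℓ₁/ℓ₂)², well below ρ²/8 ·
(ℓ₁/ℓ₂)². -/
theorem primeParam_add_le {α N ρ ℓ₁ ℓ₂ : ℝ} {s : ℕ} (hα : 1 ≤ α) (hN : ℓ₂ ≤ N) (h2 : 1 ≤ ℓ₂)
    (h12 : ℓ₂ ≤ ℓ₁) (h2sq : ℓ₂ ^ 2 ≤ 4 * ℓ₁) (hs : (s : ℝ) ≤ 30 * α * ℓ₁)
    (hρ : 6500 * α ^ 3 * b ≤ ρ) :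
    (primeParam α N s : ℝ) + b * ℓ₁ ≤ ρ ^ 2 / 8 * (ℓ₁ / ℓ₂) ^ 2 := by
  have hb' : (2 : ℝ) ≤ b := by exact_mod_cast hb
  have hN0 : 0 < N := by linarith
  have hℓ2 : 0 < ℓ₂ := by linarith
  have hℓ1 : 0 < ℓ₁ := by linarith
  have hZ1 : 1 ≤ ℓ₁ / ℓ₂ := by rw [one_le_div hℓ2]; exact h12
  have hY : α * s / N ≤ 30 * α ^ 2 * (ℓ₁ / ℓ₂) := by
    calc α * s / N ≤ α * (30 * α * ℓ₁) / ℓ₂ := by gcongr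
      _ = _ := by ring
  have hα2 : 1 ≤ α ^ 2 := one_le_pow₀ hα
  have hm := primeParam_le_sq hα hN0 (Y := 30 * α ^ 2 * (ℓ₁ / ℓ₂)) (by
    have := one_le_mul_of_one_le_of_one_le hα2 hZ1
    linarith) hY
  have hlog : (b : ℝ) * ℓ₁ ≤ 4 * b * (ℓ₁ / ℓ₂) ^ 2 := by
    have : ℓ₁ ≤ 4 * (ℓ₁ / ℓ₂) ^ 2 := by
      rw [div_pow, mul_div_assoc', le_div_iff₀ (by positivity)]
      have := mul_le_mul_of_nonneg_left h2sq hℓ1.le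
      linarith
    have := mul_le_mul_of_nonneg_left this (show (0 : ℝ) ≤ b by linarith)
    linarith
  have hconst : 63000 * α ^ 4 + 4 * b ≤ ρ ^ 2 / 8 := by
    have e1 : (6500 * α ^ 3 * b) ^ 2 ≤ ρ ^ 2 := by gcongr
    have e2 : α ^ 4 ≤ α ^ 6 := pow_le_pow_right₀ hα (by norm_num)
    have e3 : (b : ℝ) ≤ b ^ 2 := by nlinarith
    have e4 : (1 : ℝ) ≤ α ^ 6 := one_le_pow₀ hα
    have e5 : α ^ 6 ≤ α ^ 6 * b ^ 2 := le_mul_of_one_le_right (by positivity) (by nlinarith)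
    have e6 : (b : ℝ) ^ 2 ≤ α ^ 6 * b ^ 2 := le_mul_of_one_le_left (by positivity) e4
    have e7 : (6500 * α ^ 3 * b) ^ 2 = 42250000 * (α ^ 6 * b ^ 2) := by ring
    rw [e7] at e1
    linarith
  have h1 := mul_le_mul_of_nonneg_right hconst (sq_nonneg (ℓ₁ / ℓ₂))
  have e : 70 * (30 * α ^ 2 * (ℓ₁ / ℓ₂)) ^ 2 = 63000 * α ^ 4 * (ℓ₁ / ℓ₂) ^ 2 := by ring
  rw [e] at hm
  linarith

-- The choices of t and m make each of αst², 4αsm and 4αst at most a quarter of mtN; the last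
-- quarter is left for the height term.
omit hb in
theorem mul_le_of_inequality {α s t m N c B D Bs BN h : ℝ} (ht4 : 4 ≤ t)
    (htm : t ≤ m) (hN : 0 < N) (hc : 0 ≤ c) (hB : 0 ≤ B) (hD : 0 ≤ D) (hBN : 1 ≤ BN)
    (hh : 0 ≤ h) (ht2 : 16 * α * s ≤ t * N) (hm2 : 4 * α * s * t ≤ m * N)
    (hBs : Bs ≤ B * ((t + m) * D))
    (hI : m * t * N ≤ α * s * (t ^ 2 + 4 * (t + m)) + c * (Bs * h * (t + m * BN))) :
    t * N ≤ 16 * c * B * m * D * BN * h := by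
  have ht0 : 0 < t := by linarith
  have hm0 : 0 < m := by linarith
  have a1 : α * s * t ^ 2 ≤ m * t * N / 4 := by
    have := mul_le_mul_of_nonneg_right hm2 ht0.le
    linarith
  have a2 : 4 * (α * s * m) ≤ m * t * N / 4 := by
    have := mul_le_mul_of_nonneg_right ht2 hm0.le
    linarith
  have a3 : 4 * (α * s * t) ≤ m * t * N / 4 := by
    have := mul_le_mul_of_nonneg_right ht4 (mul_pos hm0 hN).le
    linarith
  have a4 : (m * t * N : ℝ) / 4 ≤ c * (Bs * h * (t + m * BN)) := by linarith
  have a5 : t + m * BN ≤ 2 * m * BN := by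
    have := mul_le_mul_of_nonneg_left hBN hm0.le
    linarith
  have a6 : Bs ≤ B * (2 * m * D) := by
    refine hBs.trans ?_
    gcongr
    linarith
  have a7 : (m * t * N : ℝ) / 4 ≤ c * (B * (2 * m * D) * h * (2 * m * BN)) := by
    refine a4.trans ?_
    gcongr
  have a8 : m * (t * N) ≤ m * (16 * c * B * m * D * BN * h) := by
    have e : c * (B * (2 * m * D) * h * (2 * m * BN)) * 4 =
      m * (16 * c * B * m * D * BN * h) := by ring
    rw [← e]
    linarith
  exact le_of_mul_le_mul_left a8 hm0

-- Since m ≤ t (4αs/N + 2), the factor t cancels. Inserting s ≤ 30 α ℓ₁ and 1/N ≤ r/ℓ₂ gives the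
-- constant 122 = 4 · 30 + 2.
omit hb in
theorem sq_le_of_mul_le {α s t m N r ℓ₁ ℓ₂ A h : ℝ} (hα : 1 ≤ α) (hs0 : 0 ≤ s) (ht4 : 4 ≤ t)
    (hN : 0 < N) (hr₀ : 0 < r) (hr₁ : r ≤ 1) (hA : 0 ≤ A) (hh : 0 ≤ h)
    (h2 : 1 ≤ ℓ₂) (h12 : ℓ₂ ≤ ℓ₁) (hN2 : ℓ₂ / r ≤ N) (hs : s ≤ 30 * α * ℓ₁)
    (hm : m ≤ 4 * (α * s / N) * t + 1 + t) (hstep : t * N ≤ A * m * h) :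
    ℓ₂ ^ 2 ≤ A * (122 * α ^ 2 * r * ℓ₁) * h := by
  have ht0 : 0 < t := by linarith
  have hℓ2 : 0 < ℓ₂ := by linarith
  have hℓ1 : 0 < ℓ₁ := by linarith
  have a1 : m ≤ t * (4 * (α * s / N) + 2) := by linarith
  have a2 : N ≤ A * (4 * (α * s / N) + 2) * h := by
    have : t * N ≤ t * (A * (4 * (α * s / N) + 2) * h) := by
      refine hstep.trans ?_
      have e : t * (A * (4 * (α * s / N) + 2) * h) = A * (t * (4 * (α * s / N) + 2)) * h := by ring
      rw [e]
      gcongr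
    exact le_of_mul_le_mul_left this ht0
  have a3 : N⁻¹ ≤ r / ℓ₂ := by
    rw [inv_le_comm₀ hN (by positivity), inv_div]
    exact hN2
  have a4 : (4 * (α * s / N) + 2) / N ≤ 122 * α ^ 2 * r * ℓ₁ / ℓ₂ ^ 2 := by
    have e1 : (4 * (α * s / N) + 2) / N = 4 * α * s * N⁻¹ * N⁻¹ + 2 * N⁻¹ := by
      field_simp
    rw [e1]
    calc 4 * α * s * N⁻¹ * N⁻¹ + 2 * N⁻¹
        ≤ 4 * α * (30 * α * ℓ₁) * (r / ℓ₂) * (r / ℓ₂) + 2 * (r / ℓ₂) := by gcongr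
      _ = (120 * α ^ 2 * ℓ₁ * r ^ 2 + 2 * r * ℓ₂) / ℓ₂ ^ 2 := by field_simp; ring
      _ ≤ _ := by
        gcongr
        have b1 : r ^ 2 ≤ r := by nlinarith
        have b2 : 120 * α ^ 2 * ℓ₁ * r ^ 2 ≤ 120 * α ^ 2 * ℓ₁ * r := by gcongr
        have b3 : r * ℓ₂ ≤ α ^ 2 * r * ℓ₁ := by
          have : 1 ≤ α ^ 2 := one_le_pow₀ hα
          calc r * ℓ₂ ≤ r * ℓ₁ := by gcongr
            _ ≤ α ^ 2 * (r * ℓ₁) := le_mul_of_one_le_left (by positivity) this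
            _ = _ := by ring
        linarith
  have a5 : 1 ≤ A * h * ((4 * (α * s / N) + 2) / N) := by
    have : N / N ≤ A * (4 * (α * s / N) + 2) * h / N := by gcongr
    rw [div_self hN.ne'] at this
    refine this.trans (le_of_eq ?_)
    ring
  have a6 : 1 ≤ A * h * (122 * α ^ 2 * r * ℓ₁ / ℓ₂ ^ 2) := by
    refine a5.trans ?_
    gcongr
  have hℓsq : 0 < ℓ₂ ^ 2 := by positivity
  rw [mul_div_assoc', le_div_iff₀ hℓsq, one_mul] at a6
  refine a6.trans (le_of_eq ?_)
  ring

/-- The lower bound for the height, deduced from the inequality of the interpolation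
determinant by an optimal choice of the parameters. -/
theorem lower_bound_of_inequality {d D : ℕ} (hd : 1 ≤ d) (hD : 1 ≤ D) {α c r ρ h : ℝ}
    (hα : 1 ≤ α) (hc : 1 ≤ c) (hr₀ : 0 < r) (hr₁ : r ≤ 1) (hρ : 6500 * α ^ 3 * b ≤ ρ)
    (count : ℕ → ℕ)
    (hcount : ∀ N : ℕ, 3 * Real.logb b ρ / r ≤ N →
      1 / (2 * r) * ((b : ℝ) ^ (r * N) / N) ≤ count N)
    (hineq : ∀ N t m s : ℕ, m + Nat.log 2 D ≤ count N → (t + m) * D ≤ (b ^ d) ^ s →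
      (m * t * N : ℝ) ≤ α * s * (t ^ 2 + 4 * (t + m)) +
        c * (((b : ℝ) ^ d) ^ s * h * (t + m * ((b : ℝ) ^ d) ^ N)))
    (hh : 0 ≤ h) :
    1 / (1952 * α ^ 2 * r * c * ((b : ℝ) ^ d) ^ 2 * ρ ^ (3 * d / r)) *
      (max (Real.logb b (Real.logb b D)) 1 ^ (2 + d / r * α) /
        (D * max (Real.logb b D) 1 ^ (1 + 2 * d / r * α))) ≤ h := by
  have hb' : (2 : ℝ) ≤ b := by exact_mod_cast hb
  have hb1 : (1 : ℝ) < b := by linarith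
  have hb0 : (0 : ℝ) < b := by linarith
  have hD' : (1 : ℝ) ≤ D := by exact_mod_cast hD
  have hlogD : 0 ≤ Real.logb b D := Real.logb_nonneg hb1 hD'
  rw [max_logb_logb hb' hlogD]
  have hparam := fun (N : ℝ) (hN : 1 ≤ N) (s : ℕ) => parameter_le hα hN hb hd hD (s := s)
  have hD2 := natLog_two_le hb hD
  set ℓ₁ := max (Real.logb b D) 1 with hℓ₁
  have h1 : 1 ≤ ℓ₁ := le_max_right _ _
  have hsq := logb_sq_le hb' h1
  have hself := logb_le_self hb' (y := ℓ₁) (by linarith)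
  have hℓ1log : 0 ≤ Real.logb b ℓ₁ := Real.logb_nonneg hb1 h1
  set ℓ₂ := max (Real.logb b ℓ₁) 1 with hℓ₂
  have h2 : 1 ≤ ℓ₂ := le_max_right _ _
  have h12 : ℓ₂ ≤ ℓ₁ := max_le hself h1
  have h2sq : ℓ₂ ^ 2 ≤ 4 * ℓ₁ := by
    rcases max_choice (Real.logb b ℓ₁) 1 with h | h
    · rw [hℓ₂, h]; exact hsq
    · rw [hℓ₂, h]; linarith
  have hlog : Real.logb b ℓ₁ ≤ ℓ₂ := le_max_left _ _
  have hlog' : ℓ₂ ≤ 2 * Real.logb b ℓ₁ - Real.logb b ℓ₂ + 1 := by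
    rcases max_choice (Real.logb b ℓ₁) 1 with h | h
    · have := logb_le_self hb' (y := ℓ₂) (by linarith)
      rw [← hℓ₂] at h
      linarith
    · rw [← hℓ₂] at h
      rw [h, Real.logb_one]
      linarith
  have hα3 : 1 ≤ α ^ 3 := one_le_pow₀ hα
  have hbρ : (b : ℝ) ≤ ρ := by
    refine le_trans ?_ hρ
    nlinarith
  have hρ3 : 3 ≤ ρ := by
    refine le_trans ?_ hρ
    nlinarith
  have hρ0 : 0 < ρ := by linarith
  obtain ⟨N, hN1, hN2, hN3, hN4⟩ := exists_degree hb hr₀ hr₁ hρ3 hbρ h1 h2 h12 hlog hlog'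
    (d := d) hα
  have hNℓ : ℓ₂ ≤ N := by
    refine le_trans ?_ hN2
    rw [le_div_iff₀ hr₀]
    nlinarith
  have hN : (1 : ℝ) ≤ N := h2.trans hNℓ
  have hN0 : (0 : ℝ) < N := by linarith
  obtain ⟨s, hs1, hs2, hs3⟩ := exists_parameter hα hN (B := b ^ d) (D := D)
    (hb.trans (Nat.le_self_pow (by omega) b)) hD
  have hs := hparam N hN s hs1 hs3
  have hm1 := primeParam_le hα hN0 s
  have ht2 := le_multParam (α := α) hN0 s
  have hm2 := le_primeParam (α := α) hN0 s
  have ht4 : (4 : ℝ) ≤ multParam α N s := by exact_mod_cast four_le_multParam s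
  have htm : (multParam α N s : ℝ) ≤ primeParam α N s := by
    exact_mod_cast multParam_le_primeParam s
  have hadd := primeParam_add_le hb hα hNℓ h2 h12 h2sq hs hρ
  set t := multParam α N s with ht
  set m := primeParam α N s with hm
  have hcountN : m + Nat.log 2 D ≤ count N := by
    have hfin : (m + Nat.log 2 D : ℝ) ≤ count N :=
      le_trans (by linarith) (hN3.trans (hcount N hN1))
    exact_mod_cast hfin
  have hI := hineq N t m s hcountN hs2
  have hs3' : ((b : ℝ) ^ d) ^ s ≤ (b : ℝ) ^ d * ((t + m) * D) := by exact_mod_cast hs3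
  set B := (b : ℝ) ^ d with hB
  have hB0 : 0 < B := by positivity
  have hB1 : 1 ≤ B := one_le_pow₀ hb1.le
  have hBN : 1 ≤ B ^ N := one_le_pow₀ hB1
  have hstep1 := mul_le_of_inequality ht4 htm hN0 (by linarith) hB0.le (by linarith) hBN hh ht2 hm2
    hs3' hI
  have hstep2 := sq_le_of_mul_le (A := 16 * c * B * D * B ^ N) hα (Nat.cast_nonneg s) ht4 hN0 hr₀ hr₁
    (by positivity) hh h2 h12 hN2 hs hm1 (hstep1.trans (le_of_eq (by ring)))
  have hℓ10 : 0 < ℓ₁ := by linarith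
  have hℓ20 : 0 < ℓ₂ := by linarith
  set e := (d : ℝ) / r * α with he
  have e1 : (1 + 2 * d / r * α : ℝ) = 1 + 2 * e := by rw [he]; ring
  have e2 : ℓ₂ ^ (2 + e) = ℓ₂ ^ 2 * ℓ₂ ^ e := by
    rw [Real.rpow_add hℓ20, Real.rpow_two]
  have e3 : ℓ₁ ^ (1 + 2 * e) = ℓ₁ * (ℓ₁ ^ 2) ^ e := by
    rw [Real.rpow_add hℓ10, Real.rpow_one, Real.rpow_mul hℓ10.le, Real.rpow_two]
  have e4 : (ℓ₁ ^ 2 / ℓ₂) ^ e = (ℓ₁ ^ 2) ^ e / ℓ₂ ^ e := Real.div_rpow (by positivity) hℓ20.le _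
  rw [e1, e2, e3]
  rw [e4] at hN4
  set p := (ℓ₁ ^ 2) ^ e with hp
  set p' := ℓ₂ ^ e with hp'
  have hp0 : 0 < p := by positivity
  have hp'0 : 0 < p' := by positivity
  set w := ρ ^ (3 * d / r) with hw
  have hw0 : 0 < w := by positivity
  -- The constant 1952 of the statement is 16 · 122.
  have hstep3 : ℓ₂ ^ 2 ≤ 16 * c * B * D * (B * (w * (p / p'))) * (122 * α ^ 2 * r * ℓ₁) * h := by
    refine hstep2.trans ?_
    gcongr
  rw [one_div_mul_eq_div, div_div, div_le_iff₀ (by positivity)]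
  refine (mul_le_mul_of_nonneg_right hstep3 hp'0.le).trans (le_of_eq ?_)
  field_simp
  ring

end Optimisation

/-! ### Comparison with the constant `C₀`, and the theorem -/

section Conclusion

set_option linter.unusedSectionVars false

variable {F : Type*} [Field F] [Fintype F] {d : ℕ} (Φ : DrinfeldModule F d)

namespace DrinfeldModule

theorem one_le_fieldDegree : (1 : ℝ) ≤ Φ.fieldDegree := by
  have := Φ.finiteDimensional_coeffField
  exact_mod_cast Module.finrank_pos (R := RatFunc F) (M := Φ.coeffField)

theorem fieldDegree_le_alpha : (Φ.fieldDegree : ℝ) ≤ Φ.alpha :=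
  le_mul_of_one_le_left (by positivity) Φ.one_le_height

theorem one_le_alpha : 1 ≤ Φ.alpha := Φ.one_le_fieldDegree.trans Φ.fieldDegree_le_alpha

theorem le_c0 {r : ℝ} (hr₀ : 0 < r) : 6500 * Φ.alpha ^ 3 * (q F : ℝ) ^ d ≤ Φ.c0 r := by
  have hq := one_lt_q_real (F := F)
  have hd : (1 : ℝ) ≤ d := by exact_mod_cast Φ.rank_pos
  have hα := Φ.one_le_alpha
  have h1 : (q F : ℝ) ^ d ≤ (q F : ℝ) ^ (d + r * Φ.alpha) := by
    rw [← Real.rpow_natCast]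
    exact Real.rpow_le_rpow_of_exponent_le hq.le (le_add_of_nonneg_right (by positivity))
  have e : Φ.c0 r = d * (6500 * Φ.alpha ^ 3 * (q F : ℝ) ^ (d + r * Φ.alpha)) := by
    rw [c0, show Φ.alpha ^ 3 = Φ.height ^ 3 * (Φ.fieldDegree : ℝ) ^ 3 from mul_pow _ _ _]
    ring
  rw [e]
  calc 6500 * Φ.alpha ^ 3 * (q F : ℝ) ^ d
      ≤ 6500 * Φ.alpha ^ 3 * (q F : ℝ) ^ (d + r * Φ.alpha) := by gcongr
    _ ≤ _ := le_mul_of_one_le_left (by positivity) hd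

theorem one_le_degree (x : Bar F) : 1 ≤ degree x := by
  have : FiniteDimensional (RatFunc F) (RatFunc F)⟮x⟯ :=
    IntermediateField.adjoin.finiteDimensional (Algebra.IsIntegral.isIntegral x)
  exact Module.finrank_pos (R := RatFunc F) (M := (RatFunc F)⟮x⟯)

theorem bound_nonneg (r : ℝ) (D : ℕ) : 0 ≤ Φ.bound r D := by
  have h1 : 0 ≤ logLogPlus F D := zero_le_one.trans (le_max_right _ _)
  have h2 : 0 ≤ logPlus F D := zero_le_one.trans (le_max_right _ _)
  rw [bound]
  positivity

/-- The constant of the lower bound, for a parameter `ρ ≥ c₀`. -/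
def lowerConst (r ρ : ℝ) : ℝ :=
  1 / (1952 * Φ.alpha ^ 2 * r * Φ.fieldDegree * ((q F : ℝ) ^ d) ^ 2 * ρ ^ (3 * d / r))

theorem lowerConst_mul_bound_le {r ρ : ℝ} (hr₀ : 0 < r) (hr₁ : r ≤ 1) (hρ : Φ.c0 r ≤ ρ)
    (hcount : ∀ N : ℕ, 3 * Real.logb (q F) ρ / r ≤ N →
      1 / (2 * r) * ((q F : ℝ) ^ (r * N) / N) ≤ Φ.countRV N)
    {x : Bar F} (hx : ¬ Φ.IsTorsion x) (hsep : IsSeparable (RatFunc F) x) :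
    Φ.lowerConst r ρ * Φ.bound r (degree x) ≤ Φ.canonicalHeight x := by
  have hα := Φ.one_le_alpha
  have hq := one_lt_q_real (F := F)
  have hρ' : 6500 * Φ.alpha ^ 3 * (q F : ℝ) ≤ ρ := by
    refine le_trans ?_ ((Φ.le_c0 hr₀).trans hρ)
    gcongr
    exact le_self_pow₀ hq.le Φ.rank_pos.ne'
  exact lower_bound_of_inequality one_lt_card_q Φ.rank_pos (one_le_degree x) hα
    Φ.one_le_fieldDegree hr₀ hr₁ hρ' Φ.countRV hcount
    (fun N t m s h1 h2 => Φ.height_inequality hx hsep N t m s h1 h2) (Φ.canonicalHeight_nonneg x)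

theorem one_lt_c0 {r : ℝ} (hr₀ : 0 < r) : 1 < Φ.c0 r := by
  refine lt_of_lt_of_le ?_ (Φ.le_c0 hr₀)
  have h1 : 1 ≤ Φ.alpha ^ 3 := one_le_pow₀ Φ.one_le_alpha
  have h2 := Φ.two_le_q_pow
  nlinarith

theorem lowerConst_pos {r ρ : ℝ} (hr₀ : 0 < r) (hρ : 0 < ρ) : 0 < Φ.lowerConst r ρ := by
  have hα := Φ.one_le_alpha
  have hc := Φ.one_le_fieldDegree
  have hq := one_lt_q_real (F := F)
  rw [lowerConst]
  positivity

theorem bigC0_pos {r : ℝ} (hr₀ : 0 < r) : 0 < Φ.bigC0 r := by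
  have hα := Φ.one_le_alpha
  have hq := one_lt_q_real (F := F)
  have hc := Φ.one_lt_c0 hr₀
  exact lt_min (by positivity) (by positivity)

/-- The second entry of the minimum suffices. Since α ≥ 1 and d/r ≥ 1, the exponent 1 + 4dα/r
exceeds 3d/r by at least 2, and c₀² ≥ 3 α⁴ q^d pays for the remaining factors, as 1952 ≤ 3 · 768. -/
theorem bigC0_le_lowerConst {r : ℝ} (hr₀ : 0 < r) (hr₁ : r ≤ 1) :
    Φ.bigC0 r ≤ Φ.lowerConst r (Φ.c0 r) := by
  refine (min_le_right _ _).trans ?_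
  have hα := Φ.one_le_alpha
  have hcα := Φ.fieldDegree_le_alpha
  have hc1 := Φ.one_le_fieldDegree
  have hB := Φ.two_le_q_pow
  have hc0 := Φ.one_lt_c0 hr₀
  have hle := Φ.le_c0 hr₀
  have hd : (1 : ℝ) ≤ d := by exact_mod_cast Φ.rank_pos
  rw [lowerConst]
  generalize Φ.alpha = α at *
  generalize (Φ.fieldDegree : ℝ) = c at *
  generalize Φ.c0 r = κ at *
  generalize (q F : ℝ) ^ d = B at *
  have hκ0 : 0 < κ := by linarith
  have hdr : 1 ≤ d / r := by rw [one_le_div hr₀]; linarith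
  have hpow : κ ^ (3 * d / r) * κ ^ 2 ≤ κ ^ (1 + 4 * d / r * α) := by
    rw [← Real.rpow_natCast κ 2, ← Real.rpow_add hκ0]
    refine Real.rpow_le_rpow_of_exponent_le hc0.le ?_
    have e1 : 3 * d / r = 3 * (d / r) := by ring
    have e2 : 4 * d / r * α = 4 * (d / r) * α := by ring
    rw [e1, e2]
    have : 4 * (d / r) * 1 ≤ 4 * (d / r) * α := by gcongr
    push_cast
    linarith
  have hκ2 : 3 * α ^ 4 * B ≤ κ ^ 2 := by
    have h1 : (6500 * α ^ 3 * B) ^ 2 ≤ κ ^ 2 := by gcongr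
    refine le_trans ?_ h1
    have e2 : α ^ 4 ≤ α ^ 6 := pow_le_pow_right₀ hα (by norm_num)
    calc 3 * α ^ 4 * B ≤ 42250000 * α ^ 6 * B ^ 2 := by
          gcongr
          · norm_num
          · exact le_self_pow₀ (by linarith) two_ne_zero
      _ = _ := by ring
  set w := κ ^ (3 * d / r) with hw
  have hw0 : 0 < w := by positivity
  have hfin : 3 * α ^ 4 * B * w ≤ κ ^ (1 + 4 * d / r * α) := by
    refine le_trans ?_ hpow
    rw [mul_comm w]
    gcongr
  have hB0 : 0 < B := by linarith
  have hα0 : 0 < α := by linarith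
  rw [div_le_div_iff₀ (by positivity) (by positivity), one_mul]
  calc α * (1952 * α ^ 2 * r * c * B ^ 2 * w) ≤ α * (1952 * α ^ 2 * r * α * B ^ 2 * w) := by gcongr
    _ ≤ 768 * r * B * (3 * α ^ 4 * B * w) := by
      have : 0 ≤ r * B ^ 2 * α ^ 4 * w := by positivity
      linarith
    _ ≤ _ := by gcongr

end DrinfeldModule

end Conclusion

end DrinfeldLehmer

end

open DrinfeldLehmer in
theorem mainTheorem1 {F : Type*} [Field F] [Fintype F] {d : ℕ} (Φ : DrinfeldModule F d)
    (r : ℝ) (hr₀ : 0 < r) (hr₁ : r ≤ 1) :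
    (∀ x : Bar F, Tendsto (Φ.heightSeq x) atTop (𝓝 (Φ.canonicalHeight x))) ∧
    (Φ.IsRV r → ∀ x : Bar F, ¬ Φ.IsTorsion x → IsSeparable (RatFunc F) x →
      Φ.canonicalHeight x ≥ Φ.bigC0 r * Φ.bound r (degree x)) ∧
    (Φ.IsRVStar r → ∃ C : ℝ, 0 < C ∧ C ≤ Φ.bigC0 r ∧
      ∀ x : Bar F, ¬ Φ.IsTorsion x → IsSeparable (RatFunc F) x →
        Φ.canonicalHeight x ≥ C * Φ.bound r (degree x)) := by
  have hq := one_lt_q_real (F := F)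
  refine ⟨Φ.tendsto_heightSeq, fun hRV x hx hsep => ?_, fun hRV => ?_⟩
  · refine le_trans (mul_le_mul_of_nonneg_right (Φ.bigC0_le_lowerConst hr₀ hr₁)
      (Φ.bound_nonneg r _)) (Φ.lowerConst_mul_bound_le hr₀ hr₁ le_rfl (fun N hN => ?_) hx hsep)
    have h1 : 0 < 3 * Real.logb (q F) (Φ.c0 r) / r := by
      have := Real.logb_pos hq (Φ.one_lt_c0 hr₀)
      positivity
    have h2 : (0 : ℝ) < N := h1.trans_le hN
    exact hRV N (by exact_mod_cast h2)
  · obtain ⟨N₀, -, hN₀⟩ := hRV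
    -- The count of RV primes is only used for N ≥ 3 log ρ / r, so ρ ≥ q^{N₀} keeps N beyond the
    -- threshold N₀, at the expense of the constant.
    set ρ := max (Φ.c0 r) ((q F : ℝ) ^ N₀) with hρ
    have hc0 := Φ.one_lt_c0 hr₀
    have hρ0 : 0 < ρ := lt_of_lt_of_le (by linarith) (le_max_left _ _)
    refine ⟨min (Φ.bigC0 r) (Φ.lowerConst r ρ), lt_min (Φ.bigC0_pos hr₀)
      (Φ.lowerConst_pos hr₀ hρ0), min_le_left _ _, fun x hx hsep => ?_⟩
    refine le_trans (mul_le_mul_of_nonneg_right (min_le_right _ _) (Φ.bound_nonneg r _))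
      (Φ.lowerConst_mul_bound_le hr₀ hr₁ (le_max_left _ _) (fun N hN => ?_) hx hsep)
    refine hN₀ N ?_
    have h1 : (N₀ : ℝ) ≤ Real.logb (q F) ρ := by
      rw [Real.le_logb_iff_rpow_le hq hρ0, Real.rpow_natCast]
      exact le_max_right _ _
    have h2 : Real.logb (q F) ρ ≤ 3 * Real.logb (q F) ρ / r := by
      have h0 : (0 : ℝ) ≤ Real.logb (q F) ρ := le_trans (Nat.cast_nonneg _) h1
      rw [le_div_iff₀ hr₀]
      nlinarith
    exact_mod_cast h1.trans (h2.trans hN)
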